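/- **Setting.** Let $\mathfrak g$ be a complex Lie algebra and let $U_\hbar\mathfrak g$ be a quantum universal enveloping algebra: a topological Hopf algebra over $\mathbb C[[\hbar]]$, with underlying $\mathbb C[[\hbar]]$-module $U\mathfrak g[[\hbar]]$ and unit $1$, whose product, coproduct $\Delta_0$ and counit $\epsilon_0$ reduce modulo $\hbar$ to those of $U\mathfrak g$. Let $\eta\subset\mathfrak g$ be a finite-dimensional abelian Lie subalgebra such that $U\eta[[\hbar]]$ is a commutative Hopf subalgebra of $U_\hbar\mathfrak g$, that is, the elements of $\eta$ commute with each other in $U_\hbar\mathfrak g$ and $\Delta_0h=h\otimes1+1\otimes h$ for $h\in\eta$. Let $h_1,\dots,h_r$ be a basis of $\eta$ and $\lambda_1,\dots,\lambda_r$ the corresponding linear coordinates on $\eta^*$. All tensor products below are completed in the $\hbar$-adic topology. Let $\mathcal M(\eta^*)$ be the algebra of meromorphic functions on $\eta^*$ and $\mathcal D$ the algebra of meromorphic differential operators on $\eta^*$, generated by $\mathcal M(\eta^*)$ and the $\partial/\partial\lambda_i$. The algebra $H=\mathcal D\otimes U_\hbar\mathfrak g$ is a Hopf algebroid over $R=\mathcal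 M(\eta^*)[[\hbar]]$: source and target are both the inclusion $R\to H$, so that $fx\otimes_R y=x\otimes_R fy$ in $H\otimes_RH$ for $f\in R$; the coproduct $\Delta:H\to H\otimes_RH$ is multiplicative with $\Delta f=f\otimes_R1$ for $f\in R$, $\Delta\frac{\partial}{\partial\lambda_i}=\frac{\partial}{\partial\lambda_i}\otimes_R1+1\otimes_R\frac{\partial}{\partial\lambda_i}$ and $\Delta u=\Delta_0u$ for $u\in U_\hbar\mathfrak g$; the counit is $\epsilon(D\otimes u)=\epsilon_0(u)\,D(1)$. An element $\mathcal F=\sum_ix_i\otimes_Ry_i\in H\otimes_RH$ is called a *twistor* here if it satisfies the twistor equations $$(\Delta\otimes_R\mathrm{id})\mathcal F\cdot\mathcal F^{12}=(\mathrm{id}\otimes_R\Delta)\mathcal F\cdot\mathcal F^{23}\ \text{ in } H\otimes_RH\otimes_RH,\qquad (\epsilon\otimes_R\mathrm{id})\mathcal F=(\mathrm{id}\otimes_R\epsilon)\mathcal F=1,$$ where the first equation means $\sum_{i,j}\Delta(x_i)(x_j\otimes y_j)\otimes_Ry_i=\sum_{i,j}x_i\otimes_R\Delta(y_i)(x_j\otimes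 y_j)$. Let $\Theta=\exp\bigl(\hbar\sum_i\frac{\partial}{\partial\lambda_i}\otimes h_i\bigr)\in H\otimes H$. Let $F$ be a meromorphic function on $\eta^*$ with values in $U_\hbar\mathfrak g\otimes U_\hbar\mathfrak g$, that is, a formal power series in $\hbar$ with coefficients in $\mathcal M(\eta^*)\otimes_{\mathbb C}(U\mathfrak g\otimes_{\mathbb C}U\mathfrak g)$; it is regarded as an element of $H\otimes_RH$, and $F(\lambda)\Theta\in H\otimes_RH$ is its product with $\Theta$. Set $$F^{12}(\lambda+\hbar h^{(3)})=\sum_{k\ge0}\frac{\hbar^k}{k!}\sum_{i_1,\dots,i_k}\frac{\partial^kF}{\partial\lambda_{i_1}\cdots\partial\lambda_{i_k}}\otimes h_{i_1}\cdots h_{i_k},\qquad F^{23}(\lambda)=1\otimes F(\lambda).$$ **Theorem.** Assume that $F$ is of zero weight, i.e. $[F(\lambda),\,1\otimes h+h\otimes1]=0$ for all $h\in\eta$. Then $F(\lambda)\Theta$ is a twistor if and only if $F$ satisfies both the shifted cocycle equation $$[(\Delta_0\otimes\mathrm{id})F(\lambda)]\;F^{12}(\lambda+\hbar h^{(3)})=[(\mathrm{id}\otimes\Delta_0)F(\lambda)]\;F^{23}(\lambda)$$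 and the normalisation $$(\epsilon_0\otimes\mathrm{id})F(\lambda)=1,\qquad(\mathrm{id}\otimes\epsilon_0)F(\lambda)=1.$$ -/

import Mathlib

open scoped TensorProduct

/-! ### Meromorphic functions on `η* ≅ ℂ^r`, in the linear coordinates `(λ_1, …, λ_r)` -/

section Meromorphic
open Filter Topology

/-- The filter of sets containing a dense open set. -/
def denseOpen (X : Type*) [TopologicalSpace X] : Filter X where
  sets := {s | ∃ U ⊆ s, IsOpen U ∧ Dense U}
  univ_sets := ⟨Set.univ, subset_rfl, isOpen_univ, dense_univ⟩
  sets_of_superset := fun ⟨U, h, hU⟩ hst => ⟨U, h.trans hst, hU⟩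
  inter_sets := fun ⟨U, h, hU, dU⟩ ⟨V, h', hV, dV⟩ =>
    ⟨U ∩ V, Set.inter_subset_inter h h', hU.inter hV, dU.inter_of_isOpen_left dV hU⟩

lemma exists_open_of_eventually_inf {X : Type*} [TopologicalSpace X] {p : X → Prop} {x : X}
    (h : ∀ᶠ y in 𝓝 x ⊓ denseOpen X, p y) :
    ∃ V W : Set X, IsOpen V ∧ x ∈ V ∧ IsOpen W ∧ Dense W ∧ ∀ y ∈ V ∩ W, p y := by
  obtain ⟨s, hs, t, ht, hst⟩ := Filter.mem_inf_iff_superset.1 h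
  obtain ⟨W, hWt, hW, dW⟩ := ht
  obtain ⟨V, hVs, hV, hx⟩ := mem_nhds_iff.1 hs
  exact ⟨V, W, hV, hx, hW, dW, fun y hy => hst ⟨hVs hy.1, hWt hy.2⟩⟩

lemma eventually_denseOpen_of_local {X : Type*} [TopologicalSpace X] {p : X → Prop}
    (h : ∀ x, ∀ᶠ y in 𝓝 x ⊓ denseOpen X, p y) : ∀ᶠ y in denseOpen X, p y := by
  have key := fun x => exists_open_of_eventually_inf (h x)
  choose V W hV hx hW dW hp using key
  refine ⟨⋃ x, V x ∩ W x, ?_, isOpen_iUnion fun x => (hV x).inter (hW x), ?_⟩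
  · intro y hy
    obtain ⟨x, hy⟩ := Set.mem_iUnion.1 hy
    exact hp x y hy
  · intro z
    rw [mem_closure_iff]
    intro o ho hz
    obtain ⟨y, hy, hyW⟩ := (dW z).inter_open_nonempty (o ∩ V z) (ho.inter (hV z)) ⟨z, hz, hx z⟩
    exact ⟨y, hy.1, Set.mem_iUnion.2 ⟨z, hy.2, hyW⟩⟩

/-- `f` is locally a quotient of holomorphic functions: near every point `f = p / q` off a closed
nowhere dense set, where `p, q` are holomorphic near the point and the zero set of `q` is nowhere
dense (that is, `q` is not a zero divisor in the ring of germs). The values of `f` on a closed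
nowhere dense set do not matter; see `Mero`. -/
def IsMeromorphicFn {r : ℕ} (f : (Fin r → ℂ) → ℂ) : Prop :=
  ∀ x, ∃ p q : (Fin r → ℂ) → ℂ, AnalyticAt ℂ p x ∧ AnalyticAt ℂ q x ∧
    ∀ᶠ y in 𝓝 x ⊓ denseOpen (Fin r → ℂ), q y ≠ 0 ∧ f y = p y / q y

/-- The algebra of functions that are locally quotients of holomorphic functions. -/
def meroFn (r : ℕ) : Subalgebra ℂ ((Fin r → ℂ) → ℂ) where
  carrier := {f | IsMeromorphicFn f}
  mul_mem' := by
    intro f g hf hg x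
    obtain ⟨p, q, hp, hq, h⟩ := hf x
    obtain ⟨p', q', hp', hq', h'⟩ := hg x
    refine ⟨p * p', q * q', hp.mul hp', hq.mul hq', ?_⟩
    filter_upwards [h, h'] with y hy hy'
    exact ⟨mul_ne_zero hy.1 hy'.1, by simp [hy.2, hy'.2, div_mul_div_comm]⟩
  add_mem' := by
    intro f g hf hg x
    obtain ⟨p, q, hp, hq, h⟩ := hf x
    obtain ⟨p', q', hp', hq', h'⟩ := hg x
    refine ⟨p * q' + q * p', q * q', (hp.mul hq').add (hq.mul hp'), hq.mul hq', ?_⟩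
    filter_upwards [h, h'] with y hy hy'
    exact ⟨mul_ne_zero hy.1 hy'.1, by simp [hy.2, hy'.2, div_add_div _ _ hy.1 hy'.1]⟩
  algebraMap_mem' := fun c x => ⟨fun _ => c, fun _ => 1, analyticAt_const, analyticAt_const,
    Eventually.of_forall fun y => by simp⟩

/-- The ideal of functions vanishing off a closed nowhere dense set. -/
def meroNull (r : ℕ) : Ideal (meroFn r) where
  carrier := {f | ∀ᶠ y in denseOpen (Fin r → ℂ), f.1 y = 0}
  add_mem' := by
    intro f g hf hg
    simp only [Set.mem_ofPred_eq] at hf hg ⊢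
    filter_upwards [hf, hg] with y h h'
    simp [h, h']
  zero_mem' := by simp
  smul_mem' := by
    intro c f hf
    simp only [Set.mem_ofPred_eq] at hf ⊢
    filter_upwards [hf] with y h
    simp [h]

/-- The algebra `ℳ(ℂ^r)` of meromorphic functions on `ℂ^r`: functions that are locally quotients of
holomorphic functions, two of them being identified if they agree on a dense open set. -/
def Mero (r : ℕ) : Type := meroFn r ⧸ meroNull r

noncomputable instance (r : ℕ) : CommRing (Mero r) :=
  inferInstanceAs (CommRing (meroFn r ⧸ meroNull r))
noncomputable instance (r : ℕ) : Algebra ℂ (Mero r) :=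
  inferInstanceAs (Algebra ℂ (meroFn r ⧸ meroNull r))

/-- The meromorphic function represented by `f`. -/
def Mero.mk {r : ℕ} : meroFn r →ₐ[ℂ] Mero r := Ideal.Quotient.mkₐ ℂ (meroNull r)

lemma Mero.mk_surjective {r : ℕ} : Function.Surjective (Mero.mk (r := r)) :=
  Ideal.Quotient.mkₐ_surjective ℂ _

lemma Mero.mk_eq_mk {r : ℕ} {f g : meroFn r} :
    Mero.mk f = Mero.mk g ↔ ∀ᶠ y in denseOpen (Fin r → ℂ), f.1 y = g.1 y := by
  refine (Ideal.Quotient.eq (I := meroNull r)).trans ?_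
  change (∀ᶠ y in denseOpen (Fin r → ℂ), (f - g).1 y = 0) ↔ _
  simp [sub_eq_zero]


lemma eventually_nhds_of_eventually_inf {X : Type*} [TopologicalSpace X] {p : X → Prop} {x : X}
    (h : ∀ᶠ y in 𝓝 x ⊓ denseOpen X, p y) :
    ∀ᶠ y in 𝓝 x ⊓ denseOpen X, ∀ᶠ z in 𝓝 y, p z := by
  obtain ⟨V, W, hV, hx, hW, dW, H⟩ := exists_open_of_eventually_inf h
  refine Filter.mem_inf_iff_superset.2 ⟨V, hV.mem_nhds hx, W, ⟨W, subset_rfl, hW, dW⟩, ?_⟩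
  intro y hy
  filter_upwards [(hV.inter hW).mem_nhds hy] with z hz using H z hz

lemma eventually_nhds_of_eventually {X : Type*} [TopologicalSpace X] {p : X → Prop}
    (h : ∀ᶠ y in denseOpen X, p y) : ∀ᶠ y in denseOpen X, ∀ᶠ z in 𝓝 y, p z := by
  obtain ⟨W, H, hW, dW⟩ := h
  exact ⟨W, fun y hy => Filter.mem_of_superset (hW.mem_nhds hy) H, hW, dW⟩

lemma IsMeromorphicFn.eventually_analyticAt {r : ℕ} {f : (Fin r → ℂ) → ℂ}
    (hf : IsMeromorphicFn f) : ∀ᶠ y in denseOpen (Fin r → ℂ), AnalyticAt ℂ f y := by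
  refine eventually_denseOpen_of_local fun x => ?_
  obtain ⟨p, q, hp, hq, h⟩ := hf x
  filter_upwards [eventually_nhds_of_eventually_inf h,
    Filter.mem_inf_of_left hp.eventually_analyticAt,
    Filter.mem_inf_of_left hq.eventually_analyticAt] with y hy hp hq
  exact (hp.div hq hy.self_of_nhds.1).congr (hy.mono fun z hz => hz.2.symm)

/-- The partial derivative `∂f/∂λ_i` of a representative. -/
noncomputable def pderivFn {r : ℕ} (i : Fin r) (f : meroFn r) : meroFn r :=
  ⟨fun x => fderiv ℂ f.1 x (Pi.single i 1), by
    intro x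
    obtain ⟨p, q, hp, hq, h⟩ := f.2 x
    have hd : ∀ {g : (Fin r → ℂ) → ℂ}, AnalyticAt ℂ g x →
        AnalyticAt ℂ (fun y => fderiv ℂ g y (Pi.single i 1)) x := fun {g} hg =>
      ((ContinuousLinearMap.apply ℂ ℂ (Pi.single i 1 : Fin r → ℂ)).analyticAt _).comp hg.fderiv
    refine ⟨fun y => fderiv ℂ p y (Pi.single i 1) * q y - p y * fderiv ℂ q y (Pi.single i 1),
      fun y => q y * q y, ((hd hp).mul hq).sub (hp.mul (hd hq)), hq.mul hq, ?_⟩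
    filter_upwards [eventually_nhds_of_eventually_inf h,
      Filter.mem_inf_of_left hp.eventually_analyticAt,
      Filter.mem_inf_of_left hq.eventually_analyticAt] with y hy hp hq
    have h0 := hy.self_of_nhds.1
    refine ⟨mul_ne_zero h0 h0, ?_⟩
    have hf : DifferentiableAt ℂ f.1 y := ((hp.div hq h0).congr
      (hy.mono fun z hz => hz.2.symm)).differentiableAt
    have e : p =ᶠ[𝓝 y] f.1 * q := hy.mono fun z hz => by
      rw [Pi.mul_apply, hz.2, div_mul_cancel₀ _ hz.1]
    change fderiv ℂ f.1 y _ = _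
    rw [e.fderiv_eq, fderiv_mul hf hq.differentiableAt, e.self_of_nhds]
    simp
    field_simp
    ring⟩

lemma pderivFn_congr {r : ℕ} (i : Fin r) {f g : meroFn r} (h : Mero.mk f = Mero.mk g) :
    Mero.mk (pderivFn i f) = Mero.mk (pderivFn i g) := by
  rw [Mero.mk_eq_mk] at h ⊢
  filter_upwards [eventually_nhds_of_eventually h] with y hy
  change fderiv ℂ f.1 y _ = fderiv ℂ g.1 y _
  rw [Filter.EventuallyEq.fderiv_eq hy]

lemma pderivFn_add {r : ℕ} (i : Fin r) (f g : meroFn r) :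
    Mero.mk (pderivFn i (f + g)) = Mero.mk (pderivFn i f) + Mero.mk (pderivFn i g) := by
  rw [← map_add, Mero.mk_eq_mk]
  filter_upwards [f.2.eventually_analyticAt, g.2.eventually_analyticAt] with y hf hg
  change fderiv ℂ (f.1 + g.1) y _ = fderiv ℂ f.1 y _ + fderiv ℂ g.1 y _
  rw [fderiv_add hf.differentiableAt hg.differentiableAt]
  rfl

lemma pderivFn_smul {r : ℕ} (i : Fin r) (c : ℂ) (f : meroFn r) :
    Mero.mk (pderivFn i (c • f)) = c • Mero.mk (pderivFn i f) := by
  rw [← map_smul, Mero.mk_eq_mk]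
  filter_upwards [f.2.eventually_analyticAt] with y hf
  change fderiv ℂ (c • f.1) y _ = c • fderiv ℂ f.1 y _
  rw [fderiv_const_smul hf.differentiableAt]
  rfl

lemma pderivFn_mul {r : ℕ} (i : Fin r) (f g : meroFn r) :
    Mero.mk (pderivFn i (f * g)) =
      Mero.mk f * Mero.mk (pderivFn i g) + Mero.mk g * Mero.mk (pderivFn i f) := by
  rw [← map_mul, ← map_mul, ← map_add, Mero.mk_eq_mk]
  filter_upwards [f.2.eventually_analyticAt, g.2.eventually_analyticAt] with y hf hg
  change fderiv ℂ (f.1 * g.1) y _ = f.1 y * fderiv ℂ g.1 y _ + g.1 y * fderiv ℂ f.1 y _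
  rw [fderiv_mul hf.differentiableAt hg.differentiableAt]
  simp

/-- The derivation `∂/∂λ_i` of the algebra of meromorphic functions. -/
noncomputable def Mero.pderiv {r : ℕ} (i : Fin r) : Derivation ℂ (Mero r) (Mero r) :=
  Derivation.mk'
    { toFun := Quotient.lift (s := Submodule.quotientRel (meroNull r))
        (fun f => Mero.mk (pderivFn i f)) fun f g h =>
          pderivFn_congr i (Quotient.sound h)
      map_add' := by
        intro a b
        obtain ⟨f, rfl⟩ := Mero.mk_surjective a
        obtain ⟨g, rfl⟩ := Mero.mk_surjective b
        exact pderivFn_add i f g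
      map_smul' := by
        intro c a
        obtain ⟨f, rfl⟩ := Mero.mk_surjective a
        exact pderivFn_smul i c f }
    (by
      intro a b
      obtain ⟨f, rfl⟩ := Mero.mk_surjective a
      obtain ⟨g, rfl⟩ := Mero.mk_surjective b
      exact pderivFn_mul i f g)

lemma Mero.pderiv_mk {r : ℕ} (i : Fin r) (f : meroFn r) :
    Mero.pderiv i (Mero.mk f) = Mero.mk (pderivFn i f) := rfl

lemma Mero.pderiv_comm {r : ℕ} (i j : Fin r) (a : Mero r) :
    Mero.pderiv i (Mero.pderiv j a) = Mero.pderiv j (Mero.pderiv i a) := by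
  obtain ⟨f, rfl⟩ := Mero.mk_surjective a
  simp only [Mero.pderiv_mk]
  rw [Mero.mk_eq_mk]
  filter_upwards [f.2.eventually_analyticAt] with y hf
  have hd : DifferentiableAt ℂ (fderiv ℂ f.1) y := hf.fderiv.differentiableAt
  have key : ∀ k l : Fin r, (pderivFn k (pderivFn l f)).1 y =
      fderiv ℂ (fderiv ℂ f.1) y (Pi.single k 1) (Pi.single l 1) := by
    intro k l
    change fderiv ℂ (fun x => fderiv ℂ f.1 x (Pi.single l 1)) y (Pi.single k 1) = _
    rw [fderiv_clm_apply hd (differentiableAt_const _)]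
    simp
  rw [key, key]
  exact (hf.contDiffAt.isSymmSndFDerivAt_of_omega).eq _ _

end Meromorphic

/-! ### Meromorphic differential operators -/

section DifferentialOperators

/-- The relations between meromorphic functions and the `∂_i`; see `DiffPres`. -/
inductive DiffPresRel (r : ℕ) :
    FreeAlgebra ℂ (Mero r ⊕ Fin r) → FreeAlgebra ℂ (Mero r ⊕ Fin r) → Prop
  | add (f g : Mero r) : DiffPresRel r (FreeAlgebra.ι ℂ (.inl (f + g)))
      (FreeAlgebra.ι ℂ (.inl f) + FreeAlgebra.ι ℂ (.inl g))
  | mul (f g : Mero r) : DiffPresRel r (FreeAlgebra.ι ℂ (.inl (f * g)))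
      (FreeAlgebra.ι ℂ (.inl f) * FreeAlgebra.ι ℂ (.inl g))
  | const (c : ℂ) : DiffPresRel r (FreeAlgebra.ι ℂ (.inl (algebraMap ℂ (Mero r) c)))
      (algebraMap ℂ _ c)
  | leibniz (i : Fin r) (f : Mero r) : DiffPresRel r
      (FreeAlgebra.ι ℂ (.inr i) * FreeAlgebra.ι ℂ (.inl f))
      (FreeAlgebra.ι ℂ (.inl f) * FreeAlgebra.ι ℂ (.inr i) +
        FreeAlgebra.ι ℂ (.inl (Mero.pderiv i f)))
  | comm (i j : Fin r) : DiffPresRel r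
      (FreeAlgebra.ι ℂ (.inr i) * FreeAlgebra.ι ℂ (.inr j))
      (FreeAlgebra.ι ℂ (.inr j) * FreeAlgebra.ι ℂ (.inr i))

/-- The algebra generated by the algebra of meromorphic functions and `∂_1, …, ∂_r` with the
relations `∂_i f = f ∂_i + ∂f/∂λ_i` and `∂_i ∂_j = ∂_j ∂_i`. It is shown below to be isomorphic to
the algebra `DiffOp r` of differential operators, and is used only to construct maps out of it. -/
def DiffPres (r : ℕ) : Type := RingQuot (DiffPresRel r)

noncomputable instance (r : ℕ) : Ring (DiffPres r) :=
  inferInstanceAs (Ring (RingQuot (DiffPresRel r)))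
noncomputable instance (r : ℕ) : Algebra ℂ (DiffPres r) :=
  inferInstanceAs (Algebra ℂ (RingQuot (DiffPresRel r)))

namespace DiffPres
variable {r : ℕ}

/-- The projection from the free algebra. -/
noncomputable def mk : FreeAlgebra ℂ (Mero r ⊕ Fin r) →ₐ[ℂ] DiffPres r :=
  RingQuot.mkAlgHom ℂ (DiffPresRel r)

lemma mk_rel {x y : FreeAlgebra ℂ (Mero r ⊕ Fin r)} (h : DiffPresRel r x y) : mk x = mk y :=
  RingQuot.mkAlgHom_rel ℂ h

/-- `∂/∂λ_i` as an element of `DiffPres`. -/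
noncomputable def partial_ (i : Fin r) : DiffPres r := mk (FreeAlgebra.ι ℂ (.inr i))

/-- A meromorphic function as an element of `DiffPres`. -/
noncomputable def ofMero : Mero r →ₐ[ℂ] DiffPres r :=
  AlgHom.ofLinearMap
    { toFun := fun f => mk (FreeAlgebra.ι ℂ (.inl f))
      map_add' := fun f g => by rw [mk_rel (.add f g), map_add]
      map_smul' := fun c f => by
        rw [Algebra.smul_def c f, mk_rel (.mul _ f), map_mul, mk_rel (.const c), AlgHom.commutes,
          RingHom.id_apply, Algebra.smul_def] }
    (by
      have h := mk_rel (r := r) (.const 1)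
      rw [map_one, map_one, map_one] at h
      exact h)
    (fun f g => by
      change mk _ = mk _ * mk _
      rw [mk_rel (.mul f g), map_mul])

lemma partial_mul_ofMero (i : Fin r) (f : Mero r) :
    partial_ i * ofMero f = ofMero f * partial_ i + ofMero (Mero.pderiv i f) := by
  have h := mk_rel (.leibniz i f)
  rwa [map_add, map_mul, map_mul] at h

lemma partial_comm (i j : Fin r) :
    (partial_ i * partial_ j : DiffPres r) = partial_ j * partial_ i := by
  have h := mk_rel (r := r) (.comm i j)
  rwa [map_mul, map_mul] at h

/-- The universal property of `DiffPres`. -/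
noncomputable def lift {A : Type*} [Ring A] [Algebra ℂ A] (φ : Mero r →ₐ[ℂ] A) (d : Fin r → A)
    (h : ∀ i f, d i * φ f = φ f * d i + φ (Mero.pderiv i f))
    (hc : ∀ i j, d i * d j = d j * d i) : DiffPres r →ₐ[ℂ] A :=
  RingQuot.liftAlgHom ℂ ⟨FreeAlgebra.lift ℂ (Sum.elim φ d), by
    rintro _ _ (⟨f, g⟩ | ⟨f, g⟩ | c | ⟨i, f⟩ | ⟨i, j⟩)
    · simp
    · simp
    · simp
    · simp [h]
    · simp [hc i j]⟩

section
variable {A : Type*} [Ring A] [Algebra ℂ A] (φ : Mero r →ₐ[ℂ] A) (d : Fin r → A)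
    (h : ∀ i f, d i * φ f = φ f * d i + φ (Mero.pderiv i f))
    (hc : ∀ i j, d i * d j = d j * d i)

lemma lift_mk (x : FreeAlgebra ℂ (Mero r ⊕ Fin r)) :
    lift φ d h hc (mk x) = FreeAlgebra.lift ℂ (Sum.elim φ d) x :=
  RingQuot.liftAlgHom_mkAlgHom_apply _ _ _ x

@[simp] lemma lift_ofMero (f : Mero r) : lift φ d h hc (ofMero f) = φ f :=
  (lift_mk φ d h hc _).trans (by simp)

@[simp] lemma lift_partial (i : Fin r) : lift φ d h hc (partial_ i) = d i :=
  (lift_mk φ d h hc _).trans (by simp)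

end

/-- The action on meromorphic functions. -/
noncomputable def toEnd : DiffPres r →ₐ[ℂ] Module.End ℂ (Mero r) :=
  lift (Algebra.lmul ℂ (Mero r)) (fun i => (Mero.pderiv i).toLinearMap)
    (fun i f => by
      ext g
      simp [mul_comm])
    (fun i j => by
      ext g
      exact Mero.pderiv_comm i j g)



/-- The coordinate function `λ_i`. -/
noncomputable def _root_.Mero.coord (i : Fin r) : Mero r :=
  Mero.mk ⟨fun x => x i, fun x => ⟨fun y => y i, fun _ => 1,
    (ContinuousLinearMap.proj (R := ℂ) (φ := fun _ : Fin r => ℂ) i).analyticAt x,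
    analyticAt_const, Filter.Eventually.of_forall fun y => by simp⟩⟩

lemma _root_.Mero.pderiv_coord (i j : Fin r) :
    Mero.pderiv i (Mero.coord j) = if i = j then 1 else 0 := by
  have h1 : (if i = j then 1 else 0 : Mero r) =
      Mero.mk (if i = j then 1 else 0) := by split_ifs <;> simp
  rw [h1, Mero.coord, Mero.pderiv_mk, Mero.mk_eq_mk]
  refine Filter.Eventually.of_forall fun y => ?_
  change fderiv ℂ (ContinuousLinearMap.proj (R := ℂ) (φ := fun _ : Fin r => ℂ) j) y
    (Pi.single i 1) = _
  rw [ContinuousLinearMap.fderiv]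
  by_cases h : i = j
  · subst h; simp
  · rw [if_neg h]; simp [Ne.symm h]

/-- The monomial `∂_{i₁} ⋯ ∂_{iₙ}`. -/
noncomputable def word (w : List (Fin r)) : DiffPres r := (w.map partial_).prod

/-- The operators of order at most `n`. -/
noncomputable def filt (n : ℕ) : Submodule ℂ (DiffPres r) :=
  Submodule.span ℂ {x | ∃ (f : Mero r) (w : List (Fin r)), w.length ≤ n ∧ x = ofMero f * word w}

/-- The commutator `[x, λ_i]`. -/
noncomputable def br (i : Fin r) : DiffPres r →ₗ[ℂ] DiffPres r :=
  LinearMap.mulRight ℂ (ofMero (Mero.coord i)) - LinearMap.mulLeft ℂ (ofMero (Mero.coord i))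

lemma br_apply (i : Fin r) (x : DiffPres r) :
   br i x = x * ofMero (Mero.coord i) - ofMero (Mero.coord i) * x := rfl

/-- The map `x ↦ ∑ i, [x, λ_i] ∂_i`, which multiplies `f ∂_{i₁} ⋯ ∂_{iₙ}` by `n`. -/
noncomputable def euler : DiffPres r →ₗ[ℂ] DiffPres r :=
  ∑ i, LinearMap.mulRight ℂ (partial_ i) ∘ₗ br i

lemma euler_apply (x : DiffPres r) : euler x = ∑ i, br i x * partial_ i := by
  simp [euler, LinearMap.sum_apply]

lemma br_mul (i : Fin r) (x y : DiffPres r) : br i (x * y) = br i x * y + x * br i y := by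
  simp only [br_apply]; noncomm_ring

lemma br_ofMero (i : Fin r) (f : Mero r) : br i (ofMero f) = 0 := by
  rw [br_apply, ← map_mul, ← map_mul, mul_comm, sub_self]

lemma br_partial (i j : Fin r) : br i (partial_ j) = if j = i then 1 else 0 := by
  rw [br_apply, partial_mul_ofMero, Mero.pderiv_coord]
  split_ifs <;> simp

lemma word_cons (i : Fin r) (w : List (Fin r)) : word (i :: w) = partial_ i * word w := by
  simp [word]

lemma commute_partial_word (i : Fin r) (w : List (Fin r)) :
    Commute (partial_ i : DiffPres r) (word w) := by
  induction w with
  | nil => exact Commute.one_right _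
  | cons j w ih => rw [word_cons]; exact (show Commute _ _ from partial_comm i j).mul_right ih

lemma euler_word (f : Mero r) (w : List (Fin r)) :
    euler (ofMero f * word w) = (w.length : ℂ) • (ofMero f * word w) := by
  have hw : euler (word w) = (w.length : ℂ) • word w := by
    induction w with
    | nil => simp [euler_apply, word, br_apply]
    | cons j w ih =>
      rw [euler_apply] at ih ⊢
      simp only [word_cons, br_mul, add_mul, Finset.sum_add_distrib, br_partial, mul_assoc,
        ← Finset.mul_sum, ih]
      simp [← (commute_partial_word _ _).eq, add_smul, add_comm]
  rw [euler_apply] at hw ⊢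
  simp only [br_mul, br_ofMero, zero_mul, zero_add, mul_assoc, ← Finset.mul_sum, hw, mul_smul_comm]


lemma br_word (i : Fin r) (w : List (Fin r)) :
    br i (word w) ∈ Submodule.span ℂ {x | ∃ w' : List (Fin r), w'.length + 1 = w.length ∧
      x = word w'} := by
  induction w with
  | nil => simp [word, br_apply]
  | cons j w ih =>
    rw [word_cons, br_mul, br_partial]
    refine add_mem ?_ ?_
    · split_ifs
      · exact Submodule.subset_span ⟨w, rfl, one_mul _⟩
      · simp
    · refine Submodule.span_induction (p := fun x _ => partial_ j * x ∈ _) ?_ ?_ ?_ ?_ ih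
      · rintro _ ⟨w', hw', rfl⟩
        exact Submodule.subset_span ⟨j :: w', by simp [hw'], (word_cons _ _).symm⟩
      · simp
      · intro x y _ _ hx hy; rw [mul_add]; exact add_mem hx hy
      · intro c x _ hx; rw [mul_smul_comm]; exact Submodule.smul_mem _ c hx

lemma br_mem (n : ℕ) (i : Fin r) {x : DiffPres r} (hx : x ∈ filt (n + 1)) : br i x ∈ filt n := by
  refine Submodule.span_induction (p := fun x _ => br i x ∈ filt n) ?_ ?_ ?_ ?_ hx
  · rintro _ ⟨f, w, hw, rfl⟩
    rw [br_mul, br_ofMero, zero_mul, zero_add]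
    refine Submodule.span_induction (p := fun x _ => ofMero f * x ∈ filt n) ?_ ?_ ?_ ?_
      (br_word i w)
    · rintro _ ⟨w', hw', rfl⟩
      exact Submodule.subset_span ⟨f, w', by omega, rfl⟩
    · simp
    · intro x y _ _ hx hy; rw [mul_add]; exact add_mem hx hy
    · intro c x _ hx; rw [mul_smul_comm]; exact Submodule.smul_mem _ c hx
  · simp
  · intro x y _ _ hx hy; rw [map_add]; exact add_mem hx hy
  · intro c x _ hx; rw [map_smul]; exact Submodule.smul_mem _ c hx

lemma filt_mono {m n : ℕ} (h : m ≤ n) : filt (r := r) m ≤ filt n :=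
  Submodule.span_mono fun _ ⟨f, w, hw, e⟩ => ⟨f, w, hw.trans h, e⟩

lemma ofMero_mul_mem {n : ℕ} (g : Mero r) {x : DiffPres r} (hx : x ∈ filt n) :
    ofMero g * x ∈ filt n := by
  refine Submodule.span_induction (p := fun x _ => ofMero g * x ∈ filt n) ?_ ?_ ?_ ?_ hx
  · rintro _ ⟨f, w, hw, rfl⟩
    exact Submodule.subset_span ⟨g * f, w, hw, by rw [map_mul, mul_assoc]⟩
  · simp
  · intro x y _ _ hx hy; rw [mul_add]; exact add_mem hx hy
  · intro c x _ hx; rw [mul_smul_comm]; exact Submodule.smul_mem _ c hx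

lemma partial_mul_mem {n : ℕ} (i : Fin r) {x : DiffPres r} (hx : x ∈ filt n) :
    partial_ i * x ∈ filt (n + 1) := by
  refine Submodule.span_induction (p := fun x _ => partial_ i * x ∈ filt (n + 1)) ?_ ?_ ?_ ?_ hx
  · rintro _ ⟨f, w, hw, rfl⟩
    rw [← mul_assoc, partial_mul_ofMero, add_mul, mul_assoc, ← word_cons]
    exact add_mem (Submodule.subset_span ⟨_, _, by simpa using hw, rfl⟩)
      (Submodule.subset_span ⟨_, _, by omega, rfl⟩)
  · simp
  · intro x y _ _ hx hy; rw [mul_add]; exact add_mem hx hy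
  · intro c x _ hx; rw [mul_smul_comm]; exact Submodule.smul_mem _ c hx

lemma exists_mem_filt (x : DiffPres r) : ∃ n, x ∈ filt n := by
  have key : ∀ a : FreeAlgebra ℂ (Mero r ⊕ Fin r), ∀ y : DiffPres r, (∃ n, y ∈ filt n) →
      ∃ n, mk a * y ∈ filt n := by
    intro a
    induction a using FreeAlgebra.induction with
    | grade0 c =>
      rintro y ⟨n, hy⟩
      refine ⟨n, ?_⟩
      rw [AlgHom.commutes, ← Algebra.smul_def]
      exact Submodule.smul_mem _ c hy
    | grade1 g =>
      rintro y ⟨n, hy⟩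
      rcases g with f | i
      · exact ⟨n, ofMero_mul_mem f hy⟩
      · exact ⟨n + 1, partial_mul_mem i hy⟩
    | mul a b ha hb =>
      intro y hy
      rw [map_mul, mul_assoc]
      exact ha _ (hb _ hy)
    | add a b ha hb =>
      intro y hy
      obtain ⟨m, hm⟩ := ha _ hy
      obtain ⟨n, hn⟩ := hb _ hy
      refine ⟨max m n, ?_⟩
      rw [map_add, add_mul]
      exact add_mem (filt_mono (le_max_left _ _) hm) (filt_mono (le_max_right _ _) hn)
  obtain ⟨a, rfl⟩ := RingQuot.mkAlgHom_surjective ℂ (DiffPresRel r) x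
  obtain ⟨n, hn⟩ := key a 1 ⟨0, Submodule.subset_span ⟨1, [], le_rfl, by simp [word]⟩⟩
  exact ⟨n, by rwa [mul_one] at hn⟩

/-- The operator `(euler - 1) ⋯ (euler - n)`. -/
noncomputable def eulerProd : ℕ → DiffPres r →ₗ[ℂ] DiffPres r
  | 0 => LinearMap.id
  | n + 1 => eulerProd n ∘ₗ (euler - ((n : ℂ) + 1) • LinearMap.id)

lemma eulerProd_apply (n : ℕ) (a : ℂ) {x : DiffPres r} (h : euler x = a • x) :
    eulerProd n x = (∏ k ∈ Finset.range n, (a - (k + 1))) • x := by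
  induction n with
  | zero => simp [eulerProd]
  | succ n ih =>
    rw [Finset.prod_range_succ, mul_comm, mul_smul, ← ih]
    simp [eulerProd, h, ← sub_smul]

lemma eulerProd_mem (n : ℕ) {x : DiffPres r} (hx : x ∈ filt n) :
    eulerProd n x ∈ LinearMap.range (ofMero (r := r)).toLinearMap := by
  refine Submodule.span_induction (p := fun x _ => eulerProd n x ∈ _) ?_ ?_ ?_ ?_ hx
  · rintro _ ⟨f, w, hw, rfl⟩
    rw [eulerProd_apply n _ (euler_word f w)]
    rcases w with _ | ⟨j, w⟩
    · exact Submodule.smul_mem _ _ ⟨f, by simp [word]⟩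
    · rw [Finset.prod_eq_zero (i := w.length) (by simpa using hw) (by simp), zero_smul]
      exact zero_mem _
  · simp
  · intro x y _ _ hx hy; rw [map_add]; exact add_mem hx hy
  · intro c x _ hx; rw [map_smul]; exact Submodule.smul_mem _ c hx

lemma toEnd_ofMero (f g : Mero r) : toEnd (ofMero f) g = f * g := by
  simp [toEnd]

/-- The algebra given by generators and relations acts faithfully on meromorphic functions. -/
theorem toEnd_injective : Function.Injective (toEnd (r := r)) := by
  have key : ∀ n : ℕ, ∀ x ∈ filt (r := r) n, toEnd x = 0 → x = 0 := by
    intro n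
    induction n with
    | zero =>
      intro x hx h0
      obtain ⟨f, rfl⟩ := eulerProd_mem 0 hx
      have h1 := LinearMap.congr_fun h0 1
      rw [AlgHom.toLinearMap_apply, toEnd_ofMero, mul_one, LinearMap.zero_apply] at h1
      rw [h1, map_zero]
    | succ n ih =>
      intro x hx h0
      have hb : ∀ i, br i x = 0 := fun i => ih _ (br_mem n i hx) (by
        rw [br_apply, map_sub, map_mul, map_mul, h0, zero_mul, mul_zero, sub_zero])
      have he : euler x = (0 : ℂ) • x := by simp [euler_apply, hb]
      have h2 := eulerProd_apply (n + 1) 0 he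
      obtain ⟨f, hf⟩ := eulerProd_mem (n + 1) hx
      have h3 : f = 0 := by
        have h4 := congrArg toEnd (hf.trans h2)
        rw [map_smul, h0, smul_zero] at h4
        simpa [toEnd_ofMero] using LinearMap.congr_fun h4 1
      rw [h3, map_zero, h2] at hf
      refine (smul_eq_zero.1 hf.symm).resolve_left ?_
      refine Finset.prod_ne_zero_iff.2 ?_
      intro k _
      rw [zero_sub, neg_ne_zero]
      exact_mod_cast Nat.succ_ne_zero k
  refine (injective_iff_map_eq_zero _).2 fun x hx => ?_
  obtain ⟨n, hn⟩ := exists_mem_filt x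
  exact key n x hn hx
end DiffPres


/-- The algebra `𝒟` of meromorphic differential operators: the algebra of operators on meromorphic
functions that is generated by the multiplications by meromorphic functions and the
`∂_i = ∂/∂λ_i`. -/
noncomputable def diffOpAlgebra (r : ℕ) : Subalgebra ℂ (Module.End ℂ (Mero r)) :=
  Algebra.adjoin ℂ (Set.range (Sum.elim (fun f : Mero r => Algebra.lmul ℂ (Mero r) f)
    (fun i : Fin r => (Mero.pderiv i).toLinearMap)))

/-- The type of meromorphic differential operators on `ℂ^r`. -/
def DiffOp (r : ℕ) : Type := diffOpAlgebra r

noncomputable instance (r : ℕ) : Ring (DiffOp r) := inferInstanceAs (Ring (diffOpAlgebra r))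
noncomputable instance (r : ℕ) : Algebra ℂ (DiffOp r) :=
  inferInstanceAs (Algebra ℂ (diffOpAlgebra r))

namespace DiffOp
variable {r : ℕ}

/-- The action of differential operators on meromorphic functions. -/
noncomputable def toEnd : DiffOp r →ₐ[ℂ] Module.End ℂ (Mero r) := (diffOpAlgebra r).val

lemma toEnd_injective : Function.Injective (toEnd (r := r)) := Subtype.val_injective

/-- `∂_i = ∂/∂λ_i` as a differential operator. -/
noncomputable def pd (i : Fin r) : DiffOp r :=
  (⟨(Mero.pderiv i).toLinearMap, Algebra.subset_adjoin ⟨.inr i, rfl⟩⟩ : diffOpAlgebra r)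

/-- A meromorphic function as a multiplication operator. -/
noncomputable def ofMero : Mero r →ₐ[ℂ] DiffOp r :=
  (Algebra.lmul ℂ (Mero r)).codRestrict (diffOpAlgebra r)
    fun f => Algebra.subset_adjoin ⟨.inl f, rfl⟩

lemma toEnd_ofMero (f g : Mero r) : toEnd (ofMero f) g = f * g := rfl

lemma toEnd_pd (i : Fin r) (g : Mero r) : toEnd (pd i) g = Mero.pderiv i g := rfl

lemma pd_mul_ofMero (i : Fin r) (f : Mero r) :
    pd i * ofMero f = ofMero f * pd i + ofMero (Mero.pderiv i f) := by
  refine toEnd_injective (LinearMap.ext fun g => ?_)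
  rw [map_mul, map_add, map_mul, LinearMap.add_apply, Module.End.mul_apply, Module.End.mul_apply,
    toEnd_ofMero, toEnd_ofMero, toEnd_ofMero, toEnd_pd, toEnd_pd, Derivation.leibniz, smul_eq_mul,
    smul_eq_mul, mul_comm g]

lemma pd_comm (i j : Fin r) : (pd i * pd j : DiffOp r) = pd j * pd i := by
  refine toEnd_injective (LinearMap.ext fun g => ?_)
  rw [map_mul, map_mul]
  exact Mero.pderiv_comm i j g

lemma range_toEnd : (DiffPres.toEnd (r := r)).range = diffOpAlgebra r := by
  rw [diffOpAlgebra, Algebra.adjoin_range_eq_range_freeAlgebra_lift]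
  ext x
  constructor
  · rintro ⟨y, rfl⟩
    obtain ⟨a, rfl⟩ := RingQuot.mkAlgHom_surjective ℂ (DiffPresRel r) y
    exact ⟨a, (DiffPres.lift_mk _ _ _ _ a).symm⟩
  · rintro ⟨a, rfl⟩
    exact ⟨DiffPres.mk a, DiffPres.lift_mk _ _ _ _ a⟩

/-- The presentation of the algebra of differential operators. -/
noncomputable def presEquiv : DiffPres r ≃ₐ[ℂ] DiffOp r :=
  (AlgEquiv.ofInjective _ DiffPres.toEnd_injective).trans (Subalgebra.equivOfEq _ _ range_toEnd)

lemma toEnd_presEquiv (x : DiffPres r) : toEnd (presEquiv x) = DiffPres.toEnd x := rfl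

lemma presEquiv_ofMero (f : Mero r) : presEquiv (DiffPres.ofMero f) = ofMero f :=
  toEnd_injective (LinearMap.ext fun g => DiffPres.toEnd_ofMero f g)

lemma presEquiv_partial (i : Fin r) : presEquiv (DiffPres.partial_ i) = pd i :=
  toEnd_injective (DiffPres.lift_partial _ _ _ _ i)

/-- The universal property of the algebra of differential operators. -/
noncomputable def lift {A : Type*} [Ring A] [Algebra ℂ A] (φ : Mero r →ₐ[ℂ] A) (d : Fin r → A)
    (h : ∀ i f, d i * φ f = φ f * d i + φ (Mero.pderiv i f))
    (hc : ∀ i j, d i * d j = d j * d i) : DiffOp r →ₐ[ℂ] A :=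
  (DiffPres.lift φ d h hc).comp presEquiv.symm.toAlgHom

section
variable {A : Type*} [Ring A] [Algebra ℂ A] (φ : Mero r →ₐ[ℂ] A) (d : Fin r → A)
    (h : ∀ i f, d i * φ f = φ f * d i + φ (Mero.pderiv i f))
    (hc : ∀ i j, d i * d j = d j * d i)

@[simp] lemma lift_ofMero (f : Mero r) : lift φ d h hc (ofMero f) = φ f := by
  rw [← presEquiv_ofMero]
  simp [lift]

@[simp] lemma lift_pd (i : Fin r) : lift φ d h hc (pd i) = d i := by
  rw [← presEquiv_partial]
  simp [lift]

end

/-- Functions act on differential operators by left multiplication. -/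
noncomputable instance : Module (Mero r) (DiffOp r) :=
  Module.compHom (DiffOp r) (ofMero (r := r)).toRingHom

lemma smul_def (f : Mero r) (d : DiffOp r) : f • d = ofMero f * d := rfl

instance : IsScalarTower ℂ (Mero r) (DiffOp r) :=
  ⟨fun c f d => by simp [smul_def]⟩
instance : SMulCommClass ℂ (Mero r) (DiffOp r) :=
  ⟨fun c f d => by simp [smul_def]⟩
instance : SMulCommClass (Mero r) ℂ (DiffOp r) := SMulCommClass.symm _ _ _
instance : IsScalarTower (Mero r) (DiffOp r) (DiffOp r) :=
  ⟨fun c f d => by simp [smul_def, mul_assoc]⟩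

/-- The counit of `𝒟`: the zeroth order part `d ↦ d(1)` of a differential operator. -/
noncomputable def evalOne : DiffOp r →ₗ[Mero r] Mero r where
  toFun d := toEnd d 1
  map_add' := by simp
  map_smul' := by
    intro f d
    rw [smul_def, map_mul, Module.End.mul_apply, toEnd_ofMero]
    rfl

end DiffOp
end DifferentialOperators

/-! ### Topologically free modules over `ℂ⟦ħ⟧`

A sequence `v : ℕ → V` stands for the formal power series `∑ ħⁿ vₙ` in `V⟦ħ⟧`. The completed tensor
product of `V⟦ħ⟧` and `W⟦ħ⟧` is `(V ⊗ W)⟦ħ⟧`, and a sequence `φ` of linear maps `V → W` stands for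
the `ħ`-linear map `∑ ħⁿ φₙ` from `V⟦ħ⟧` to `W⟦ħ⟧`. -/

section FormalSeries

/-- The value `(∑ ħⁿ φₙ)(∑ ħⁿ vₙ)`. -/
noncomputable def happ {S V W : Type*} [Semiring S] [AddCommMonoid V] [AddCommMonoid W]
    [Module S V] [Module S W] (φ : ℕ → V →ₗ[S] W) (v : ℕ → V) : ℕ → W :=
  fun n => ∑ p ∈ Finset.HasAntidiagonal.antidiagonal n, φ p.1 (v p.2)

/-- The value of the bilinear map `∑ ħⁿ μₙ` at the pair `(∑ ħⁿ vₙ, ∑ ħⁿ wₙ)`. -/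
noncomputable def hmul {V W Z : Type*} [AddCommGroup V] [AddCommGroup W] [AddCommGroup Z]
    [Module ℂ V] [Module ℂ W] [Module ℂ Z] (μ : ℕ → V →ₗ[ℂ] W →ₗ[ℂ] Z) (v : ℕ → V) (w : ℕ → W) :
    ℕ → Z :=
  happ (happ μ v) w

/-- The series `v + 0 ħ + 0 ħ² + ⋯`. -/
def hconst {V : Type*} [Zero V] (v : V) : ℕ → V := Pi.single 0 v

/-- The product on the completed tensor product of two algebras `V⟦ħ⟧` and `W⟦ħ⟧` with products
`∑ ħⁿ μₙ` and `∑ ħⁿ νₙ`. -/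
noncomputable def tensorMul {V W : Type*} [AddCommGroup V] [AddCommGroup W]
    [Module ℂ V] [Module ℂ W] (μ : ℕ → V →ₗ[ℂ] V →ₗ[ℂ] V) (ν : ℕ → W →ₗ[ℂ] W →ₗ[ℂ] W) :
    ℕ → (V ⊗[ℂ] W) →ₗ[ℂ] (V ⊗[ℂ] W) →ₗ[ℂ] (V ⊗[ℂ] W) :=
  fun n => ∑ p ∈ Finset.HasAntidiagonal.antidiagonal n, TensorProduct.map₂ (μ p.1) (ν p.2)

end FormalSeries

/-! ### Quantum universal enveloping algebras -/

section QUE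

/-- The universal enveloping algebra of a complex Lie algebra. -/
abbrev UEA (𝔤 : Type*) [LieRing 𝔤] [LieAlgebra ℂ 𝔤] := UniversalEnvelopingAlgebra ℂ 𝔤

namespace UEA
variable (𝔤 : Type*) [LieRing 𝔤] [LieAlgebra ℂ 𝔤]

attribute [local instance] LieRing.ofAssociativeRing

/-- The inclusion `𝔤 → U𝔤`. -/
noncomputable def of : 𝔤 →ₗ[ℂ] UEA 𝔤 := (UniversalEnvelopingAlgebra.ι ℂ).toLinearMap

/-- The coproduct of `U𝔤`, with `x ↦ x ⊗ 1 + 1 ⊗ x` for `x` in `𝔤`. -/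
noncomputable def comul : UEA 𝔤 →ₐ[ℂ] UEA 𝔤 ⊗[ℂ] UEA 𝔤 :=
  UniversalEnvelopingAlgebra.lift ℂ
    { toFun := fun x =>
        UniversalEnvelopingAlgebra.ι ℂ x ⊗ₜ 1 + 1 ⊗ₜ UniversalEnvelopingAlgebra.ι ℂ x
      map_add' := fun x y => by
        simp only [map_add, TensorProduct.add_tmul, TensorProduct.tmul_add]; abel
      map_smul' := fun c x => by
        simp [TensorProduct.smul_tmul']
      map_lie' := by
        intro x y
        simp only [LieHom.map_lie, Ring.lie_def, mul_add, add_mul,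
          Algebra.TensorProduct.tmul_mul_tmul, one_mul, mul_one, TensorProduct.sub_tmul,
          TensorProduct.tmul_sub]
        abel }

/-- The counit of `U𝔤`, with `x ↦ 0` for `x` in `𝔤`. -/
noncomputable def counit : UEA 𝔤 →ₐ[ℂ] ℂ := UniversalEnvelopingAlgebra.lift ℂ 0

end UEA

/-- A quantum universal enveloping algebra `U_ħ𝔤`: a topological Hopf algebra over `ℂ⟦ħ⟧` with
underlying module `U𝔤⟦ħ⟧` and unit `1`, whose product, coproduct and counit reduce modulo `ħ` to
those of `U𝔤`. -/
structure QUEAlgebra (𝔤 : Type*) [LieRing 𝔤] [LieAlgebra ℂ 𝔤] where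
  mul : ℕ → UEA 𝔤 →ₗ[ℂ] UEA 𝔤 →ₗ[ℂ] UEA 𝔤
  comul : ℕ → UEA 𝔤 →ₗ[ℂ] UEA 𝔤 ⊗[ℂ] UEA 𝔤
  counit : ℕ → UEA 𝔤 →ₗ[ℂ] ℂ
  antipode : ℕ → UEA 𝔤 →ₗ[ℂ] UEA 𝔤
  mul_limit : mul 0 = LinearMap.mul ℂ (UEA 𝔤)
  comul_limit : comul 0 = (UEA.comul 𝔤).toLinearMap
  counit_limit : counit 0 = (UEA.counit 𝔤).toLinearMap
  mul_assoc : ∀ x y z, hmul mul (hmul mul x y) z = hmul mul x (hmul mul y z)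
  one_mul : ∀ x, hmul mul (hconst 1) x = x
  mul_one : ∀ x, hmul mul x (hconst 1) = x
  comul_mul : ∀ x y, happ comul (hmul mul x y) =
    hmul (tensorMul mul mul) (happ comul x) (happ comul y)
  comul_one : happ comul (hconst 1) = hconst (1 ⊗ₜ 1)
  counit_mul : ∀ x y, happ counit (hmul mul x y) =
    hmul (hconst (LinearMap.mul ℂ ℂ)) (happ counit x) (happ counit y)
  counit_one : happ counit (hconst 1) = hconst 1
  coassoc : ∀ x, happ (hconst (TensorProduct.assoc ℂ (UEA 𝔤) (UEA 𝔤) (UEA 𝔤)).toLinearMap)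
      (happ (fun n => (comul n).rTensor (UEA 𝔤)) (happ comul x)) =
    happ (fun n => (comul n).lTensor (UEA 𝔤)) (happ comul x)
  rTensor_counit_comul : ∀ x, happ (fun n => TensorProduct.lid ℂ (UEA 𝔤) ∘ₗ
    (counit n).rTensor (UEA 𝔤)) (happ comul x) = x
  lTensor_counit_comul : ∀ x, happ (fun n => TensorProduct.rid ℂ (UEA 𝔤) ∘ₗ
    (counit n).lTensor (UEA 𝔤)) (happ comul x) = x
  mul_antipode_rTensor_comul : ∀ x, happ (fun n => TensorProduct.lift (mul n))
      (happ (fun n => (antipode n).rTensor (UEA 𝔤)) (happ comul x)) =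
    fun n => happ counit x n • 1
  mul_antipode_lTensor_comul : ∀ x, happ (fun n => TensorProduct.lift (mul n))
      (happ (fun n => (antipode n).lTensor (UEA 𝔤)) (happ comul x)) =
    fun n => happ counit x n • 1

end QUE

/-! ### The Hopf algebroid `H = 𝒟 ⊗ U_ħ𝔤`

The base algebra is `R = ℳ(η*)⟦ħ⟧`; the source and target maps are both the inclusion `f ↦ f ⊗ 1`,
so that both actions of `R` on `H` are left multiplication by functions. -/

section TotalAlgebra
open TensorProduct

/-- The coefficients of the total algebra: `H = (𝒟 ⊗ U𝔤)⟦ħ⟧`. -/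
abbrev HCoeff (𝔤 : Type*) [LieRing 𝔤] [LieAlgebra ℂ 𝔤] (r : ℕ) := DiffOp r ⊗[ℂ] UEA 𝔤

/-- The coefficients of `H ⊗_R H = ((𝒟 ⊗ U𝔤) ⊗_{ℳ(η*)} (𝒟 ⊗ U𝔤))⟦ħ⟧`. -/
abbrev HHCoeff (𝔤 : Type*) [LieRing 𝔤] [LieAlgebra ℂ 𝔤] (r : ℕ) :=
  HCoeff 𝔤 r ⊗[Mero r] HCoeff 𝔤 r

variable {𝔤 : Type*} [LieRing 𝔤] [LieAlgebra ℂ 𝔤] {r : ℕ}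

/-- The projection `H ⊗ H → H ⊗_R H`. -/
noncomputable def toBalanced :
    HCoeff 𝔤 r ⊗[ℂ] HCoeff 𝔤 r →ₗ[ℂ] HHCoeff 𝔤 r :=
  TensorProduct.lift
    (LinearMap.mk₂ ℂ (fun x y => x ⊗ₜ[Mero r] y) TensorProduct.add_tmul
      (fun _ _ _ => rfl) TensorProduct.tmul_add (fun c x y => TensorProduct.tmul_smul c x y))


lemma partial_smul_smul (i : Fin r) (f : Mero r) (x : HCoeff 𝔤 r) :
    (DiffOp.pd i : DiffOp r) • f • x =
      f • (DiffOp.pd i : DiffOp r) • x + (Mero.pderiv i f) • x := by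
  have e : ∀ (f : Mero r) (x : HCoeff 𝔤 r), f • x = DiffOp.ofMero f • x := fun f x => by
    rw [← one_smul (DiffOp r) x, ← smul_assoc, DiffOp.smul_def, mul_one, one_smul]
  rw [e, e, e, smul_smul, smul_smul, ← add_smul, DiffOp.pd_mul_ofMero]

/-- The map underlying `partialAct`. -/
noncomputable def partialAddHom (i : Fin r) : HHCoeff 𝔤 r →+ HHCoeff 𝔤 r :=
  TensorProduct.liftAddHom
    (AddMonoidHom.mk' (fun x => AddMonoidHom.mk' (fun y =>
        (((DiffOp.pd i : DiffOp r) • x) ⊗ₜ[Mero r] y +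
          x ⊗ₜ[Mero r] ((DiffOp.pd i : DiffOp r) • y) : HHCoeff 𝔤 r))
        (fun y y' => by simp only [TensorProduct.tmul_add, smul_add]; abel))
      (fun x x' => by
        ext y
        simp only [AddMonoidHom.mk'_apply, AddMonoidHom.add_apply, TensorProduct.add_tmul,
          smul_add]
        abel))
    (fun f x y => by
      simp only [AddMonoidHom.mk'_apply, partial_smul_smul, TensorProduct.add_tmul,
        TensorProduct.tmul_add, TensorProduct.smul_tmul]
      abel)

lemma partialAddHom_tmul (i : Fin r) (x y : HCoeff 𝔤 r) :
    partialAddHom i (x ⊗ₜ[Mero r] y) = ((DiffOp.pd i : DiffOp r) • x) ⊗ₜ[Mero r] y +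
      x ⊗ₜ[Mero r] ((DiffOp.pd i : DiffOp r) • y) := rfl

lemma partialAddHom_smul (i : Fin r) (c : ℂ) (z : HHCoeff 𝔤 r) :
    partialAddHom i (c • z) = c • partialAddHom i z := by
  induction z using TensorProduct.induction_on with
  | zero => rw [smul_zero, map_zero, smul_zero]
  | add a b ha hb => rw [smul_add, map_add, ha, hb, map_add, smul_add]
  | tmul x y =>
    rw [TensorProduct.smul_tmul', partialAddHom_tmul, partialAddHom_tmul, smul_add,
      TensorProduct.smul_tmul', TensorProduct.smul_tmul', smul_comm]

/-- The action of `Δ(∂_i) = ∂_i ⊗ 1 + 1 ⊗ ∂_i` on `H ⊗_R H`. -/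
noncomputable def partialAct (i : Fin r) : HHCoeff 𝔤 r →ₗ[ℂ] HHCoeff 𝔤 r where
  __ := partialAddHom i
  map_smul' := partialAddHom_smul i

lemma partialAct_tmul (i : Fin r) (x y : HCoeff 𝔤 r) :
    partialAct i (x ⊗ₜ[Mero r] y) = ((DiffOp.pd i : DiffOp r) • x) ⊗ₜ[Mero r] y +
      x ⊗ₜ[Mero r] ((DiffOp.pd i : DiffOp r) • y) := rfl

/-- The action `d ↦ Δ(d)` of `𝒟` on `H ⊗_R H` through its coproduct, which is determined by
`Δ(f) = f ⊗ 1` and `Δ(∂_i) = ∂_i ⊗ 1 + 1 ⊗ ∂_i`. -/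
noncomputable def diffOpAct : DiffOp r →ₐ[ℂ] Module.End ℂ (HHCoeff 𝔤 r) :=
  DiffOp.lift (Algebra.lsmul ℂ ℂ (HHCoeff 𝔤 r)) partialAct
    (fun i f => by
      refine LinearMap.ext fun z => ?_
      induction z using TensorProduct.induction_on with
      | zero => simp
      | add a b ha hb => rw [map_add, map_add, ha, hb]
      | tmul x y =>
        simp only [Module.End.mul_apply, LinearMap.add_apply, Algebra.lsmul_coe,
          TensorProduct.smul_tmul', partialAct_tmul, smul_add, partial_smul_smul,
          TensorProduct.add_tmul]
        abel)
    (fun i j => by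
      refine LinearMap.ext fun z => ?_
      induction z using TensorProduct.induction_on with
      | zero => simp
      | add a b ha hb => rw [map_add, map_add, ha, hb]
      | tmul x y =>
        have hc : ∀ v : HCoeff 𝔤 r, (DiffOp.pd i : DiffOp r) • (DiffOp.pd j : DiffOp r) • v
            = (DiffOp.pd j : DiffOp r) • (DiffOp.pd i : DiffOp r) • v := fun v => by
          rw [smul_smul, smul_smul, DiffOp.pd_comm]
        simp only [Module.End.mul_apply, partialAct_tmul, map_add, hc]
        abel)

lemma diffOpAct_smul (f : Mero r) (d : DiffOp r) :
    diffOpAct (𝔤 := 𝔤) (f • d) = f • diffOpAct d := by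
  rw [DiffOp.smul_def, map_mul, diffOpAct, DiffOp.lift_ofMero]
  rfl

end TotalAlgebra

namespace QUEAlgebra
open TensorProduct
variable {𝔤 : Type*} [LieRing 𝔤] [LieAlgebra ℂ 𝔤] (A : QUEAlgebra 𝔤) {r : ℕ}

/-- The product of `U_ħ𝔤 ⊗ U_ħ𝔤`. -/
noncomputable def mul₂ := tensorMul A.mul A.mul

/-- The product of `U_ħ𝔤 ⊗ U_ħ𝔤 ⊗ U_ħ𝔤`. -/
noncomputable def mul₃ := tensorMul A.mul₂ A.mul

/-- The product of the total algebra `H = 𝒟 ⊗ U_ħ𝔤`. -/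
noncomputable def mulH (r : ℕ) := tensorMul (hconst (LinearMap.mul ℂ (DiffOp r))) A.mul

/-- Left multiplication by `u` on the factor `U_ħ𝔤` of `H`. -/
noncomputable def leftMulU (n : ℕ) : UEA 𝔤 →ₗ[ℂ] HCoeff 𝔤 r →ₗ[Mero r] HCoeff 𝔤 r :=
  AlgebraTensorModule.lTensor (Mero r) (DiffOp r) ∘ₗ A.mul n

/-- Left multiplication by an element of `U_ħ𝔤 ⊗ U_ħ𝔤` on `H ⊗_R H`. -/
noncomputable def leftMulUU (n : ℕ) :
    UEA 𝔤 ⊗[ℂ] UEA 𝔤 →ₗ[ℂ] HHCoeff 𝔤 r →ₗ[Mero r] HHCoeff 𝔤 r :=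
  ∑ p ∈ Finset.HasAntidiagonal.antidiagonal n, TensorProduct.lift (LinearMap.mk₂ ℂ
    (fun u v => TensorProduct.map (A.leftMulU p.1 u) (A.leftMulU p.2 v))
    (fun u u' v => by rw [map_add, TensorProduct.map_add_left])
    (fun c u v => by rw [map_smul]; ext; simp [TensorProduct.smul_tmul'])
    (fun u v v' => by rw [map_add, TensorProduct.map_add_right])
    (fun c u v => by rw [map_smul]; ext; simp))

/-- The action of `U_ħ𝔤` on `H ⊗_R H` through its coproduct `Δ₀`. -/
noncomputable def ueaAct (n : ℕ) : UEA 𝔤 →ₗ[ℂ] HHCoeff 𝔤 r →ₗ[Mero r] HHCoeff 𝔤 r :=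
  ∑ p ∈ Finset.HasAntidiagonal.antidiagonal n, A.leftMulUU p.1 ∘ₗ A.comul p.2

/-- The action `x · (y ⊗_R z) = Δ(x)(y ⊗ z)` of `H` on `H ⊗_R H` through the coproduct `Δ` of the
Hopf algebroid `H = 𝒟 ⊗ U_ħ𝔤`; in particular `Δ(x) = x · (1 ⊗_R 1)`. -/
noncomputable def act (n : ℕ) : HCoeff 𝔤 r →ₗ[Mero r] HHCoeff 𝔤 r →ₗ[ℂ] HHCoeff 𝔤 r :=
  AlgebraTensorModule.lift (LinearMap.mk₂' (Mero r) ℂ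
    (fun d u => diffOpAct d ∘ₗ (A.ueaAct n u).restrictScalars ℂ)
    (fun d d' u => by rw [map_add, LinearMap.add_comp])
    (fun f d u => by rw [diffOpAct_smul, LinearMap.smul_comp])
    (fun d u u' => by rw [map_add, LinearMap.restrictScalars_add, LinearMap.comp_add])
    (fun c d u => by rw [map_smul, LinearMap.restrictScalars_smul, LinearMap.comp_smul]))


/-- The `R`-linear map `x ↦ Δ(x) G` from `H` to `H ⊗_R H`, where `G` is in `H ⊗_R H`. -/
noncomputable def actOn (G : ℕ → HHCoeff 𝔤 r) : ℕ → HCoeff 𝔤 r →ₗ[Mero r] HHCoeff 𝔤 r :=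
  happ (fun n => (A.act n).flip) G

/-- The counit `ε : H → R`, `d ⊗ u ↦ ε₀(u) d(1)`. -/
noncomputable def counitH (n : ℕ) : HCoeff 𝔤 r →ₗ[Mero r] Mero r :=
  (AlgebraTensorModule.rid ℂ (Mero r) (Mero r)).toLinearMap ∘ₗ
    AlgebraTensorModule.map DiffOp.evalOne (A.counit n)

/-- The twistor equations for an element `T = ∑ xᵢ ⊗_R yᵢ` of `H ⊗_R H`: the cocycle equation
`(Δ ⊗_R id)T · T¹² = (id ⊗_R Δ)T · T²³` in `H ⊗_R H ⊗_R H`, where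
`(Δ ⊗_R id)T · T¹² = ∑ (Δ(xᵢ) T) ⊗_R yᵢ` and `(id ⊗_R Δ)T · T²³ = ∑ xᵢ ⊗_R (Δ(yᵢ) T)`, and the
counit equations `(ε ⊗_R id)T = (id ⊗_R ε)T = 1`. -/
structure IsTwistor (T : ℕ → HHCoeff 𝔤 r) : Prop where
  cocycle :
    happ (hconst
          (TensorProduct.assoc (Mero r) (HCoeff 𝔤 r) (HCoeff 𝔤 r) (HCoeff 𝔤 r)).toLinearMap)
        (happ (fun n => (A.actOn T n).rTensor (HCoeff 𝔤 r)) T) =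
      happ (fun n => (A.actOn T n).lTensor (HCoeff 𝔤 r)) T
  counit_left :
    happ (fun n => (TensorProduct.lid (Mero r) (HCoeff 𝔤 r)).toLinearMap ∘ₗ
      (A.counitH n).rTensor (HCoeff 𝔤 r)) T = hconst (1 ⊗ₜ 1)
  counit_right :
    happ (fun n => (TensorProduct.rid (Mero r) (HCoeff 𝔤 r)).toLinearMap ∘ₗ
      (A.counitH n).lTensor (HCoeff 𝔤 r)) T = hconst (1 ⊗ₜ 1)

/-- The element `θ = ∑ i, ∂/∂λ_i ⊗ h_i` of `H ⊗ H`, for the basis `h_1, …, h_r` of `η`. -/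
noncomputable def theta {η : LieSubalgebra ℂ 𝔤} (b : Module.Basis (Fin r) ℂ η) :
    HCoeff 𝔤 r ⊗[ℂ] HCoeff 𝔤 r :=
  ∑ i, (DiffOp.pd i ⊗ₜ 1) ⊗ₜ (1 ⊗ₜ UEA.of 𝔤 (b i))

/-- The power `θⁿ` in the algebra `H ⊗ H`. -/
noncomputable def thetaPow {η : LieSubalgebra ℂ 𝔤} (b : Module.Basis (Fin r) ℂ η) :
    ℕ → ℕ → HCoeff 𝔤 r ⊗[ℂ] HCoeff 𝔤 r
  | 0 => hconst ((1 ⊗ₜ 1) ⊗ₜ (1 ⊗ₜ 1))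
  | n + 1 => hmul (tensorMul (A.mulH r) (A.mulH r)) (thetaPow b n) (hconst (theta b))

/-- The element `Θ = exp(ħθ) = ∑ ħⁿ/n! θⁿ` of `H ⊗ H`. -/
noncomputable def Theta {η : LieSubalgebra ℂ 𝔤} (b : Module.Basis (Fin r) ℂ η) :
    ℕ → HCoeff 𝔤 r ⊗[ℂ] HCoeff 𝔤 r :=
  fun n => ∑ p ∈ Finset.HasAntidiagonal.antidiagonal n, ((p.1.factorial : ℂ)⁻¹) • A.thetaPow b p.1 p.2

/-- The map `f u ⊗ v ↦ (f ⊗ u) ⊗ (1 ⊗ v)` from `ℳ(η*, U_ħ𝔤 ⊗ U_ħ𝔤)` to `H ⊗ H`. In `H ⊗_R H` it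
does not matter on which factor the function `f` is put. -/
noncomputable def embed : Mero r ⊗[ℂ] (UEA 𝔤 ⊗[ℂ] UEA 𝔤) →ₗ[ℂ] HCoeff 𝔤 r ⊗[ℂ] HCoeff 𝔤 r :=
  TensorProduct.map (DiffOp.ofMero.toLinearMap.rTensor (UEA 𝔤))
      (TensorProduct.mk ℂ (DiffOp r) (UEA 𝔤) 1) ∘ₗ
    (TensorProduct.assoc ℂ (Mero r) (UEA 𝔤) (UEA 𝔤)).symm.toLinearMap

/-- The element `F(λ)Θ` of `H ⊗_R H`. Here and below, an element of `ℳ(η*, U_ħ𝔤 ⊗ U_ħ𝔤)`, a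
meromorphic function on `η*` with values in `U_ħ𝔤 ⊗ U_ħ𝔤`, is a formal power series with
coefficients in `ℳ(η*) ⊗ (U𝔤 ⊗ U𝔤)`. -/
noncomputable def twistElt {η : LieSubalgebra ℂ 𝔤} (b : Module.Basis (Fin r) ℂ η)
    (F : ℕ → Mero r ⊗[ℂ] (UEA 𝔤 ⊗[ℂ] UEA 𝔤)) : ℕ → HHCoeff 𝔤 r :=
  happ (hconst toBalanced)
    (hmul (tensorMul (A.mulH r) (A.mulH r)) (happ (hconst embed) F) (A.Theta b))

/-- The pointwise product of meromorphic functions with values in the algebra `W⟦ħ⟧` with product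
`∑ ħⁿ μₙ`. -/
noncomputable def _root_.meroMul (r : ℕ) {W : Type*} [AddCommGroup W] [Module ℂ W]
    (μ : ℕ → W →ₗ[ℂ] W →ₗ[ℂ] W) :=
  tensorMul (hconst (LinearMap.mul ℂ (Mero r))) μ

/-- `F` is of zero weight: `[F(λ), 1 ⊗ h + h ⊗ 1] = 0` for all `h` in `η`. -/
def IsZeroWeight (η : LieSubalgebra ℂ 𝔤) (F : ℕ → Mero r ⊗[ℂ] (UEA 𝔤 ⊗[ℂ] UEA 𝔤)) : Prop :=
  ∀ h ∈ η,
    hmul (meroMul r A.mul₂) F (hconst (1 ⊗ₜ (1 ⊗ₜ UEA.of 𝔤 h + UEA.of 𝔤 h ⊗ₜ 1))) =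
    hmul (meroMul r A.mul₂) (hconst (1 ⊗ₜ (1 ⊗ₜ UEA.of 𝔤 h + UEA.of 𝔤 h ⊗ₜ 1))) F

/-- The product `h_{i₁} ⋯ h_{iₙ}` in `U_ħ𝔤`. -/
noncomputable def wordProd {η : LieSubalgebra ℂ 𝔤} (b : Module.Basis (Fin r) ℂ η) :
    List (Fin r) → ℕ → UEA 𝔤
  | [] => hconst 1
  | i :: l => hmul A.mul (hconst (UEA.of 𝔤 (b i))) (wordProd b l)

/-- The iterated derivative `∂ⁿ/∂λ_{i₁}⋯∂λ_{iₙ}`. -/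
noncomputable def _root_.Mero.iterPderiv : List (Fin r) → Mero r →ₗ[ℂ] Mero r
  | [] => LinearMap.id
  | i :: l => (Mero.pderiv i).toLinearMap ∘ₗ Mero.iterPderiv l

/-- The element `F¹²(λ + ħh⁽³⁾) = ∑ₖ ħᵏ/k! ∑_{i₁, …, iₖ} ∂ᵏF/∂λ_{i₁}⋯∂λ_{iₖ} ⊗ h_{i₁} ⋯ h_{iₖ}` of
`ℳ(η*, U_ħ𝔤 ⊗ U_ħ𝔤 ⊗ U_ħ𝔤)`. -/
noncomputable def shift {η : LieSubalgebra ℂ 𝔤} (b : Module.Basis (Fin r) ℂ η)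
    (F : ℕ → Mero r ⊗[ℂ] (UEA 𝔤 ⊗[ℂ] UEA 𝔤)) :
    ℕ → Mero r ⊗[ℂ] ((UEA 𝔤 ⊗[ℂ] UEA 𝔤) ⊗[ℂ] UEA 𝔤) :=
  fun n => ∑ p ∈ Finset.HasAntidiagonal.antidiagonal n, ((p.1.factorial : ℂ)⁻¹) •
    ∑ i : Fin p.1 → Fin r, ∑ q ∈ Finset.HasAntidiagonal.antidiagonal p.2,
      TensorProduct.assoc ℂ (Mero r) (UEA 𝔤 ⊗[ℂ] UEA 𝔤) (UEA 𝔤)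
        ((Mero.iterPderiv (List.ofFn i)).rTensor (UEA 𝔤 ⊗[ℂ] UEA 𝔤) (F q.1) ⊗ₜ
          A.wordProd b (List.ofFn i) q.2)

/-- The shifted cocycle equation
`[(Δ₀ ⊗ id)F(λ)] F¹²(λ + ħh⁽³⁾) = [(id ⊗ Δ₀)F(λ)] F²³(λ)`. -/
def IsShiftedCocycle {η : LieSubalgebra ℂ 𝔤} (b : Module.Basis (Fin r) ℂ η)
    (F : ℕ → Mero r ⊗[ℂ] (UEA 𝔤 ⊗[ℂ] UEA 𝔤)) : Prop :=
  hmul (meroMul r A.mul₃)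
      (happ (fun n => ((A.comul n).rTensor (UEA 𝔤)).lTensor (Mero r)) F) (A.shift b F) =
    hmul (meroMul r A.mul₃)
      (happ (fun n => ((TensorProduct.assoc ℂ (UEA 𝔤) (UEA 𝔤) (UEA 𝔤)).symm.toLinearMap ∘ₗ
        (A.comul n).lTensor (UEA 𝔤)).lTensor (Mero r)) F)
      (happ (hconst (((TensorProduct.assoc ℂ (UEA 𝔤) (UEA 𝔤) (UEA 𝔤)).symm.toLinearMap ∘ₗ
        TensorProduct.mk ℂ (UEA 𝔤) (UEA 𝔤 ⊗[ℂ] UEA 𝔤) 1).lTensor (Mero r))) F)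

/-- The normalisation `(ε₀ ⊗ id)F(λ) = 1` and `(id ⊗ ε₀)F(λ) = 1`. -/
def IsCounital
    (F : ℕ → Mero r ⊗[ℂ] (UEA 𝔤 ⊗[ℂ] UEA 𝔤)) : Prop :=
  happ (fun n => ((TensorProduct.lid ℂ (UEA 𝔤)).toLinearMap ∘ₗ
      (A.counit n).rTensor (UEA 𝔤)).lTensor (Mero r)) F = hconst (1 ⊗ₜ 1) ∧
  happ (fun n => ((TensorProduct.rid ℂ (UEA 𝔤)).toLinearMap ∘ₗ
      (A.counit n).lTensor (UEA 𝔤)).lTensor (Mero r)) F = hconst (1 ⊗ₜ 1)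

end QUEAlgebra

/-!
The element `F(λ)Θ` of `H ⊗_R H` is `exp(ħθ) F`, where `θ` denotes right multiplication by
`∑ i, ∂_i ⊗ h_i` (`ofSeq_twistElt`). This makes sense on `H ⊗_R H` because right multiplications are
linear over `R`, which acts on `H` from the left. Write `θ₁₂`, `θ₁₃`, `θ₂₃` for right multiplication
by `∑ i, ∂_i ⊗ h_i` in two of the factors of `H ⊗_R H ⊗_R H`; they commute with each other because
the `∂_i` do and the `h_i` do.

On the left-hand side of the cocycle equation, the factor `(F(λ)Θ)¹²` contributes `exp(ħθ₁₂)`, since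
right multiplications commute with the left multiplications by the `Δ(x)` (`leftSide_fexp`). The
exponent of `(Δ ⊗ id)Θ` is `∑ i, Δ(∂_i) ⊗ h_i`, which has to be moved to the right of `F¹²`. By the
Leibniz rule this gives `θ₁₃ + θ₂₃`, plus the operator that replaces `F` by `∂F/∂λ_i` and multiplies
by `h_i` in the third factor, summed over `i` (`leftSide_theta₂`). The two operators commute, and the
exponential of the second one turns `F¹²` into `F¹²(λ + ħh⁽³⁾)` (`leftSide_twist`).

On the right-hand side, the factor `(F(λ)Θ)²³` contributes `exp(ħθ₂₃)`, and the exponent of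
`(id ⊗ Δ)Θ` is `∑ i, ∂_i ⊗ Δ₀(h_i)`. Since `h_i` is primitive and `F` has zero weight, it can be moved
past `F²³`, and becomes `θ₁₂ + θ₁₃` (`rightSide_twist`).

So the two sides of the cocycle equation for `F(λ)Θ` are the images of the two sides of the shifted
cocycle equation under `exp(ħ(θ₁₂ + θ₁₃ + θ₂₃))`, composed with the embedding `iota₃` of functions
with values in `U_ħ𝔤 ⊗ U_ħ𝔤 ⊗ U_ħ𝔤` into `H ⊗_R H ⊗_R H`. Both maps are injective: the embedding has
a left inverse, which evaluates differential operators at the function `1`. For the counit equations,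
`ε ⊗ id` and `id ⊗ ε` vanish on the image of `θ`, because `ε(x ∂_i) = 0` and `ε₀(h_i) = 0`, so that
they take the same value on `F(λ)Θ` and on `F`.

Formal power series are treated as modules over `ℂ[X]`, with `X` acting as `ħ`. Linearity over
`ℂ[X]` already implies `ħ`-adic continuity, hence identities between linear maps can be checked on
constant series (`FSeries.eq_of_C`) and on pure tensors (`FSeries.eq_of_tens`).
-/

set_option linter.unusedSectionVars false

/-! ### Formal power series as modules over `ℂ[ħ]` -/

/-- The module `V⟦ħ⟧` of formal power series with coefficients in `V`, as sequences of coefficients.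
It is regarded as a module over the polynomial ring `ℂ[X]`, where `X` acts as multiplication by `ħ`.
Every `ℂ[X]`-linear map `V⟦ħ⟧ → W⟦ħ⟧` is automatically continuous in the `ħ`-adic topology, so that
these are the `ℂ⟦ħ⟧`-linear maps. -/
def FSeries (V : Type*) : Type _ := ℕ → V

namespace FSeries
open Polynomial Finset

/-- A sequence of coefficients, as a series. -/
def ofSeq {V : Type*} (v : ℕ → V) : FSeries V := v

@[simp] lemma ofSeq_apply {V : Type*} (v : ℕ → V) (n : ℕ) : ofSeq v n = v n := rfl

section Module
variable {V W : Type*} [AddCommGroup V] [Module ℂ V] [AddCommGroup W] [Module ℂ W]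

instance : AddCommGroup (FSeries V) := inferInstanceAs (AddCommGroup (ℕ → V))
instance : Module ℂ (FSeries V) := inferInstanceAs (Module ℂ (ℕ → V))

@[ext] lemma ext {v w : FSeries V} (h : ∀ n, v n = w n) : v = w := funext h

lemma add_apply (v w : FSeries V) (n : ℕ) : (v + w) n = v n + w n := rfl
lemma smul_apply (c : ℂ) (v : FSeries V) (n : ℕ) : (c • v) n = c • v n := rfl
lemma zero_apply (n : ℕ) : (0 : FSeries V) n = 0 := rfl

/-- The coefficient of `ħⁿ`. -/
def coeff (n : ℕ) : FSeries V →ₗ[ℂ] V where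
  toFun v := v n
  map_add' _ _ := rfl
  map_smul' _ _ := rfl

lemma sum_apply {ι : Type*} (s : Finset ι) (v : ι → FSeries V) (n : ℕ) :
    (∑ i ∈ s, v i) n = ∑ i ∈ s, v i n := map_sum (coeff n) v s

/-- The series `ħ v`. -/
def shiftFun (v : FSeries V) : FSeries V
  | 0 => 0
  | n + 1 => v n

/-- Multiplication by `ħ`. -/
def shiftMul : FSeries V →ₗ[ℂ] FSeries V where
  toFun := shiftFun
  map_add' v w := by ext n; cases n <;> simp [shiftFun, add_apply]
  map_smul' c v := by ext n; cases n <;> simp [shiftFun, smul_apply]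

@[simp] lemma shiftMul_zero (v : FSeries V) : shiftMul v 0 = 0 := rfl
@[simp] lemma shiftMul_succ (v : FSeries V) (n : ℕ) : shiftMul v (n + 1) = v n := rfl

noncomputable instance : Module ℂ[X] (FSeries V) :=
  Module.compHom (FSeries V) (aeval (shiftMul (V := V))).toRingHom

lemma poly_smul_def (p : ℂ[X]) (v : FSeries V) : p • v = aeval (shiftMul (V := V)) p v := rfl

lemma X_smul (v : FSeries V) : (X : ℂ[X]) • v = shiftMul v := by simp [poly_smul_def]

instance : IsScalarTower ℂ ℂ[X] (FSeries V) := ⟨fun c p v => by simp [poly_smul_def]⟩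

@[simp] lemma X_smul_zero (v : FSeries V) : ((X : ℂ[X]) • v) 0 = 0 := by simp [X_smul]
@[simp] lemma X_smul_succ (v : FSeries V) (n : ℕ) : ((X : ℂ[X]) • v) (n + 1) = v n := by
  simp [X_smul]

/-- A `ℂ`-linear map that commutes with `ħ` is linear over `ℂ[X]`. -/
lemma map_poly_smul (f : FSeries V →ₗ[ℂ] FSeries W) (hf : ∀ v, f (shiftMul v) = shiftMul (f v))
    (p : ℂ[X]) (v : FSeries V) : f (p • v) = p • f v := by
  induction p using Polynomial.induction_on' with
  | add p q hp hq => rw [add_smul, add_smul, map_add, hp, hq]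
  | monomial n c =>
    simp only [poly_smul_def, aeval_monomial, Module.End.mul_apply, Module.algebraMap_end_apply,
      map_smul]
    congr 1
    induction n generalizing v with
    | zero => simp
    | succ n ih => rw [pow_succ, Module.End.mul_apply, ih, hf]; rfl

/-- The constant series. -/
noncomputable def C : V →ₗ[ℂ] FSeries V where
  toFun := hconst
  map_add' v w := Pi.single_add (f := fun _ : ℕ => V) 0 v w
  map_smul' c v := Pi.single_smul (f := fun _ : ℕ => V) 0 c v

@[simp] lemma C_zero_apply (v : V) : (C v : FSeries V) 0 = v := by
  change (Pi.single 0 v : ℕ → V) 0 = v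
  simp
@[simp] lemma C_succ_apply (v : V) (n : ℕ) : (C v : FSeries V) (n + 1) = 0 :=
  Pi.single_eq_of_ne (M := fun _ => V) n.succ_ne_zero v

/-- The series `(v - v₀) / ħ`. -/
def tail (v : FSeries V) : FSeries V := fun n => v (n + 1)

lemma eq_C_add (v : FSeries V) : v = C (v 0) + (X : ℂ[X]) • tail v := by
  ext n; cases n <;> simp [add_apply, tail]

/-- Maps that are linear over `ℂ[X]` agree if they agree on constant series. The maps are not
bundled, so that any expression in `x` can be used; its linearity is proved by default. -/
theorem eq_of_C {f g : FSeries V → FSeries W} (x : FSeries V) (h : ∀ v, f (C v) = g (C v))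
    (hf : IsLinearMap ℂ[X] f := by
      constructor <;> intros <;> simp only [map_add, map_smul, LinearMap.add_apply,
        LinearMap.smul_apply, map_sum, Finset.sum_add_distrib, ← Finset.smul_sum, smul_add] <;>
      abel)
    (hg : IsLinearMap ℂ[X] g := by
      constructor <;> intros <;> simp only [map_add, map_smul, LinearMap.add_apply,
        LinearMap.smul_apply, map_sum, Finset.sum_add_distrib, ← Finset.smul_sum, smul_add] <;>
      abel) :
    f x = g x := by
  ext n
  induction n generalizing x with
  | zero => rw [eq_C_add x, hf.map_add, hg.map_add, hf.map_smul, hg.map_smul, h]; simp [add_apply]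
  | succ n ih =>
    rw [eq_C_add x, hf.map_add, hg.map_add, hf.map_smul, hg.map_smul, h]
    simp [add_apply, ih]

/-- The sum `∑ ħᵏ gₖ` of a sequence of series. -/
def sum (g : ℕ → FSeries V) : FSeries V :=
  fun n => ∑ p ∈ antidiagonal n, g p.1 p.2

lemma sum_eq (g : ℕ → FSeries V) : sum g = g 0 + (X : ℂ[X]) • sum (fun n => g (n + 1)) := by
  ext n
  cases n with
  | zero => simp [sum, add_apply]
  | succ n => simp [sum, add_apply, Nat.sum_antidiagonal_succ]

/-- Maps that are linear over `ℂ[X]` commute with `ħ`-adically convergent sums. -/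
theorem map_series_sum (f : FSeries V →ₗ[ℂ[X]] FSeries W) (g : ℕ → FSeries V) :
    f (sum g) = sum (fun n => f (g n)) := by
  ext n
  induction n generalizing g with
  | zero => rw [sum_eq, sum_eq (fun n => f (g n)), map_add, map_smul]; simp [add_apply]
  | succ n ih => rw [sum_eq, sum_eq (fun n => f (g n)), map_add, map_smul]; simp [add_apply, ih]

lemma sum_add (g h : ℕ → FSeries V) : sum (fun n => g n + h n) = sum g + sum h := by
  ext n; simp [sum, add_apply, Finset.sum_add_distrib]

/-- A double sum `∑ ħ^(p + q) g p q`, arranged by the values of `p + q`. -/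
lemma sum_sum (g : ℕ → ℕ → FSeries V) :
    sum (fun p => sum (g p)) = sum (fun n => ∑ p ∈ antidiagonal n, g p.1 p.2) := by
  have key : ∀ g : ℕ → ℕ → FSeries V, sum (fun n => ∑ p ∈ antidiagonal n, g p.1 p.2) =
      sum (g 0) + (X : ℂ[X]) • sum (fun n => ∑ p ∈ antidiagonal n, g (p.1 + 1) p.2) := fun g => by
    rw [sum_eq]
    simp only [Nat.sum_antidiagonal_succ, sum_add]
    rw [sum_eq (g 0), smul_add]
    simp [add_assoc]
  ext n
  induction n generalizing g with
  | zero => rw [sum_eq, key]; simp [add_apply]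
  | succ n ih => rw [sum_eq, key]; simp only [add_apply, X_smul_succ, ih]

end Module

section Apply
variable {S : Type*} [CommRing S] [Algebra ℂ S]
  {V W : Type*} [AddCommGroup V] [Module ℂ V] [Module S V] [IsScalarTower ℂ S V]
  [AddCommGroup W] [Module ℂ W] [Module S W] [IsScalarTower ℂ S W]

/-- The value `happ φ v`, as a series. -/
noncomputable def happS (φ : FSeries (V →ₗ[S] W)) (v : FSeries V) : FSeries W := happ φ v

lemma happS_coeff [SMulCommClass S ℂ W] (φ : FSeries (V →ₗ[S] W)) (v : FSeries V) (n : ℕ) :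
    happS φ v n = ∑ p ∈ antidiagonal n, φ p.1 (v p.2) := rfl

variable (S) in
/-- The value `happ φ v`, as a bilinear map over `ℂ[X]`. -/
noncomputable def app [SMulCommClass S ℂ W] :
    FSeries (V →ₗ[S] W) →ₗ[ℂ[X]] FSeries V →ₗ[ℂ[X]] FSeries W :=
  LinearMap.mk₂ ℂ[X] happS
    (fun φ ψ v => by
      ext n
      simp [happS_coeff, add_apply, Finset.sum_add_distrib])
    (fun c φ v => by
      refine map_poly_smul (V := V →ₗ[S] W) (W := W)
        { toFun := fun φ => happS φ v
          map_add' := fun φ ψ => by ext n; simp [happS_coeff, add_apply, Finset.sum_add_distrib]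
          map_smul' := fun c φ => by ext n; simp [happS_coeff, smul_apply, Finset.smul_sum] } ?_ c φ
      intro φ
      ext n
      cases n with
      | zero => simp [happS_coeff]
      | succ n => simp [happS_coeff, Nat.sum_antidiagonal_succ])
    (fun φ v w => by
      ext n
      simp [happS_coeff, add_apply, Finset.sum_add_distrib])
    (fun c φ v => by
      refine map_poly_smul (V := V) (W := W)
        { toFun := fun v => happS φ v
          map_add' := fun φ ψ => by ext n; simp [happS_coeff, add_apply, Finset.sum_add_distrib]
          map_smul' := fun c φ => by
            ext n; simp [happS_coeff, smul_apply, Finset.smul_sum, LinearMap.map_smul_of_tower] }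
        ?_ c v
      intro φ
      ext n
      cases n with
      | zero => simp [happS_coeff]
      | succ n => simp [happS_coeff, Nat.sum_antidiagonal_succ'])

variable [SMulCommClass S ℂ W]

lemma app_coeff (φ : FSeries (V →ₗ[S] W)) (v : FSeries V) (n : ℕ) :
    app S φ v n = ∑ p ∈ antidiagonal n, φ p.1 (v p.2) := rfl

lemma sum_antidiagonal_C {N : Type*} [AddCommMonoid N] (v : V) (n : ℕ) (g : ℕ → V → N)
    (hg : ∀ m, g m 0 = 0) :
    ∑ p ∈ antidiagonal n, g p.1 ((C v : FSeries V) p.2) = g n v := by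
  cases n with
  | zero => simp
  | succ n => simp [Nat.sum_antidiagonal_succ', hg]

lemma sum_antidiagonal_C' {N : Type*} [AddCommMonoid N] (v : V) (n : ℕ) (g : V → ℕ → N)
    (hg : ∀ m, g 0 m = 0) :
    ∑ p ∈ antidiagonal n, g ((C v : FSeries V) p.1) p.2 = g v n := by
  cases n with
  | zero => simp
  | succ n => simp [Nat.sum_antidiagonal_succ, hg]

@[simp] lemma app_C_right_coeff (φ : FSeries (V →ₗ[S] W)) (v : V) (n : ℕ) :
    app S φ (C v) n = φ n v :=
  sum_antidiagonal_C v n (fun m x => φ m x) (by simp)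

@[simp] lemma app_C_left_coeff (φ : V →ₗ[S] W) (v : FSeries V) (n : ℕ) :
    app S (C φ) v n = φ (v n) :=
  sum_antidiagonal_C' φ n (fun x m => x (v m)) (by simp)

@[simp] lemma app_C_C (φ : V →ₗ[S] W) (v : V) : app S (C φ) (C v) = C (φ v) := by
  ext n; cases n <;> simp

end Apply

section Bilinear
variable {S S' : Type*} [CommRing S] [Algebra ℂ S] [CommRing S'] [Algebra ℂ S']
  {V W Z : Type*} [AddCommGroup V] [Module ℂ V] [Module S V] [IsScalarTower ℂ S V]
  [AddCommGroup W] [Module ℂ W] [Module S' W] [IsScalarTower ℂ S' W]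
  [AddCommGroup Z] [Module ℂ Z] [Module S Z] [IsScalarTower ℂ S Z] [SMulCommClass S ℂ Z]
  [Module S' Z] [IsScalarTower ℂ S' Z] [SMulCommClass S' ℂ Z] [SMulCommClass S' S Z]

variable (S S') in
/-- The bilinear map `hmul μ`, where the coefficients of `μ` may be linear over different
algebras in the two variables. -/
noncomputable def bil [IsScalarTower ℂ S (W →ₗ[S'] Z)] [SMulCommClass S ℂ (W →ₗ[S'] Z)]
    (μ : FSeries (V →ₗ[S] W →ₗ[S'] Z)) :
    FSeries V →ₗ[ℂ[X]] FSeries W →ₗ[ℂ[X]] FSeries Z :=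
  app S' ∘ₗ app S μ

variable [IsScalarTower ℂ S (W →ₗ[S'] Z)] [SMulCommClass S ℂ (W →ₗ[S'] Z)]

lemma bil_apply (μ : FSeries (V →ₗ[S] W →ₗ[S'] Z)) (v : FSeries V) (w : FSeries W) :
    bil S S' μ v w = app S' (app S μ v) w := rfl

@[simp] lemma bil_C_C_coeff (μ : FSeries (V →ₗ[S] W →ₗ[S'] Z)) (v : V) (w : W) (n : ℕ) :
    bil S S' μ (C v) (C w) n = μ n v w := by simp [bil_apply]

lemma bil_C_coeff (μ : V →ₗ[S] W →ₗ[S'] Z) (v : FSeries V) (w : FSeries W) (n : ℕ) :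
    bil S S' (C μ) v w n = ∑ p ∈ antidiagonal n, μ (v p.1) (w p.2) := by
  rw [bil_apply, app_coeff]; simp only [app_C_left_coeff]

@[simp] lemma bil_C_C_C (μ : V →ₗ[S] W →ₗ[S'] Z) (v : V) (w : W) :
    bil S S' (C μ) (C v) (C w) = C (μ v w) := by simp [bil_apply]

end Bilinear

section Tensor
variable {S : Type*} [CommRing S] [Algebra ℂ S]
  {V W Z V' W' : Type*} [AddCommGroup V] [Module ℂ V] [Module S V] [IsScalarTower ℂ S V]
  [AddCommGroup W] [Module ℂ W] [Module S W] [IsScalarTower ℂ S W]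
  [SMulCommClass S ℂ V] [SMulCommClass S ℂ W]
  [AddCommGroup Z] [Module ℂ Z]
  [AddCommGroup V'] [Module ℂ V'] [Module S V'] [IsScalarTower ℂ S V'] [SMulCommClass S ℂ V']
  [AddCommGroup W'] [Module ℂ W'] [Module S W'] [IsScalarTower ℂ S W'] [SMulCommClass S ℂ W']

variable (S) in
/-- The completed tensor product of two series. -/
noncomputable def tens : FSeries V →ₗ[ℂ[X]] FSeries W →ₗ[ℂ[X]] FSeries (V ⊗[S] W) :=
  bil S S (C (TensorProduct.mk S V W))

/-- The completed tensor product `v ⊗ w` over `S` of two series. -/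
notation:100 v:100 " ⊗ₕ[" S "] " w:101 => tens S v w

lemma tens_coeff (v : FSeries V) (w : FSeries W) (n : ℕ) :
    (v ⊗ₕ[S] w) n = ∑ p ∈ antidiagonal n, v p.1 ⊗ₜ w p.2 := bil_C_coeff _ _ _ _

lemma C_tmul (v : V) (w : W) : C (v ⊗ₜ[S] w) = C v ⊗ₕ[S] C w :=
  (bil_C_C_C (S := S) (S' := S) (TensorProduct.mk S V W) v w).symm

/-- Maps that are linear over `ℂ[X]` agree if they agree on completed tensor products. -/
theorem eq_of_tens {f g : FSeries (V ⊗[S] W) → FSeries Z} (x : FSeries (V ⊗[S] W))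
    (h : ∀ v w, f (v ⊗ₕ[S] w) = g (v ⊗ₕ[S] w))
    (hf : IsLinearMap ℂ[X] f := by
      constructor <;> intros <;> simp only [map_add, map_smul, LinearMap.add_apply,
        LinearMap.smul_apply, map_sum, Finset.sum_add_distrib, ← Finset.smul_sum, smul_add] <;>
      abel)
    (hg : IsLinearMap ℂ[X] g := by
      constructor <;> intros <;> simp only [map_add, map_smul, LinearMap.add_apply,
        LinearMap.smul_apply, map_sum, Finset.sum_add_distrib, ← Finset.smul_sum, smul_add] <;>
      abel) :
    f x = g x := by
  refine eq_of_C x (fun t => ?_) hf hg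
  induction t using TensorProduct.induction_on with
  | zero => rw [map_zero, hf.map_zero, hg.map_zero]
  | add a b ha hb => rw [map_add, hf.map_add, hg.map_add, ha, hb]
  | tmul v w => rw [C_tmul, h]

/-- A variant of `eq_of_tens` in which the first factor is constant. -/
theorem eq_of_C_tens {f g : FSeries (V ⊗[S] W) → FSeries Z} (x : FSeries (V ⊗[S] W))
    (h : ∀ v w, f (C v ⊗ₕ[S] w) = g (C v ⊗ₕ[S] w))
    (hf : IsLinearMap ℂ[X] f := by
      constructor <;> intros <;> simp only [map_add, map_smul, LinearMap.add_apply,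
        LinearMap.smul_apply, map_sum, Finset.sum_add_distrib, ← Finset.smul_sum, smul_add] <;>
      abel)
    (hg : IsLinearMap ℂ[X] g := by
      constructor <;> intros <;> simp only [map_add, map_smul, LinearMap.add_apply,
        LinearMap.smul_apply, map_sum, Finset.sum_add_distrib, ← Finset.smul_sum, smul_add] <;>
      abel) :
    f x = g x := by
  refine eq_of_C x (fun t => ?_) hf hg
  induction t using TensorProduct.induction_on with
  | zero => rw [map_zero, hf.map_zero, hg.map_zero]
  | add a b ha hb => rw [map_add, hf.map_add, hg.map_add, ha, hb]
  | tmul v w => rw [C_tmul, h]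

variable (W) in
/-- The series of linear maps `φ ⊗ id`. -/
noncomputable def rT (φ : FSeries (V →ₗ[S] V')) : FSeries (V ⊗[S] W →ₗ[S] V' ⊗[S] W) :=
  ofSeq fun n => (φ n).rTensor W

variable (V) in
/-- The series of linear maps `id ⊗ φ`. -/
noncomputable def lT (φ : FSeries (W →ₗ[S] W')) : FSeries (V ⊗[S] W →ₗ[S] V ⊗[S] W') :=
  ofSeq fun n => (φ n).lTensor V

@[simp] lemma app_rT_tens (φ : FSeries (V →ₗ[S] V')) (v : FSeries V) (w : FSeries W) :
    app S (rT W φ) (v ⊗ₕ[S] w) = app S φ v ⊗ₕ[S] w := by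
  apply eq_of_C v
  intro v
  apply eq_of_C w
  intro w
  ext n
  rw [tens_coeff, sum_antidiagonal_C w n (fun m x => app S φ (C v) m ⊗ₜ x) (by simp), ← C_tmul]
  simp [rT]

@[simp] lemma app_lT_tens (φ : FSeries (W →ₗ[S] W')) (v : FSeries V) (w : FSeries W) :
    app S (lT V φ) (v ⊗ₕ[S] w) = v ⊗ₕ[S] app S φ w := by
  apply eq_of_C v
  intro v
  apply eq_of_C w
  intro w
  ext n
  rw [tens_coeff, sum_antidiagonal_C' v n (fun x m => x ⊗ₜ app S φ (C w) m) (by simp), ← C_tmul]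
  simp [lT]

end Tensor

section Exp
variable {V W : Type*} [AddCommGroup V] [Module ℂ V] [AddCommGroup W] [Module ℂ W]

/-- The exponential `exp(ħa) = ∑ ħᵏ aᵏ / k!` of an operator `a` on series. -/
noncomputable def fexp (a : Module.End ℂ[X] (FSeries V)) : Module.End ℂ[X] (FSeries V) where
  toFun v := sum fun k => (k.factorial : ℂ)⁻¹ • (a ^ k) v
  map_add' v w := by simp only [map_add, smul_add, sum_add]
  map_smul' c v := by
    have h := map_series_sum (LinearMap.lsmul ℂ[X] (FSeries V) c)
      fun k => (k.factorial : ℂ)⁻¹ • (a ^ k) v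
    simp only [LinearMap.lsmul_apply] at h
    rw [RingHom.id_apply, h]
    simp only [map_smul]
    congr 1
    funext k
    exact smul_comm _ _ _

lemma fexp_apply (a : Module.End ℂ[X] (FSeries V)) (v : FSeries V) :
    fexp a v = sum fun k => (k.factorial : ℂ)⁻¹ • (a ^ k) v := rfl

/-- A linear map that intertwines `a` and `b` intertwines their exponentials. -/
lemma map_fexp (f : FSeries V →ₗ[ℂ[X]] FSeries W) {a : Module.End ℂ[X] (FSeries V)}
    {b : Module.End ℂ[X] (FSeries W)} (h : ∀ v, f (a v) = b (f v)) (v : FSeries V) :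
    f (fexp a v) = fexp b (f v) := by
  have hk : ∀ k : ℕ, ∀ v, f ((a ^ k) v) = (b ^ k) (f v) := fun k => by
    induction k with
    | zero => simp
    | succ k ih => intro v; rw [pow_succ, pow_succ, Module.End.mul_apply, ih, h]; rfl
  rw [fexp_apply, map_series_sum, fexp_apply]
  simp only [LinearMap.map_smul_of_tower, hk]

/-- A linear map that kills the image of `a` does not see `exp(ħa)`. -/
lemma map_fexp_of_map_eq_zero (f : FSeries V →ₗ[ℂ[X]] FSeries W)
    {a : Module.End ℂ[X] (FSeries V)} (h : ∀ v, f (a v) = 0) (v : FSeries V) :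
    f (fexp a v) = f v := by
  rw [map_fexp f (b := 0) (by simpa using h), fexp_apply, sum_eq]
  have : sum (fun n => ((n + 1).factorial : ℂ)⁻¹ •
      ((0 : Module.End ℂ[X] (FSeries W)) ^ (n + 1)) (f v)) = 0 := by
    ext n; simp [sum, zero_apply]
  rw [this]
  simp

lemma inv_factorial_smul_add_pow {R : Type*} [Ring R] [Algebra ℂ R] {a b : R} (h : Commute a b)
    (n : ℕ) : (n.factorial : ℂ)⁻¹ • (a + b) ^ n =
      ∑ p ∈ antidiagonal n,
        ((p.1.factorial : ℂ)⁻¹ * (p.2.factorial : ℂ)⁻¹) • (a ^ p.1 * b ^ p.2) := by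
  rw [h.add_pow', Finset.smul_sum]
  refine Finset.sum_congr rfl fun p hp => ?_
  rw [← Nat.cast_smul_eq_nsmul ℂ, smul_smul]
  congr 1
  obtain rfl := mem_antidiagonal.1 hp
  have h1 := Nat.add_choose_mul_factorial_mul_factorial p.2 p.1
  have h2 : (((p.1 + p.2).choose p.1 : ℂ)) * p.1.factorial * p.2.factorial =
      (p.1 + p.2).factorial := by rw [add_comm p.1 p.2, mul_right_comm]; exact_mod_cast h1
  have := Nat.cast_ne_zero (R := ℂ).2 p.1.factorial_ne_zero
  have := Nat.cast_ne_zero (R := ℂ).2 p.2.factorial_ne_zero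
  have := Nat.cast_ne_zero (R := ℂ).2 (p.1 + p.2).factorial_ne_zero
  field_simp
  exact h2

lemma fexp_add {a b : Module.End ℂ[X] (FSeries V)} (h : Commute a b) :
    fexp (a + b) = fexp a * fexp b := by
  ext1 v
  rw [Module.End.mul_apply, fexp_apply, fexp_apply a]
  have h1 : ∀ p : ℕ, (p.factorial : ℂ)⁻¹ • (a ^ p) (fexp b v) =
      sum fun q => ((p.factorial : ℂ)⁻¹ * (q.factorial : ℂ)⁻¹) • (a ^ p * b ^ q) v := fun p => by
    rw [fexp_apply, ← LinearMap.smul_apply, map_series_sum]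
    simp [LinearMap.map_smul_of_tower, smul_smul]
  simp only [h1, sum_sum]
  congr 1
  funext n
  rw [← LinearMap.smul_apply, inv_factorial_smul_add_pow h]
  simp [LinearMap.sum_apply]

lemma fexp_zero : fexp (0 : Module.End ℂ[X] (FSeries V)) = 1 := by
  ext1 v
  simpa using map_fexp_of_map_eq_zero LinearMap.id (a := (0 : Module.End ℂ[X] (FSeries V)))
    (by simp) v

lemma fexp_injective (a : Module.End ℂ[X] (FSeries V)) : Function.Injective (fexp a) := by
  refine Function.LeftInverse.injective (g := fexp (-a)) fun v => ?_
  rw [← Module.End.mul_apply, ← fexp_add (Commute.neg_left (Commute.refl a)), neg_add_cancel,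
    fexp_zero, Module.End.one_apply]

end Exp

end FSeries

/-! ### Tensor products of series -/

namespace FSeries
open Polynomial Finset

section TensorMul
variable {V W : Type*} [AddCommGroup V] [Module ℂ V] [AddCommGroup W] [Module ℂ W]

lemma tensorMul_tens (μ : ℕ → V →ₗ[ℂ] V →ₗ[ℂ] V) (ν : ℕ → W →ₗ[ℂ] W →ₗ[ℂ] W)
    (v v' : FSeries V) (w w' : FSeries W) :
    bil ℂ ℂ (ofSeq (tensorMul μ ν)) (v ⊗ₕ[ℂ] w) (v' ⊗ₕ[ℂ] w') =
      bil ℂ ℂ (ofSeq μ) v v' ⊗ₕ[ℂ] bil ℂ ℂ (ofSeq ν) w w' := by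
  apply eq_of_C v
  intro v
  apply eq_of_C w
  intro w
  apply eq_of_C v'
  intro v'
  apply eq_of_C w'
  intro w'
  ext n
  rw [← C_tmul, ← C_tmul, bil_C_C_coeff, tens_coeff]
  simp only [bil_C_C_coeff]
  simp [tensorMul, LinearMap.sum_apply]

lemma tensorMul_assoc {μ : ℕ → V →ₗ[ℂ] V →ₗ[ℂ] V} {ν : ℕ → W →ₗ[ℂ] W →ₗ[ℂ] W}
    (hμ : ∀ x y z, bil ℂ ℂ (ofSeq μ) (bil ℂ ℂ (ofSeq μ) x y) z =
      bil ℂ ℂ (ofSeq μ) x (bil ℂ ℂ (ofSeq μ) y z))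
    (hν : ∀ x y z, bil ℂ ℂ (ofSeq ν) (bil ℂ ℂ (ofSeq ν) x y) z =
      bil ℂ ℂ (ofSeq ν) x (bil ℂ ℂ (ofSeq ν) y z))
    (x y z : FSeries (V ⊗[ℂ] W)) :
    bil ℂ ℂ (ofSeq (tensorMul μ ν)) (bil ℂ ℂ (ofSeq (tensorMul μ ν)) x y) z =
      bil ℂ ℂ (ofSeq (tensorMul μ ν)) x (bil ℂ ℂ (ofSeq (tensorMul μ ν)) y z) := by
  apply eq_of_tens x
  intro a b
  apply eq_of_tens y
  intro c d
  apply eq_of_tens z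
  intro e f
  simp only [tensorMul_tens, hμ, hν]

end TensorMul

section AssocTensor
variable {S : Type*} [CommRing S] [Algebra ℂ S]
  {V W Z : Type*} [AddCommGroup V] [Module ℂ V] [Module S V] [IsScalarTower ℂ S V]
  [AddCommGroup W] [Module ℂ W] [Module S W] [IsScalarTower ℂ S W]
  [AddCommGroup Z] [Module ℂ Z] [Module S Z] [IsScalarTower ℂ S Z]
  [SMulCommClass S ℂ V] [SMulCommClass S ℂ W] [SMulCommClass S ℂ Z]

@[simp] lemma app_assoc_tens (v : FSeries V) (w : FSeries W) (z : FSeries Z) :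
    app S (C (TensorProduct.assoc S V W Z).toLinearMap) ((v ⊗ₕ[S] w) ⊗ₕ[S] z) =
      v ⊗ₕ[S] (w ⊗ₕ[S] z) := by
  apply eq_of_C v
  intro v
  apply eq_of_C w
  intro w
  apply eq_of_C z
  intro z
  simp only [← C_tmul, app_C_C]
  simp

@[simp] lemma app_assoc_symm_tens (v : FSeries V) (w : FSeries W) (z : FSeries Z) :
    app S (C (TensorProduct.assoc S V W Z).symm.toLinearMap) (v ⊗ₕ[S] (w ⊗ₕ[S] z)) =
      (v ⊗ₕ[S] w) ⊗ₕ[S] z := by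
  apply eq_of_C v
  intro v
  apply eq_of_C w
  intro w
  apply eq_of_C z
  intro z
  simp only [← C_tmul, app_C_C]
  simp

end AssocTensor

section ConstantMaps
variable {V V' W W' : Type*} [AddCommGroup V] [Module ℂ V] [AddCommGroup V'] [Module ℂ V']
  [AddCommGroup W] [Module ℂ W] [AddCommGroup W'] [Module ℂ W']

lemma app_C_rTensor_tens (f : V →ₗ[ℂ] V') (v : V) (w : FSeries W) :
    app ℂ (C (f.rTensor W)) (C v ⊗ₕ[ℂ] w) = C (f v) ⊗ₕ[ℂ] w := by
  apply eq_of_C w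
  intro w
  simp only [← C_tmul, app_C_C]
  simp

lemma app_C_lTensor_tens (g : W →ₗ[ℂ] W') (v : FSeries V) (w : FSeries W) :
    app ℂ (C (g.lTensor V)) (v ⊗ₕ[ℂ] w) = v ⊗ₕ[ℂ] app ℂ (C g) w := by
  apply eq_of_C v
  intro v
  apply eq_of_C w
  intro w
  simp only [← C_tmul, app_C_C]
  simp

lemma app_C_injective {f : V →ₗ[ℂ] W} (hf : Function.Injective f) :
    Function.Injective (app ℂ (C f)) := fun x y h => by
  ext n
  have := congrFun h n
  rw [app_C_left_coeff, app_C_left_coeff] at this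
  exact hf this

end ConstantMaps

end FSeries

/-! ### Multiplication operators on the total algebra -/

namespace QUEAlgebra
open TensorProduct FSeries
open scoped Polynomial

variable {𝔤 : Type*} [LieRing 𝔤] [LieAlgebra ℂ 𝔤] (A : QUEAlgebra 𝔤) {r : ℕ}

/-- The product of `U_ħ𝔤`. -/
noncomputable def umul : FSeries (UEA 𝔤) →ₗ[ℂ[X]] FSeries (UEA 𝔤) →ₗ[ℂ[X]] FSeries (UEA 𝔤) :=
  bil ℂ ℂ (ofSeq A.mul)

lemma umul_assoc (x y z : FSeries (UEA 𝔤)) :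
    A.umul (A.umul x y) z = A.umul x (A.umul y z) := A.mul_assoc x y z
lemma one_umul (x : FSeries (UEA 𝔤)) : A.umul (C 1) x = x := A.one_mul x
lemma umul_one (x : FSeries (UEA 𝔤)) : A.umul x (C 1) = x := A.mul_one x

/-- The coproduct of `U_ħ𝔤`. -/
noncomputable def ucomul : FSeries (UEA 𝔤) →ₗ[ℂ[X]] FSeries (UEA 𝔤 ⊗[ℂ] UEA 𝔤) :=
  app ℂ (ofSeq A.comul)

/-- The product of `U_ħ𝔤 ⊗ U_ħ𝔤`. -/
noncomputable def umul₂ : FSeries (UEA 𝔤 ⊗[ℂ] UEA 𝔤) →ₗ[ℂ[X]] FSeries (UEA 𝔤 ⊗[ℂ] UEA 𝔤) →ₗ[ℂ[X]]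
    FSeries (UEA 𝔤 ⊗[ℂ] UEA 𝔤) := bil ℂ ℂ (ofSeq A.mul₂)

lemma umul₂_tens (a b c d : FSeries (UEA 𝔤)) :
    A.umul₂ (a ⊗ₕ[ℂ] b) (c ⊗ₕ[ℂ] d) = A.umul a c ⊗ₕ[ℂ] A.umul b d := tensorMul_tens _ _ _ _ _ _

lemma ucomul_umul (x y : FSeries (UEA 𝔤)) :
    A.ucomul (A.umul x y) = A.umul₂ (A.ucomul x) (A.ucomul y) := A.comul_mul x y

/-- Right multiplication by `∂_i` on `H`. Like every right multiplication it is linear over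
`R = ℳ(η*)⟦ħ⟧`, which acts on `H` from the left, and therefore acts on the factors of `H ⊗_R H`. -/
noncomputable def rightPd (𝔤 : Type*) [LieRing 𝔤] [LieAlgebra ℂ 𝔤] (i : Fin r) :
    FSeries (HCoeff 𝔤 r →ₗ[Mero r] HCoeff 𝔤 r) :=
  C (AlgebraTensorModule.map (LinearMap.mulRight (Mero r) (DiffOp.pd i)) LinearMap.id)

/-- Right multiplication by `h` on `H`, where `h` is in `U𝔤`. -/
noncomputable def rightU (r : ℕ) (h : UEA 𝔤) : FSeries (HCoeff 𝔤 r →ₗ[Mero r] HCoeff 𝔤 r) :=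
  ofSeq fun n => AlgebraTensorModule.lTensor (Mero r) (DiffOp r) ((A.mul n).flip h)

@[simp] lemma app_rightPd (i : Fin r) (d : DiffOp r) (u : FSeries (UEA 𝔤)) :
    app (Mero r) (rightPd 𝔤 i) (C d ⊗ₕ[ℂ] u) = C (d * DiffOp.pd i) ⊗ₕ[ℂ] u := by
  apply eq_of_C u
  intro u
  rw [← C_tmul, rightPd, app_C_C, ← C_tmul]
  simp

@[simp] lemma app_rightU (h : UEA 𝔤) (d : FSeries (DiffOp r)) (u : FSeries (UEA 𝔤)) :
    app (Mero r) (A.rightU r h) (d ⊗ₕ[ℂ] u) = d ⊗ₕ[ℂ] A.umul u (C h) := by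
  apply eq_of_C u
  intro u
  apply eq_of_C d
  intro d
  ext n
  rw [← C_tmul, app_C_right_coeff, tens_coeff,
    sum_antidiagonal_C' d n (fun x m => x ⊗ₜ A.umul (C u) (C h) m) (by simp), umul, bil_C_C_coeff]
  simp [rightU]

/-- The operator `id ⊗ L_u` on `H`, where `L_u` is left multiplication by `u` in `U_ħ𝔤`. -/
noncomputable def leftU (r : ℕ) :
    FSeries (UEA 𝔤) →ₗ[ℂ[X]] FSeries (HCoeff 𝔤 r) →ₗ[ℂ[X]] FSeries (HCoeff 𝔤 r) :=
  bil ℂ (Mero r) (ofSeq A.leftMulU)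

@[simp] lemma leftU_tens (a u : FSeries (UEA 𝔤)) (d : FSeries (DiffOp r)) :
    A.leftU r a (d ⊗ₕ[ℂ] u) = d ⊗ₕ[ℂ] A.umul a u := by
  apply eq_of_C u
  intro u
  apply eq_of_C d
  intro d
  apply eq_of_C a
  intro a
  ext n
  rw [← C_tmul, leftU, bil_C_C_coeff, tens_coeff,
    sum_antidiagonal_C' d n (fun x m => x ⊗ₜ A.umul (C a) (C u) m) (by simp), umul, bil_C_C_coeff]
  simp [leftMulU]

/-- The action of `U_ħ𝔤 ⊗ U_ħ𝔤` on `H ⊗_R H` by left multiplication. -/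
noncomputable def leftUU (r : ℕ) : FSeries (UEA 𝔤 ⊗[ℂ] UEA 𝔤) →ₗ[ℂ[X]]
    FSeries (HHCoeff 𝔤 r) →ₗ[ℂ[X]] FSeries (HHCoeff 𝔤 r) :=
  bil ℂ (Mero r) (ofSeq A.leftMulUU)

@[simp] lemma leftUU_tens (a b : FSeries (UEA 𝔤)) (x y : FSeries (HCoeff 𝔤 r)) :
    A.leftUU r (a ⊗ₕ[ℂ] b) (x ⊗ₕ[Mero r] y) = A.leftU r a x ⊗ₕ[Mero r] A.leftU r b y := by
  apply eq_of_C a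
  intro a
  apply eq_of_C b
  intro b
  apply eq_of_C x
  intro x
  apply eq_of_C y
  intro y
  ext n
  rw [← C_tmul, ← C_tmul, leftUU, bil_C_C_coeff, tens_coeff]
  simp only [leftU, bil_C_C_coeff]
  simp [leftMulUU, LinearMap.sum_apply]

lemma leftU_umul (a b : FSeries (UEA 𝔤)) (x : FSeries (HCoeff 𝔤 r)) :
    A.leftU r (A.umul a b) x = A.leftU r a (A.leftU r b x) := by
  apply eq_of_tens x
  intro d u
  simp [umul_assoc]

lemma leftUU_umul₂ (a b : FSeries (UEA 𝔤 ⊗[ℂ] UEA 𝔤)) (x : FSeries (HHCoeff 𝔤 r)) :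
    A.leftUU r (A.umul₂ a b) x = A.leftUU r a (A.leftUU r b x) := by
  apply eq_of_tens x
  intro x y
  apply eq_of_tens a
  intro a a'
  apply eq_of_tens b
  intro b b'
  simp [umul₂_tens, leftU_umul]

/-- The action of a differential operator on `H ⊗_R H` through its coproduct. -/
noncomputable def dAct (d : DiffOp r) : FSeries (HHCoeff 𝔤 r) →ₗ[ℂ[X]] FSeries (HHCoeff 𝔤 r) :=
  app ℂ (C (diffOpAct d))

/-- The element `Δ(x) G` of `H ⊗_R H`, for `x` in `H` and `G` in `H ⊗_R H`. -/
noncomputable def hAct (r : ℕ) : FSeries (HCoeff 𝔤 r) →ₗ[ℂ[X]]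
    FSeries (HHCoeff 𝔤 r) →ₗ[ℂ[X]] FSeries (HHCoeff 𝔤 r) :=
  bil (Mero r) ℂ (ofSeq A.act)

lemma app_actOn (G : FSeries (HHCoeff 𝔤 r)) (x : FSeries (HCoeff 𝔤 r)) :
    app (Mero r) (ofSeq (A.actOn G)) x = A.hAct r x G := by
  apply eq_of_C x
  intro x
  ext n
  rw [app_C_right_coeff, hAct, bil_apply, app_coeff]
  simp only [app_C_right_coeff]
  simp [actOn, happ, LinearMap.sum_apply]

lemma hAct_tens (d : DiffOp r) (u : FSeries (UEA 𝔤)) (G : FSeries (HHCoeff 𝔤 r)) :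
    A.hAct r (C d ⊗ₕ[ℂ] u) G = dAct d (A.leftUU r (A.ucomul u) G) := by
  apply eq_of_C u
  intro u
  apply eq_of_C G
  intro G
  ext n
  rw [← C_tmul, hAct, bil_C_C_coeff, dAct, app_C_left_coeff, leftUU, bil_apply, app_C_right_coeff,
    app_coeff]
  simp only [ucomul, app_C_right_coeff]
  simp [act, ueaAct, LinearMap.sum_apply]

end QUEAlgebra

/-! ### The action through the coproduct -/

/-- Induction on differential operators. -/
theorem DiffOp.induction {r : ℕ} {p : DiffOp r → Prop} (hf : ∀ f, p (DiffOp.ofMero f))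
    (hpd : ∀ i, p (DiffOp.pd i)) (hadd : ∀ d e, p d → p e → p (d + e))
    (hmul : ∀ d e, p d → p e → p (d * e)) (d : DiffOp r) : p d := by
  obtain ⟨x, hx⟩ := d
  refine Algebra.adjoin_induction (p := fun x hx => p ⟨x, hx⟩) ?_ ?_ ?_ ?_ hx
  · rintro _ ⟨f | i, rfl⟩
    · exact hf f
    · exact hpd i
  · intro c
    have := hf (algebraMap ℂ (Mero r) c)
    rw [AlgHom.commutes] at this
    exact this
  · intro x y hx hy h h'
    exact hadd _ _ h h'
  · intro x y hx hy h h'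
    exact hmul _ _ h h'

namespace QUEAlgebra
open TensorProduct FSeries
open scoped Polynomial

variable {𝔤 : Type*} [LieRing 𝔤] [LieAlgebra ℂ 𝔤] (A : QUEAlgebra 𝔤) {r : ℕ}

/-- Left multiplication by `∂_i` on `H`. -/
noncomputable def leftPd (𝔤 : Type*) [LieRing 𝔤] [LieAlgebra ℂ 𝔤] (i : Fin r) :
    FSeries (HCoeff 𝔤 r) →ₗ[ℂ[X]] FSeries (HCoeff 𝔤 r) :=
  app ℂ (C ((LinearMap.mulLeft ℂ (DiffOp.pd i)).rTensor (UEA 𝔤)))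

@[simp] lemma leftPd_tens (i : Fin r) (d : DiffOp r) (u : FSeries (UEA 𝔤)) :
    leftPd 𝔤 i (C d ⊗ₕ[ℂ] u) = C (DiffOp.pd i * d) ⊗ₕ[ℂ] u := by
  apply eq_of_C u
  intro u
  rw [← C_tmul, leftPd, app_C_C, ← C_tmul]
  simp

lemma dAct_mul (d e : DiffOp r) (G : FSeries (HHCoeff 𝔤 r)) :
    dAct (d * e) G = dAct d (dAct e G) := by
  apply eq_of_C G
  intro G
  simp [dAct]

lemma dAct_add (d e : DiffOp r) (G : FSeries (HHCoeff 𝔤 r)) :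
    dAct (d + e) G = dAct d G + dAct e G := by
  simp [dAct]

lemma dAct_ofMero_C (f : Mero r) (G : HHCoeff 𝔤 r) :
    dAct (DiffOp.ofMero f) (C G) = C (f • G) := by
  rw [dAct, app_C_C, diffOpAct, DiffOp.lift_ofMero]
  rfl

@[simp] lemma dAct_ofMero_tens (f : Mero r) (d : DiffOp r) (u : FSeries (UEA 𝔤))
    (y : FSeries (HCoeff 𝔤 r)) : dAct (DiffOp.ofMero f) ((C d ⊗ₕ[ℂ] u) ⊗ₕ[Mero r] y) =
      (C (DiffOp.ofMero f * d) ⊗ₕ[ℂ] u) ⊗ₕ[Mero r] y := by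
  apply eq_of_C u
  intro u
  apply eq_of_C y
  intro y
  simp only [← C_tmul, dAct_ofMero_C, TensorProduct.smul_tmul']
  rfl

@[simp] lemma dAct_pd_tens (i : Fin r) (x y : FSeries (HCoeff 𝔤 r)) :
    dAct (DiffOp.pd i) (x ⊗ₕ[Mero r] y) =
      leftPd 𝔤 i x ⊗ₕ[Mero r] y + x ⊗ₕ[Mero r] leftPd 𝔤 i y := by
  apply eq_of_C_tens x
  intro d u
  apply eq_of_C_tens y
  intro e v
  apply eq_of_C u
  intro u
  apply eq_of_C v
  intro v
  simp only [leftPd_tens]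
  simp only [← C_tmul, dAct, app_C_C, diffOpAct, DiffOp.lift_pd, partialAct_tmul, map_add]
  rfl

/-- An operator that commutes with the multiplications by functions and with the `Δ(∂_i)` commutes
with the action of all differential operators. -/
lemma dAct_comm (E : FSeries (HHCoeff 𝔤 r) →ₗ[ℂ[X]] FSeries (HHCoeff 𝔤 r))
    (hf : ∀ f G, E (dAct (DiffOp.ofMero f) G) = dAct (DiffOp.ofMero f) (E G))
    (hpd : ∀ i G, E (dAct (DiffOp.pd i) G) = dAct (DiffOp.pd i) (E G)) (d : DiffOp r)
    (G : FSeries (HHCoeff 𝔤 r)) : E (dAct d G) = dAct d (E G) := by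
  induction d using DiffOp.induction generalizing G with
  | hf f => exact hf f G
  | hpd i => exact hpd i G
  | hadd d e hd he => rw [dAct_add, dAct_add, map_add, hd, he]
  | hmul d e hd he => rw [dAct_mul, dAct_mul, hd, he]

lemma app_dAct_ofMero (φ : FSeries (HHCoeff 𝔤 r →ₗ[Mero r] HHCoeff 𝔤 r)) (f : Mero r)
    (G : FSeries (HHCoeff 𝔤 r)) : app (Mero r) φ (dAct (DiffOp.ofMero f) G) =
      dAct (DiffOp.ofMero f) (app (Mero r) φ G) := by
  apply eq_of_C G
  intro G
  rw [dAct_ofMero_C]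
  ext n
  rw [app_C_right_coeff, dAct, app_C_left_coeff, app_C_right_coeff, map_smul, diffOpAct,
    DiffOp.lift_ofMero]
  rfl

/-- An operator on `H` that commutes with left multiplication by the `∂_i` and by elements of
`U_ħ𝔤`; right multiplications are of this kind. -/
def CommLeft (φ : FSeries (HCoeff 𝔤 r →ₗ[Mero r] HCoeff 𝔤 r)) : Prop :=
  (∀ i x, app (Mero r) φ (leftPd 𝔤 i x) = leftPd 𝔤 i (app (Mero r) φ x)) ∧
    ∀ a x, app (Mero r) φ (A.leftU r a x) = A.leftU r a (app (Mero r) φ x)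

lemma commLeft_rightPd (i : Fin r) : A.CommLeft (rightPd 𝔤 i) := by
  refine ⟨fun j x => ?_, fun a x => ?_⟩
  · apply eq_of_C_tens x
    intro d u
    simp [_root_.mul_assoc]
  · apply eq_of_C_tens x
    intro d u
    simp

lemma commLeft_rightU (h : UEA 𝔤) : A.CommLeft (A.rightU r h) := by
  refine ⟨fun j x => ?_, fun a x => ?_⟩
  · apply eq_of_C_tens x
    intro d u
    simp
  · apply eq_of_C_tens x
    intro d u
    simp [umul_assoc]

section CommLeft
variable {A} {φ : FSeries (HCoeff 𝔤 r →ₗ[Mero r] HCoeff 𝔤 r)}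

/-- The operator `φ ⊗ id` commutes with the action of `H` through its coproduct, since that action is
by left multiplications. -/
lemma CommLeft.hAct_rT (hφ : A.CommLeft φ) (x : FSeries (HCoeff 𝔤 r)) (G : FSeries (HHCoeff 𝔤 r)) :
    A.hAct r x (app (Mero r) (rT (HCoeff 𝔤 r) φ) G) =
      app (Mero r) (rT (HCoeff 𝔤 r) φ) (A.hAct r x G) := by
  apply eq_of_C_tens x
  intro d u
  rw [hAct_tens, hAct_tens, dAct_comm _ (app_dAct_ofMero _)]
  · congr 1
    generalize A.ucomul u = z
    apply eq_of_tens z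
    intro a b
    apply eq_of_tens G
    intro y y'
    simp [hφ.2]
  · intro i G
    apply eq_of_tens G
    intro y y'
    simp [hφ.1]

lemma CommLeft.hAct_lT (hφ : A.CommLeft φ) (x : FSeries (HCoeff 𝔤 r)) (G : FSeries (HHCoeff 𝔤 r)) :
    A.hAct r x (app (Mero r) (lT (HCoeff 𝔤 r) φ) G) =
      app (Mero r) (lT (HCoeff 𝔤 r) φ) (A.hAct r x G) := by
  apply eq_of_C_tens x
  intro d u
  rw [hAct_tens, hAct_tens, dAct_comm _ (app_dAct_ofMero _)]
  · congr 1
    generalize A.ucomul u = z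
    apply eq_of_tens z
    intro a b
    apply eq_of_tens G
    intro y y'
    simp [hφ.2]
  · intro i G
    apply eq_of_tens G
    intro y y'
    simp [hφ.1]

end CommLeft

lemma leftUU_dAct_pd (i : Fin r) (z : FSeries (UEA 𝔤 ⊗[ℂ] UEA 𝔤)) (G : FSeries (HHCoeff 𝔤 r)) :
    A.leftUU r z (dAct (DiffOp.pd i) G) = dAct (DiffOp.pd i) (A.leftUU r z G) := by
  have h : ∀ a (x : FSeries (HCoeff 𝔤 r)),
      A.leftU r a (leftPd 𝔤 i x) = leftPd 𝔤 i (A.leftU r a x) := fun a x => by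
    apply eq_of_C_tens x
    intro d u
    simp
  apply eq_of_tens z
  intro a b
  apply eq_of_tens G
  intro y y'
  simp [h]

/-- `Δ(x ∂_i) G = Δ(x) Δ(∂_i) G`. -/
lemma hAct_rightPd (i : Fin r) (x : FSeries (HCoeff 𝔤 r)) (G : FSeries (HHCoeff 𝔤 r)) :
    A.hAct r (app (Mero r) (rightPd 𝔤 i) x) G = A.hAct r x (dAct (DiffOp.pd i) G) := by
  apply eq_of_C_tens x
  intro d u
  rw [app_rightPd, hAct_tens, hAct_tens, leftUU_dAct_pd, dAct_mul]

/-- `Δ(x h) G = Δ(x) Δ₀(h) G`. -/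
lemma hAct_rightU (h : UEA 𝔤) (x : FSeries (HCoeff 𝔤 r)) (G : FSeries (HHCoeff 𝔤 r)) :
    A.hAct r (app (Mero r) (A.rightU r h) x) G =
      A.hAct r x (A.leftUU r (A.ucomul (C h)) G) := by
  apply eq_of_C_tens x
  intro d u
  rw [app_rightU, hAct_tens, hAct_tens, ucomul_umul, leftUU_umul₂]

/-! ### Functions with values in tensor powers of `U_ħ𝔤` -/

/-- The derivative `∂/∂λ_i` of a function with values in `W`. -/
noncomputable def mpd (W : Type*) [AddCommGroup W] [Module ℂ W] (i : Fin r) :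
    FSeries (Mero r ⊗[ℂ] W) →ₗ[ℂ[X]] FSeries (Mero r ⊗[ℂ] W) :=
  app ℂ (C ((Mero.pderiv i).toLinearMap.rTensor W))

@[simp] lemma mpd_tens {W : Type*} [AddCommGroup W] [Module ℂ W] (i : Fin r) (f : Mero r)
    (w : FSeries W) : mpd W i (C f ⊗ₕ[ℂ] w) = C (Mero.pderiv i f) ⊗ₕ[ℂ] w :=
  app_C_rTensor_tens _ _ _

/-- The product of functions with values in the algebra with product `μ`. -/
noncomputable def mmul (r : ℕ) {W : Type*} [AddCommGroup W] [Module ℂ W]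
    (μ : ℕ → W →ₗ[ℂ] W →ₗ[ℂ] W) : FSeries (Mero r ⊗[ℂ] W) →ₗ[ℂ[X]] FSeries (Mero r ⊗[ℂ] W) →ₗ[ℂ[X]]
      FSeries (Mero r ⊗[ℂ] W) :=
  bil ℂ ℂ (ofSeq (meroMul r μ))

@[simp] lemma mmul_tens {W : Type*} [AddCommGroup W] [Module ℂ W]
    (μ : ℕ → W →ₗ[ℂ] W →ₗ[ℂ] W) (f g : Mero r) (v w : FSeries W) :
    mmul r μ (C f ⊗ₕ[ℂ] v) (C g ⊗ₕ[ℂ] w) = C (f * g) ⊗ₕ[ℂ] bil ℂ ℂ (ofSeq μ) v w := by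
  rw [mmul, meroMul, tensorMul_tens]
  congr 2
  exact bil_C_C_C (S := ℂ) (S' := ℂ) (LinearMap.mul ℂ (Mero r)) f g

/-- The map from functions with values in `U_ħ𝔤 ⊗ U_ħ𝔤` to `H ⊗_R H`. -/
noncomputable def iota₂ (𝔤 : Type*) [LieRing 𝔤] [LieAlgebra ℂ 𝔤] (r : ℕ) :
    FSeries (Mero r ⊗[ℂ] (UEA 𝔤 ⊗[ℂ] UEA 𝔤)) →ₗ[ℂ[X]] FSeries (HHCoeff 𝔤 r) :=
  app ℂ (C (toBalanced ∘ₗ embed))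

@[simp] lemma iota₂_tens (f : Mero r) (u v : FSeries (UEA 𝔤)) :
    iota₂ 𝔤 r (C f ⊗ₕ[ℂ] (u ⊗ₕ[ℂ] v)) =
      (C (DiffOp.ofMero f) ⊗ₕ[ℂ] u) ⊗ₕ[Mero r] (C 1 ⊗ₕ[ℂ] v) := by
  apply eq_of_C u
  intro u
  apply eq_of_C v
  intro v
  simp only [← C_tmul, iota₂, app_C_C]
  rfl

/-- The Leibniz rule: `Δ(∂_i) F = ∂F/∂λ_i + F (∂_i ⊗ 1 + 1 ⊗ ∂_i)` in `H ⊗_R H`. -/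
lemma dAct_pd_iota₂ (i : Fin r) (F : FSeries (Mero r ⊗[ℂ] (UEA 𝔤 ⊗[ℂ] UEA 𝔤))) :
    dAct (DiffOp.pd i) (iota₂ 𝔤 r F) = iota₂ 𝔤 r (mpd _ i F) +
      (app (Mero r) (rT (HCoeff 𝔤 r) (rightPd 𝔤 i)) (iota₂ 𝔤 r F) +
        app (Mero r) (lT (HCoeff 𝔤 r) (rightPd 𝔤 i)) (iota₂ 𝔤 r F)) := by
  apply eq_of_C_tens F
  intro f z
  apply eq_of_tens z
  intro u v
  simp [DiffOp.pd_mul_ofMero]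
  abel

lemma leftUU_iota₂ (z : FSeries (UEA 𝔤 ⊗[ℂ] UEA 𝔤))
    (F : FSeries (Mero r ⊗[ℂ] (UEA 𝔤 ⊗[ℂ] UEA 𝔤))) :
    A.leftUU r z (iota₂ 𝔤 r F) = iota₂ 𝔤 r (mmul r A.mul₂ (C 1 ⊗ₕ[ℂ] z) F) := by
  apply eq_of_C_tens F
  intro f w
  apply eq_of_tens w
  intro u v
  apply eq_of_tens z
  intro a b
  rw [mmul_tens, ← umul₂, umul₂_tens]
  simp

lemma iota₂_mul_primitive (h : UEA 𝔤) (F : FSeries (Mero r ⊗[ℂ] (UEA 𝔤 ⊗[ℂ] UEA 𝔤))) :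
    iota₂ 𝔤 r (mmul r A.mul₂ F (C 1 ⊗ₕ[ℂ] (C h ⊗ₕ[ℂ] C 1 + C 1 ⊗ₕ[ℂ] C h))) =
      app (Mero r) (rT (HCoeff 𝔤 r) (A.rightU r h)) (iota₂ 𝔤 r F) +
        app (Mero r) (lT (HCoeff 𝔤 r) (A.rightU r h)) (iota₂ 𝔤 r F) := by
  apply eq_of_C_tens F
  intro f w
  apply eq_of_tens w
  intro u v
  rw [mmul_tens, ← umul₂, map_add, umul₂_tens, umul₂_tens]
  simp [umul_one]

/-- If `F` has zero weight, then `Δ(h) F` is the result of multiplying `F` by `h ⊗ 1 + 1 ⊗ h` on the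
right. -/
lemma leftUU_comul_iota₂ {h : UEA 𝔤} (hh : A.ucomul (C h) = C h ⊗ₕ[ℂ] C 1 + C 1 ⊗ₕ[ℂ] C h)
    {F : FSeries (Mero r ⊗[ℂ] (UEA 𝔤 ⊗[ℂ] UEA 𝔤))}
    (hF : mmul r A.mul₂ F (C 1 ⊗ₕ[ℂ] (C h ⊗ₕ[ℂ] C 1 + C 1 ⊗ₕ[ℂ] C h)) =
      mmul r A.mul₂ (C 1 ⊗ₕ[ℂ] (C h ⊗ₕ[ℂ] C 1 + C 1 ⊗ₕ[ℂ] C h)) F) :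
    A.leftUU r (A.ucomul (C h)) (iota₂ 𝔤 r F) =
      app (Mero r) (rT (HCoeff 𝔤 r) (A.rightU r h)) (iota₂ 𝔤 r F) +
        app (Mero r) (lT (HCoeff 𝔤 r) (A.rightU r h)) (iota₂ 𝔤 r F) := by
  rw [leftUU_iota₂, hh, ← hF, iota₂_mul_primitive]

end QUEAlgebra

/-! ### The twist `Θ` as an operator -/

namespace QUEAlgebra
open TensorProduct FSeries
open scoped Polynomial

variable {𝔤 : Type*} [LieRing 𝔤] [LieAlgebra ℂ 𝔤] (A : QUEAlgebra 𝔤) {r : ℕ}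

/-- Right multiplication by `∑ i, ∂_i ⊗ h_i` on `H ⊗_R H`. -/
noncomputable def theta₂ (h : Fin r → UEA 𝔤) : Module.End ℂ[X] (FSeries (HHCoeff 𝔤 r)) :=
  ∑ i, app (Mero r) (rT (HCoeff 𝔤 r) (rightPd 𝔤 i)) ∘ₗ
    app (Mero r) (lT (HCoeff 𝔤 r) (A.rightU r (h i)))

@[simp] lemma theta₂_tens (h : Fin r → UEA 𝔤) (x y : FSeries (HCoeff 𝔤 r)) :
    A.theta₂ h (x ⊗ₕ[Mero r] y) =
      ∑ i, app (Mero r) (rightPd 𝔤 i) x ⊗ₕ[Mero r] app (Mero r) (A.rightU r (h i)) y := by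
  simp [theta₂, LinearMap.sum_apply]

/-- The right multiplication `theta₂` commutes with left multiplication by `Δ(x)`. -/
lemma hAct_theta₂ (h : Fin r → UEA 𝔤) (x : FSeries (HCoeff 𝔤 r)) (G : FSeries (HHCoeff 𝔤 r)) :
    A.hAct r x (A.theta₂ h G) = A.theta₂ h (A.hAct r x G) := by
  simp only [theta₂, LinearMap.sum_apply, LinearMap.comp_apply, map_sum,
    (A.commLeft_rightPd _).hAct_rT, (A.commLeft_rightU _).hAct_lT]

/-- The product of `H ⊗ H`. -/
noncomputable def mulHH (r : ℕ) : FSeries (HCoeff 𝔤 r ⊗[ℂ] HCoeff 𝔤 r) →ₗ[ℂ[X]]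
    FSeries (HCoeff 𝔤 r ⊗[ℂ] HCoeff 𝔤 r) →ₗ[ℂ[X]] FSeries (HCoeff 𝔤 r ⊗[ℂ] HCoeff 𝔤 r) :=
  bil ℂ ℂ (ofSeq (tensorMul (A.mulH r) (A.mulH r)))

lemma bil_diffOpMul_C (d e : DiffOp r) :
    bil ℂ ℂ (ofSeq (hconst (LinearMap.mul ℂ (DiffOp r)))) (C d) (C e) = C (d * e) :=
  bil_C_C_C (S := ℂ) (S' := ℂ) (LinearMap.mul ℂ (DiffOp r)) d e

lemma bil_mulH_tens (d d' : DiffOp r) (u u' : FSeries (UEA 𝔤)) :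
    bil ℂ ℂ (ofSeq (A.mulH r)) (C d ⊗ₕ[ℂ] u) (C d' ⊗ₕ[ℂ] u') =
      C (d * d') ⊗ₕ[ℂ] A.umul u u' := by
  rw [mulH, tensorMul_tens, bil_diffOpMul_C, umul]

lemma mulHH_tens (d d' e e' : DiffOp r) (u u' v v' : FSeries (UEA 𝔤)) :
    A.mulHH r ((C d ⊗ₕ[ℂ] u) ⊗ₕ[ℂ] (C e ⊗ₕ[ℂ] v)) ((C d' ⊗ₕ[ℂ] u') ⊗ₕ[ℂ] (C e' ⊗ₕ[ℂ] v')) =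
      (C (d * d') ⊗ₕ[ℂ] A.umul u u') ⊗ₕ[ℂ] (C (e * e') ⊗ₕ[ℂ] A.umul v v') := by
  refine (tensorMul_tens _ _ _ _ _ _).trans ?_
  rw [bil_mulH_tens, bil_mulH_tens]

lemma mulHH_assoc (x y z : FSeries (HCoeff 𝔤 r ⊗[ℂ] HCoeff 𝔤 r)) :
    A.mulHH r (A.mulHH r x y) z = A.mulHH r x (A.mulHH r y z) := by
  have hD : ∀ x y z : FSeries (DiffOp r), bil ℂ ℂ (ofSeq (hconst (LinearMap.mul ℂ (DiffOp r))))
      (bil ℂ ℂ (ofSeq (hconst (LinearMap.mul ℂ (DiffOp r)))) x y) z =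
      bil ℂ ℂ (ofSeq (hconst (LinearMap.mul ℂ (DiffOp r)))) x
      (bil ℂ ℂ (ofSeq (hconst (LinearMap.mul ℂ (DiffOp r)))) y z) := fun x y z => by
    apply eq_of_C x
    intro x
    apply eq_of_C y
    intro y
    apply eq_of_C z
    intro z
    simp only [bil_diffOpMul_C, _root_.mul_assoc]
  exact tensorMul_assoc (tensorMul_assoc hD A.umul_assoc) (tensorMul_assoc hD A.umul_assoc) x y z

/-- The projection `H ⊗ H → H ⊗_R H`. -/
noncomputable def bal (𝔤 : Type*) [LieRing 𝔤] [LieAlgebra ℂ 𝔤] (r : ℕ) :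
    FSeries (HCoeff 𝔤 r ⊗[ℂ] HCoeff 𝔤 r) →ₗ[ℂ[X]] FSeries (HHCoeff 𝔤 r) :=
  app ℂ (C toBalanced)

@[simp] lemma bal_tens (x y : FSeries (HCoeff 𝔤 r)) : bal 𝔤 r (x ⊗ₕ[ℂ] y) = x ⊗ₕ[Mero r] y := by
  apply eq_of_C x
  intro x
  apply eq_of_C y
  intro y
  rw [← C_tmul, ← C_tmul, bal, app_C_C]
  rfl

section Theta
variable {η : LieSubalgebra ℂ 𝔤} (b : Module.Basis (Fin r) ℂ η)

lemma bal_mulHH_theta (z : FSeries (HCoeff 𝔤 r ⊗[ℂ] HCoeff 𝔤 r)) :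
    bal 𝔤 r (A.mulHH r z (C (theta b))) =
      A.theta₂ (fun i => UEA.of 𝔤 (b i)) (bal 𝔤 r z) := by
  apply eq_of_tens z
  intro x y
  apply eq_of_C_tens x
  intro d u
  apply eq_of_C_tens y
  intro e v
  simp only [theta, map_sum, C_tmul, mulHH_tens]
  simp [umul_one]

lemma bal_mulHH_thetaPow (z : FSeries (HCoeff 𝔤 r ⊗[ℂ] HCoeff 𝔤 r)) (k : ℕ) :
    bal 𝔤 r (A.mulHH r z (ofSeq (A.thetaPow b k))) =
      (A.theta₂ (fun i => UEA.of 𝔤 (b i)) ^ k) (bal 𝔤 r z) := by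
  induction k with
  | zero =>
    -- the zeroth power is the unit of `H ⊗ H`
    change bal 𝔤 r (A.mulHH r z (C ((1 ⊗ₜ 1) ⊗ₜ (1 ⊗ₜ 1)))) = bal 𝔤 r z
    apply eq_of_tens z
    intro x y
    apply eq_of_C_tens x
    intro d u
    apply eq_of_C_tens y
    intro e v
    simp only [C_tmul, mulHH_tens]
    simp [umul_one]
  | succ k ih =>
    change bal 𝔤 r (A.mulHH r z (A.mulHH r (ofSeq (A.thetaPow b k)) (C (theta b)))) = _
    rw [← mulHH_assoc, bal_mulHH_theta, ih, pow_succ', Module.End.mul_apply]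

lemma ofSeq_Theta : ofSeq (A.Theta b) =
    FSeries.sum fun k => ((k.factorial : ℂ)⁻¹) • ofSeq (A.thetaPow b k) := rfl

/-- The element `F(λ)Θ` is obtained from `F(λ)` by the exponential of the operator `theta₂`. -/
lemma ofSeq_twistElt (F : FSeries (Mero r ⊗[ℂ] (UEA 𝔤 ⊗[ℂ] UEA 𝔤))) :
    ofSeq (A.twistElt b F) =
      fexp (A.theta₂ (fun i => UEA.of 𝔤 (b i))) (iota₂ 𝔤 r F) := by
  change bal 𝔤 r (A.mulHH r (app ℂ (C embed) F) (ofSeq (A.Theta b))) = _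
  have h : bal 𝔤 r (app ℂ (C embed) F) = iota₂ 𝔤 r F := by
    apply eq_of_C F
    intro F
    simp [bal, iota₂]
  rw [ofSeq_Theta, map_series_sum, map_series_sum, fexp_apply]
  simp only [LinearMap.map_smul_of_tower, bal_mulHH_thetaPow, h]

end Theta

/-! ### Operators on the triple tensor product -/

/-- The coefficients of `H ⊗_R H ⊗_R H`. -/
abbrev HHHCoeff (𝔤 : Type*) [LieRing 𝔤] [LieAlgebra ℂ 𝔤] (r : ℕ) :=
  HCoeff 𝔤 r ⊗[Mero r] HHCoeff 𝔤 r

section Slots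
variable (φ : FSeries (HCoeff 𝔤 r →ₗ[Mero r] HCoeff 𝔤 r))

/-- The operator `φ ⊗ id ⊗ id`. -/
noncomputable def slot₁ : Module.End ℂ[X] (FSeries (HHHCoeff 𝔤 r)) :=
  app (Mero r) (rT (HHCoeff 𝔤 r) φ)

/-- The operator `id ⊗ φ ⊗ id`. -/
noncomputable def slot₂ : Module.End ℂ[X] (FSeries (HHHCoeff 𝔤 r)) :=
  app (Mero r) (lT (HCoeff 𝔤 r) (rT (HCoeff 𝔤 r) φ))

/-- The operator `id ⊗ id ⊗ φ`. -/
noncomputable def slot₃ : Module.End ℂ[X] (FSeries (HHHCoeff 𝔤 r)) :=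
  app (Mero r) (lT (HCoeff 𝔤 r) (lT (HCoeff 𝔤 r) φ))

@[simp] lemma slot₁_tens (x : FSeries (HCoeff 𝔤 r)) (z : FSeries (HHCoeff 𝔤 r)) :
    slot₁ φ (x ⊗ₕ[Mero r] z) = app (Mero r) φ x ⊗ₕ[Mero r] z := app_rT_tens _ _ _

lemma slot₂_tens' (x : FSeries (HCoeff 𝔤 r)) (z : FSeries (HHCoeff 𝔤 r)) :
    slot₂ φ (x ⊗ₕ[Mero r] z) = x ⊗ₕ[Mero r] app (Mero r) (rT (HCoeff 𝔤 r) φ) z :=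
  app_lT_tens _ _ _

lemma slot₃_tens' (x : FSeries (HCoeff 𝔤 r)) (z : FSeries (HHCoeff 𝔤 r)) :
    slot₃ φ (x ⊗ₕ[Mero r] z) = x ⊗ₕ[Mero r] app (Mero r) (lT (HCoeff 𝔤 r) φ) z :=
  app_lT_tens _ _ _

@[simp] lemma slot₂_tens (x y z : FSeries (HCoeff 𝔤 r)) :
    slot₂ φ (x ⊗ₕ[Mero r] (y ⊗ₕ[Mero r] z)) =
      x ⊗ₕ[Mero r] (app (Mero r) φ y ⊗ₕ[Mero r] z) := by
  simp [slot₂]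

@[simp] lemma slot₃_tens (x y z : FSeries (HCoeff 𝔤 r)) :
    slot₃ φ (x ⊗ₕ[Mero r] (y ⊗ₕ[Mero r] z)) =
      x ⊗ₕ[Mero r] (y ⊗ₕ[Mero r] app (Mero r) φ z) := by
  simp [slot₃]

end Slots

/-- Right multiplication by `∑ i, ∂_i ⊗ h_i ⊗ 1`. -/
noncomputable def theta₁₂ (h : Fin r → UEA 𝔤) : Module.End ℂ[X] (FSeries (HHHCoeff 𝔤 r)) :=
  ∑ i, slot₁ (rightPd 𝔤 i) * slot₂ (A.rightU r (h i))

/-- Right multiplication by `∑ i, ∂_i ⊗ 1 ⊗ h_i`. -/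
noncomputable def theta₁₃ (h : Fin r → UEA 𝔤) : Module.End ℂ[X] (FSeries (HHHCoeff 𝔤 r)) :=
  ∑ i, slot₁ (rightPd 𝔤 i) * slot₃ (A.rightU r (h i))

/-- Right multiplication by `∑ i, 1 ⊗ ∂_i ⊗ h_i`. -/
noncomputable def theta₂₃ (h : Fin r → UEA 𝔤) : Module.End ℂ[X] (FSeries (HHHCoeff 𝔤 r)) :=
  ∑ i, slot₂ (rightPd 𝔤 i) * slot₃ (A.rightU r (h i))

section Commute

lemma commute_of_tens {E E' : Module.End ℂ[X] (FSeries (HHHCoeff 𝔤 r))}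
    (h : ∀ x y z : FSeries (HCoeff 𝔤 r), E (E' (x ⊗ₕ[Mero r] (y ⊗ₕ[Mero r] z))) =
      E' (E (x ⊗ₕ[Mero r] (y ⊗ₕ[Mero r] z)))) : Commute E E' := by
  refine LinearMap.ext fun w => ?_
  rw [Module.End.mul_apply, Module.End.mul_apply]
  apply eq_of_tens w
  intro x v
  apply eq_of_tens v
  intro y z
  exact h x y z

variable {φ ψ : FSeries (HCoeff 𝔤 r →ₗ[Mero r] HCoeff 𝔤 r)}

lemma commute_slot₁_slot₂ : Commute (slot₁ φ) (slot₂ ψ) := commute_of_tens (by simp)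
lemma commute_slot₁_slot₃ : Commute (slot₁ φ) (slot₃ ψ) := commute_of_tens (by simp)
lemma commute_slot₂_slot₃ : Commute (slot₂ φ) (slot₃ ψ) := commute_of_tens (by simp)

lemma commute_slot₁ (h : ∀ x, app (Mero r) φ (app (Mero r) ψ x) =
    app (Mero r) ψ (app (Mero r) φ x)) : Commute (slot₁ φ) (slot₁ ψ) :=
  commute_of_tens (by simp [h])
lemma commute_slot₂ (h : ∀ x, app (Mero r) φ (app (Mero r) ψ x) =
    app (Mero r) ψ (app (Mero r) φ x)) : Commute (slot₂ φ) (slot₂ ψ) :=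
  commute_of_tens (by simp [h])
lemma commute_slot₃ (h : ∀ x, app (Mero r) φ (app (Mero r) ψ x) =
    app (Mero r) ψ (app (Mero r) φ x)) : Commute (slot₃ φ) (slot₃ ψ) :=
  commute_of_tens (by simp [h])

lemma rightPd_comm (i j : Fin r) (x : FSeries (HCoeff 𝔤 r)) :
    app (Mero r) (rightPd 𝔤 i) (app (Mero r) (rightPd 𝔤 j) x) =
      app (Mero r) (rightPd 𝔤 j) (app (Mero r) (rightPd 𝔤 i) x) := by
  apply eq_of_C_tens x
  intro d u
  rw [app_rightPd, app_rightPd, app_rightPd, app_rightPd, _root_.mul_assoc, DiffOp.pd_comm,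
    _root_.mul_assoc]

lemma rightPd_rightU_comm (i : Fin r) (h : UEA 𝔤) (x : FSeries (HCoeff 𝔤 r)) :
    app (Mero r) (rightPd 𝔤 i) (app (Mero r) (A.rightU r h) x) =
      app (Mero r) (A.rightU r h) (app (Mero r) (rightPd 𝔤 i) x) := by
  apply eq_of_C_tens x
  intro d u
  simp

variable {h : Fin r → UEA 𝔤}

lemma commute_theta₁₂_theta₁₃ : Commute (A.theta₁₂ h) (A.theta₁₃ h) :=
  Commute.sum_left _ _ _ fun i _ => Commute.sum_right _ _ _ fun j _ =>
    ((commute_slot₁ (rightPd_comm i j)).mul_right commute_slot₁_slot₃).mul_left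
      (commute_slot₁_slot₂.symm.mul_right commute_slot₂_slot₃)

lemma commute_theta₁₂_theta₂₃ : Commute (A.theta₁₂ h) (A.theta₂₃ h) :=
  Commute.sum_left _ _ _ fun i _ => Commute.sum_right _ _ _ fun j _ =>
    (commute_slot₁_slot₂.mul_right commute_slot₁_slot₃).mul_left
      ((commute_slot₂ fun x => (A.rightPd_rightU_comm j (h i) x).symm).mul_right
        commute_slot₂_slot₃)

variable (hc : ∀ i j, A.umul (C (h i)) (C (h j)) = A.umul (C (h j)) (C (h i)))
include hc

lemma rightU_comm (i j : Fin r) (x : FSeries (HCoeff 𝔤 r)) :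
    app (Mero r) (A.rightU r (h i)) (app (Mero r) (A.rightU r (h j)) x) =
      app (Mero r) (A.rightU r (h j)) (app (Mero r) (A.rightU r (h i)) x) := by
  apply eq_of_C_tens x
  intro d u
  simp only [app_rightU, umul_assoc, hc i j]

lemma commute_theta₁₃_theta₂₃ : Commute (A.theta₁₃ h) (A.theta₂₃ h) :=
  Commute.sum_left _ _ _ fun i _ => Commute.sum_right _ _ _ fun j _ =>
    (commute_slot₁_slot₂.mul_right commute_slot₁_slot₃).mul_left
      (commute_slot₂_slot₃.symm.mul_right (commute_slot₃ (A.rightU_comm hc i j)))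

lemma commute_slot₃_theta (i : Fin r) :
    Commute (slot₃ (A.rightU r (h i))) (A.theta₁₃ h + A.theta₂₃ h) :=
  (Commute.sum_right _ _ _ fun j _ => commute_slot₁_slot₃.symm.mul_right
    (commute_slot₃ (A.rightU_comm hc i j))).add_right
  (Commute.sum_right _ _ _ fun j _ => commute_slot₂_slot₃.symm.mul_right
    (commute_slot₃ (A.rightU_comm hc i j)))

end Commute
end QUEAlgebra

/-! ### Both sides of the cocycle equation -/

/-- If `B(F, θ w) = τ B(F, w) + ∑ i, qᵢ B(δᵢ F, w)`, where `τ` commutes with the `qᵢ`, then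
`B(F, exp(ħθ) w) = exp(ħτ) ∑ ħᵏ/k! (Sᵏ B)(F, w)`, where `(S B)(F, w) = ∑ i, qᵢ B(δᵢ F, w)`. -/
theorem FSeries.map_fexp_of_twisted {ι α W Z : Type*} [AddCommGroup W] [Module ℂ W]
    [AddCommGroup Z] [Module ℂ Z] (s : Finset ι)
    (B : α → FSeries W →ₗ[Polynomial ℂ] FSeries Z)
    (θ : Module.End (Polynomial ℂ) (FSeries W)) (τ : Module.End (Polynomial ℂ) (FSeries Z))
    (δ : ι → α → α) (q : ι → Module.End (Polynomial ℂ) (FSeries Z))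
    (hq : ∀ i ∈ s, Commute (q i) τ)
    (S : Module.End (Polynomial ℂ) (α → FSeries Z))
    (hS : ∀ Y F, S Y F = ∑ i ∈ s, q i (Y (δ i F)))
    (hB : ∀ F w, B F (θ w) = τ (B F w) + ∑ i ∈ s, q i (B (δ i F) w)) (F : α) (w : FSeries W) :
    B F (fexp θ w) = fexp τ (FSeries.sum fun k =>
      (k.factorial : ℂ)⁻¹ • (S ^ k) (fun F => B F w) F) := by
  -- On functions of `F`, the operator `B(F, w) ↦ B(F, θ w)` is the sum of the commuting operators
  -- `T` and `S`, so that its powers are given by the binomial theorem.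
  let T : Module.End (Polynomial ℂ) (α → FSeries Z) := LinearMap.compLeft τ α
  have hT : ∀ Y F, T Y F = τ (Y F) := fun _ _ => rfl
  have hTS : Commute T S := by
    refine LinearMap.ext fun Y => funext fun F => ?_
    simp only [Module.End.mul_apply, hT, hS, map_sum]
    refine Finset.sum_congr rfl fun i hi => ?_
    exact (LinearMap.congr_fun (hq i hi) (Y (δ i F))).symm
  have hpow : ∀ (k : ℕ) w, (fun F => B F ((θ ^ k) w)) = ((T + S) ^ k) fun F => B F w := by
    intro k
    induction k with
    | zero => intro w; simp
    | succ k ih =>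
      intro w
      rw [pow_succ, pow_succ, Module.End.mul_apply, Module.End.mul_apply, ih]
      congr 1
      funext F
      rw [hB, LinearMap.add_apply, Pi.add_apply, hT, hS]
  have hTpow : ∀ (k : ℕ) Y F, (T ^ k) Y F = (τ ^ k) (Y F) := by
    intro k
    induction k with
    | zero => intro Y F; simp
    | succ k ih => intro Y F; rw [pow_succ, pow_succ, Module.End.mul_apply, ih]; rfl
  have h1 : ∀ k : ℕ, B F ((k.factorial : ℂ)⁻¹ • (θ ^ k) w) =
      ∑ p ∈ Finset.HasAntidiagonal.antidiagonal k, ((p.1.factorial : ℂ)⁻¹ * (p.2.factorial : ℂ)⁻¹) •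
        (τ ^ p.1) ((S ^ p.2) (fun F => B F w) F) := fun k => by
    rw [LinearMap.map_smul_of_tower, congrFun (hpow k w) F, ← Pi.smul_apply, ← LinearMap.smul_apply,
      inv_factorial_smul_add_pow hTS]
    simp [LinearMap.sum_apply, Finset.sum_apply, hTpow]
  rw [fexp_apply, map_series_sum]
  simp only [h1]
  rw [fexp_apply, ← sum_sum (fun a c => ((a.factorial : ℂ)⁻¹ * (c.factorial : ℂ)⁻¹) •
        (τ ^ a) ((S ^ c) (fun F => B F w) F))]
  congr 1
  funext k
  rw [← LinearMap.smul_apply, map_series_sum]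
  simp only [LinearMap.smul_apply, LinearMap.map_smul_of_tower, smul_smul]

namespace QUEAlgebra
open TensorProduct FSeries
open scoped Polynomial

variable {𝔤 : Type*} [LieRing 𝔤] [LieAlgebra ℂ 𝔤] (A : QUEAlgebra 𝔤) {r : ℕ}

/-- The map `f ⊗ ((u ⊗ v) ⊗ w) ↦ (f ⊗ u) ⊗ ((1 ⊗ v) ⊗ (1 ⊗ w))` to the coefficients of
`H ⊗_R H ⊗_R H`. -/
noncomputable def iota₃Coeff (𝔤 : Type*) [LieRing 𝔤] [LieAlgebra ℂ 𝔤] (r : ℕ) :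
    Mero r ⊗[ℂ] ((UEA 𝔤 ⊗[ℂ] UEA 𝔤) ⊗[ℂ] UEA 𝔤) →ₗ[ℂ] HHHCoeff 𝔤 r :=
  (TensorProduct.assoc (Mero r) (HCoeff 𝔤 r) (HCoeff 𝔤 r)
      (HCoeff 𝔤 r)).toLinearMap.restrictScalars ℂ ∘ₗ
    mapOfCompatibleSMul (Mero r) ℂ ℂ (HHCoeff 𝔤 r) (HCoeff 𝔤 r) ∘ₗ
    TensorProduct.map (toBalanced ∘ₗ embed) (TensorProduct.mk ℂ (DiffOp r) (UEA 𝔤) 1) ∘ₗ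
    (TensorProduct.assoc ℂ (Mero r) (UEA 𝔤 ⊗[ℂ] UEA 𝔤) (UEA 𝔤)).symm.toLinearMap

lemma iota₃Coeff_tmul (f : Mero r) (u v w : UEA 𝔤) :
    iota₃Coeff 𝔤 r (f ⊗ₜ ((u ⊗ₜ v) ⊗ₜ w)) =
      (DiffOp.ofMero f ⊗ₜ u) ⊗ₜ ((1 ⊗ₜ v) ⊗ₜ (1 ⊗ₜ w)) := rfl

/-- The map `d ⊗ u ↦ d(1) u` from `H` to functions with values in `U_ħ𝔤`. -/
noncomputable def symbolZero (𝔤 : Type*) [LieRing 𝔤] [LieAlgebra ℂ 𝔤] (r : ℕ) :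
    HCoeff 𝔤 r →ₗ[Mero r] Mero r ⊗[ℂ] UEA 𝔤 :=
  AlgebraTensorModule.map DiffOp.evalOne LinearMap.id

lemma symbolZero_tmul (f : Mero r) (u : UEA 𝔤) :
    symbolZero 𝔤 r (DiffOp.ofMero f ⊗ₜ u) = f ⊗ₜ u := by
  simp [symbolZero, DiffOp.evalOne, DiffOp.toEnd_ofMero]

lemma symbolZero_one_tmul (u : UEA 𝔤) : symbolZero 𝔤 r (1 ⊗ₜ u) = 1 ⊗ₜ u := by
  rw [← symbolZero_tmul, map_one]

lemma iota₃Coeff_injective : Function.Injective (iota₃Coeff 𝔤 r) := by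
  -- A left inverse is obtained by evaluating the differential operators at the function `1` in each
  -- of the three factors.
  let L : HHHCoeff 𝔤 r →ₗ[Mero r] Mero r ⊗[ℂ] (UEA 𝔤 ⊗[ℂ] (UEA 𝔤 ⊗[ℂ] UEA 𝔤)) :=
    (AlgebraTensorModule.distribBaseChange ℂ (Mero r) (UEA 𝔤)
        (UEA 𝔤 ⊗[ℂ] UEA 𝔤)).symm.toLinearMap ∘ₗ
      TensorProduct.map (symbolZero 𝔤 r)
        ((AlgebraTensorModule.distribBaseChange ℂ (Mero r) (UEA 𝔤) (UEA 𝔤)).symm.toLinearMap ∘ₗ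
          TensorProduct.map (symbolZero 𝔤 r) (symbolZero 𝔤 r))
  let L' : HHHCoeff 𝔤 r →ₗ[ℂ] Mero r ⊗[ℂ] ((UEA 𝔤 ⊗[ℂ] UEA 𝔤) ⊗[ℂ] UEA 𝔤) :=
    (TensorProduct.assoc ℂ (UEA 𝔤) (UEA 𝔤) (UEA 𝔤)).symm.toLinearMap.lTensor (Mero r) ∘ₗ
      L.restrictScalars ℂ
  have hL : L' ∘ₗ iota₃Coeff 𝔤 r = LinearMap.id := by
    refine TensorProduct.ext' fun f z => ?_
    induction z using TensorProduct.induction_on with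
    | zero => simp
    | add a b ha hb => rw [tmul_add, map_add, map_add, ha, hb]
    | tmul z w =>
      induction z using TensorProduct.induction_on with
      | zero => simp
      | add a b ha hb => rw [add_tmul, tmul_add, map_add, map_add, ha, hb]
      | tmul u v =>
        rw [LinearMap.comp_apply, iota₃Coeff_tmul]
        simp only [L', L, LinearMap.comp_apply, LinearMap.restrictScalars_apply,
          TensorProduct.map_tmul, symbolZero_tmul, symbolZero_one_tmul]
        simp [AlgebraTensorModule.distribBaseChange]
  exact Function.LeftInverse.injective (g := L') fun x => LinearMap.congr_fun hL x

/-- The map from functions with values in `U_ħ𝔤 ⊗ U_ħ𝔤 ⊗ U_ħ𝔤` to `H ⊗_R H ⊗_R H`. -/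
noncomputable def iota₃ (𝔤 : Type*) [LieRing 𝔤] [LieAlgebra ℂ 𝔤] (r : ℕ) :
    FSeries (Mero r ⊗[ℂ] ((UEA 𝔤 ⊗[ℂ] UEA 𝔤) ⊗[ℂ] UEA 𝔤)) →ₗ[ℂ[X]] FSeries (HHHCoeff 𝔤 r) :=
  app ℂ (C (iota₃Coeff 𝔤 r))

lemma iota₃_injective : Function.Injective (iota₃ 𝔤 r) := app_C_injective iota₃Coeff_injective

@[simp] lemma iota₃_tens (f : Mero r) (u v w : FSeries (UEA 𝔤)) :
    iota₃ 𝔤 r (C f ⊗ₕ[ℂ] ((u ⊗ₕ[ℂ] v) ⊗ₕ[ℂ] w)) =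
      (C (DiffOp.ofMero f) ⊗ₕ[ℂ] u) ⊗ₕ[Mero r]
        ((C 1 ⊗ₕ[ℂ] v) ⊗ₕ[Mero r] (C 1 ⊗ₕ[ℂ] w)) := by
  apply eq_of_C u
  intro u
  apply eq_of_C v
  intro v
  apply eq_of_C w
  intro w
  simp only [← C_tmul, iota₃, app_C_C, iota₃Coeff_tmul]

lemma bil_mul₃_tens (a b : FSeries (UEA 𝔤 ⊗[ℂ] UEA 𝔤)) (u v : FSeries (UEA 𝔤)) :
    bil ℂ ℂ (ofSeq A.mul₃) (a ⊗ₕ[ℂ] u) (b ⊗ₕ[ℂ] v) = A.umul₂ a b ⊗ₕ[ℂ] A.umul u v :=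
  tensorMul_tens _ _ _ _ _ _

/-- The isomorphism `(H ⊗_R H) ⊗_R H → H ⊗_R (H ⊗_R H)`. -/
noncomputable def assocH (𝔤 : Type*) [LieRing 𝔤] [LieAlgebra ℂ 𝔤] (r : ℕ) :
    FSeries (HHCoeff 𝔤 r ⊗[Mero r] HCoeff 𝔤 r) →ₗ[ℂ[X]] FSeries (HHHCoeff 𝔤 r) :=
  app (Mero r) (C (TensorProduct.assoc (Mero r) (HCoeff 𝔤 r) (HCoeff 𝔤 r)
    (HCoeff 𝔤 r)).toLinearMap)

@[simp] lemma assocH_tens (x y z : FSeries (HCoeff 𝔤 r)) :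
    assocH 𝔤 r ((x ⊗ₕ[Mero r] y) ⊗ₕ[Mero r] z) = x ⊗ₕ[Mero r] (y ⊗ₕ[Mero r] z) :=
  app_assoc_tens _ _ _

/-- The element `(Δ ⊗_R id)(w) G¹²`, for `w` and `G` in `H ⊗_R H`. -/
noncomputable def leftSide (G : FSeries (HHCoeff 𝔤 r)) :
    FSeries (HHCoeff 𝔤 r) →ₗ[ℂ[X]] FSeries (HHHCoeff 𝔤 r) :=
  assocH 𝔤 r ∘ₗ app (Mero r) (rT (HCoeff 𝔤 r) (ofSeq (A.actOn G)))

/-- The element `(id ⊗_R Δ)(w) G²³`, for `w` and `G` in `H ⊗_R H`. -/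
noncomputable def rightSide (G : FSeries (HHCoeff 𝔤 r)) :
    FSeries (HHCoeff 𝔤 r) →ₗ[ℂ[X]] FSeries (HHHCoeff 𝔤 r) :=
  app (Mero r) (lT (HCoeff 𝔤 r) (ofSeq (A.actOn G)))

lemma leftSide_tens (G : FSeries (HHCoeff 𝔤 r)) (x y : FSeries (HCoeff 𝔤 r)) :
    A.leftSide G (x ⊗ₕ[Mero r] y) = assocH 𝔤 r (A.hAct r x G ⊗ₕ[Mero r] y) := by
  rw [leftSide, LinearMap.comp_apply, app_rT_tens, app_actOn]

lemma rightSide_tens (G : FSeries (HHCoeff 𝔤 r)) (x y : FSeries (HCoeff 𝔤 r)) :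
    A.rightSide G (x ⊗ₕ[Mero r] y) = x ⊗ₕ[Mero r] A.hAct r y G := by
  rw [rightSide, app_lT_tens, app_actOn]

section Slots
variable (φ : FSeries (HCoeff 𝔤 r →ₗ[Mero r] HCoeff 𝔤 r)) (z : FSeries (HHCoeff 𝔤 r))
  (y : FSeries (HCoeff 𝔤 r))

lemma assocH_rT : assocH 𝔤 r (app (Mero r) (rT (HCoeff 𝔤 r) φ) z ⊗ₕ[Mero r] y) =
    slot₁ φ (assocH 𝔤 r (z ⊗ₕ[Mero r] y)) := by
  apply eq_of_tens z
  intro a b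
  simp

lemma assocH_lT : assocH 𝔤 r (app (Mero r) (lT (HCoeff 𝔤 r) φ) z ⊗ₕ[Mero r] y) =
    slot₂ φ (assocH 𝔤 r (z ⊗ₕ[Mero r] y)) := by
  apply eq_of_tens z
  intro a b
  simp

lemma assocH_right : assocH 𝔤 r (z ⊗ₕ[Mero r] app (Mero r) φ y) =
    slot₃ φ (assocH 𝔤 r (z ⊗ₕ[Mero r] y)) := by
  apply eq_of_tens z
  intro a b
  simp

end Slots

/-- The twist in the argument `G` of `leftSide` comes out as a right multiplication, because right
multiplications commute with the left multiplications by the `Δ(x)`. -/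
lemma leftSide_fexp (h : Fin r → UEA 𝔤) (G w : FSeries (HHCoeff 𝔤 r)) :
    A.leftSide (fexp (A.theta₂ h) G) w = fexp (A.theta₁₂ h) (A.leftSide G w) := by
  apply eq_of_tens w
  intro x y
  rw [leftSide_tens, leftSide_tens]
  refine map_fexp (assocH 𝔤 r ∘ₗ (tens (Mero r)).flip y ∘ₗ A.hAct r x) (fun G => ?_) G
  simp only [LinearMap.comp_apply, LinearMap.flip_apply, hAct_theta₂]
  generalize A.hAct r x G = z
  simp only [theta₂, theta₁₂, LinearMap.sum_apply, LinearMap.comp_apply, map_sum, assocH_rT,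
    assocH_lT, Module.End.mul_apply]

lemma rightSide_fexp (h : Fin r → UEA 𝔤) (G w : FSeries (HHCoeff 𝔤 r)) :
    A.rightSide (fexp (A.theta₂ h) G) w = fexp (A.theta₂₃ h) (A.rightSide G w) := by
  apply eq_of_tens w
  intro x y
  rw [rightSide_tens, rightSide_tens]
  refine map_fexp (tens (Mero r) x ∘ₗ A.hAct r y) (fun G => ?_) G
  simp only [LinearMap.comp_apply, hAct_theta₂]
  simp only [theta₂, theta₂₃, LinearMap.sum_apply, LinearMap.comp_apply, map_sum,
    Module.End.mul_apply, slot₂_tens', slot₃_tens']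

/-- Moving `∑ i, Δ(∂_i) ⊗ h_i` past `F¹²` differentiates `F`, by the Leibniz rule; the derivative
`∂F/∂λ_i` comes with a factor `h_i` in the third place. -/
lemma leftSide_theta₂ (h : Fin r → UEA 𝔤) (F : FSeries (Mero r ⊗[ℂ] (UEA 𝔤 ⊗[ℂ] UEA 𝔤)))
    (w : FSeries (HHCoeff 𝔤 r)) :
    A.leftSide (iota₂ 𝔤 r F) (A.theta₂ h w) =
      (A.theta₁₃ h + A.theta₂₃ h) (A.leftSide (iota₂ 𝔤 r F) w) +
        ∑ i, slot₃ (A.rightU r (h i)) (A.leftSide (iota₂ 𝔤 r (mpd _ i F)) w) := by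
  apply eq_of_tens w
  intro x y
  simp only [theta₂_tens, map_sum, leftSide_tens, hAct_rightPd, dAct_pd_iota₂, map_add,
    (A.commLeft_rightPd _).hAct_rT, (A.commLeft_rightPd _).hAct_lT, LinearMap.add_apply,
    assocH_right, assocH_rT, assocH_lT, theta₁₃, theta₂₃, LinearMap.sum_apply,
    Module.End.mul_apply, Finset.sum_add_distrib]
  have h1 : ∀ i (z : FSeries (HHHCoeff 𝔤 r)),
      slot₃ (A.rightU r (h i)) (slot₁ (rightPd 𝔤 i) z) =
      slot₁ (rightPd 𝔤 i) (slot₃ (A.rightU r (h i)) z) := fun i z =>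
    LinearMap.congr_fun commute_slot₁_slot₃.symm z
  have h2 : ∀ i (z : FSeries (HHHCoeff 𝔤 r)),
      slot₃ (A.rightU r (h i)) (slot₂ (rightPd 𝔤 i) z) =
      slot₂ (rightPd 𝔤 i) (slot₃ (A.rightU r (h i)) z) := fun i z =>
    LinearMap.congr_fun commute_slot₂_slot₃.symm z
  simp only [h1, h2]
  abel

/-- For `F` of zero weight, `∑ i, ∂_i ⊗ Δ₀(h_i)` moves past `F²³`. -/
lemma rightSide_theta₂ {h : Fin r → UEA 𝔤} {F : FSeries (Mero r ⊗[ℂ] (UEA 𝔤 ⊗[ℂ] UEA 𝔤))}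
    (hF : ∀ i, A.leftUU r (A.ucomul (C (h i))) (iota₂ 𝔤 r F) =
      app (Mero r) (rT (HCoeff 𝔤 r) (A.rightU r (h i))) (iota₂ 𝔤 r F) +
        app (Mero r) (lT (HCoeff 𝔤 r) (A.rightU r (h i))) (iota₂ 𝔤 r F))
    (w : FSeries (HHCoeff 𝔤 r)) :
    A.rightSide (iota₂ 𝔤 r F) (A.theta₂ h w) =
      (A.theta₁₂ h + A.theta₁₃ h) (A.rightSide (iota₂ 𝔤 r F) w) := by
  apply eq_of_tens w
  intro x y
  simp only [theta₂_tens, map_sum, rightSide_tens, hAct_rightU, hF, map_add,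
    (A.commLeft_rightU _).hAct_rT, (A.commLeft_rightU _).hAct_lT, LinearMap.add_apply,
    theta₁₂, theta₁₃, LinearMap.sum_apply, Module.End.mul_apply, Finset.sum_add_distrib,
    slot₂_tens', slot₃_tens', slot₁_tens]

/-! ### The shifted cocycle equation -/

/-- The map `Δ₀ ⊗ id` on functions with values in `U_ħ𝔤 ⊗ U_ħ𝔤`. -/
noncomputable def comulLeft (r : ℕ) : FSeries (Mero r ⊗[ℂ] (UEA 𝔤 ⊗[ℂ] UEA 𝔤)) →ₗ[ℂ[X]]
    FSeries (Mero r ⊗[ℂ] ((UEA 𝔤 ⊗[ℂ] UEA 𝔤) ⊗[ℂ] UEA 𝔤)) :=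
  app ℂ (ofSeq fun n => ((A.comul n).rTensor (UEA 𝔤)).lTensor (Mero r))

/-- The map `id ⊗ Δ₀` on functions with values in `U_ħ𝔤 ⊗ U_ħ𝔤`. -/
noncomputable def comulRight (r : ℕ) : FSeries (Mero r ⊗[ℂ] (UEA 𝔤 ⊗[ℂ] UEA 𝔤)) →ₗ[ℂ[X]]
    FSeries (Mero r ⊗[ℂ] ((UEA 𝔤 ⊗[ℂ] UEA 𝔤) ⊗[ℂ] UEA 𝔤)) :=
  app ℂ (ofSeq fun n => ((TensorProduct.assoc ℂ (UEA 𝔤) (UEA 𝔤) (UEA 𝔤)).symm.toLinearMap ∘ₗ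
        (A.comul n).lTensor (UEA 𝔤)).lTensor (Mero r))

/-- The map `F ↦ F²³`. -/
noncomputable def embed₂₃ (𝔤 : Type*) [LieRing 𝔤] [LieAlgebra ℂ 𝔤] (r : ℕ) :
    FSeries (Mero r ⊗[ℂ] (UEA 𝔤 ⊗[ℂ] UEA 𝔤)) →ₗ[ℂ[X]]
    FSeries (Mero r ⊗[ℂ] ((UEA 𝔤 ⊗[ℂ] UEA 𝔤) ⊗[ℂ] UEA 𝔤)) :=
  app ℂ (C (((TensorProduct.assoc ℂ (UEA 𝔤) (UEA 𝔤) (UEA 𝔤)).symm.toLinearMap ∘ₗ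
    TensorProduct.mk ℂ (UEA 𝔤) (UEA 𝔤 ⊗[ℂ] UEA 𝔤) 1).lTensor (Mero r)))

/-- The map `F ↦ F ⊗ u`. -/
noncomputable def tensU (r : ℕ) : FSeries (Mero r ⊗[ℂ] (UEA 𝔤 ⊗[ℂ] UEA 𝔤)) →ₗ[ℂ[X]]
    FSeries (UEA 𝔤) →ₗ[ℂ[X]] FSeries (Mero r ⊗[ℂ] ((UEA 𝔤 ⊗[ℂ] UEA 𝔤) ⊗[ℂ] UEA 𝔤)) :=
  LinearMap.compr₂ (tens ℂ)
    (app ℂ (C (TensorProduct.assoc ℂ (Mero r) (UEA 𝔤 ⊗[ℂ] UEA 𝔤) (UEA 𝔤)).toLinearMap))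

@[simp] lemma tensU_tens (f : FSeries (Mero r)) (a : FSeries (UEA 𝔤 ⊗[ℂ] UEA 𝔤))
    (u : FSeries (UEA 𝔤)) : tensU r (f ⊗ₕ[ℂ] a) u = f ⊗ₕ[ℂ] (a ⊗ₕ[ℂ] u) :=
  app_assoc_tens _ _ _

@[simp] lemma comulLeft_tens (f : Mero r) (u v : FSeries (UEA 𝔤)) :
    A.comulLeft r (C f ⊗ₕ[ℂ] (u ⊗ₕ[ℂ] v)) = C f ⊗ₕ[ℂ] (A.ucomul u ⊗ₕ[ℂ] v) := by
  rw [ucomul, ← app_rT_tens]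
  exact app_lT_tens (V := Mero r) (rT (UEA 𝔤) (ofSeq A.comul)) (C f) (u ⊗ₕ[ℂ] v)

@[simp] lemma comulRight_tens (f : Mero r) (u v : FSeries (UEA 𝔤)) :
    A.comulRight r (C f ⊗ₕ[ℂ] (u ⊗ₕ[ℂ] v)) = C f ⊗ₕ[ℂ]
      app ℂ (C (TensorProduct.assoc ℂ (UEA 𝔤) (UEA 𝔤) (UEA 𝔤)).symm.toLinearMap)
        (u ⊗ₕ[ℂ] A.ucomul v) := by
  refine (app_lT_tens (V := Mero r) (ofSeq fun n =>
    (TensorProduct.assoc ℂ (UEA 𝔤) (UEA 𝔤) (UEA 𝔤)).symm.toLinearMap ∘ₗ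
        (A.comul n).lTensor (UEA 𝔤)) (C f) (u ⊗ₕ[ℂ] v)).trans ?_
  refine congrArg (tens (V := Mero r) (W := (UEA 𝔤 ⊗[ℂ] UEA 𝔤) ⊗[ℂ] UEA 𝔤) ℂ (C f)) ?_
  rw [ucomul, ← app_lT_tens (V := UEA 𝔤)]
  generalize u ⊗ₕ[ℂ] v = z
  apply eq_of_C z
  intro z
  ext n
  simp [lT]

@[simp] lemma embed₂₃_tens (f : Mero r) (u v : FSeries (UEA 𝔤)) :
    embed₂₃ 𝔤 r (C f ⊗ₕ[ℂ] (u ⊗ₕ[ℂ] v)) = C f ⊗ₕ[ℂ] ((C 1 ⊗ₕ[ℂ] u) ⊗ₕ[ℂ] v) := by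
  rw [embed₂₃, app_C_lTensor_tens]
  congr 1
  apply eq_of_C u
  intro u
  apply eq_of_C v
  intro v
  simp only [← C_tmul, app_C_C]
  simp

lemma dAct_one (G : FSeries (HHCoeff 𝔤 r)) : dAct 1 G = G := by
  apply eq_of_C G
  intro G
  simp [dAct]

/-- Functions can be moved across `⊗_R`. -/
lemma tens_ofMero_mul (f : Mero r) (d e : DiffOp r) (u v : FSeries (UEA 𝔤))
    (y : FSeries (HCoeff 𝔤 r)) :
    (C d ⊗ₕ[ℂ] u) ⊗ₕ[Mero r] ((C (DiffOp.ofMero f * e) ⊗ₕ[ℂ] v) ⊗ₕ[Mero r] y) =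
      (C (DiffOp.ofMero f * d) ⊗ₕ[ℂ] u) ⊗ₕ[Mero r] ((C e ⊗ₕ[ℂ] v) ⊗ₕ[Mero r] y) := by
  apply eq_of_C u
  intro u
  apply eq_of_C v
  intro v
  apply eq_of_C y
  intro y
  simp only [← C_tmul]
  congr 1
  exact (smul_tmul f (d ⊗ₜ u : HCoeff 𝔤 r) ((e ⊗ₜ v : HCoeff 𝔤 r) ⊗ₜ[Mero r] y)).symm

lemma leftSide_iota₂ (F F' : FSeries (Mero r ⊗[ℂ] (UEA 𝔤 ⊗[ℂ] UEA 𝔤))) :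
    A.leftSide (iota₂ 𝔤 r F) (iota₂ 𝔤 r F') =
      iota₃ 𝔤 r (mmul r A.mul₃ (A.comulLeft r F') (tensU r F (C 1))) := by
  apply eq_of_C_tens F'
  intro f' z'
  apply eq_of_tens z'
  intro u' v'
  rw [iota₂_tens, leftSide_tens, hAct_tens, leftUU_iota₂, comulLeft_tens]
  generalize A.ucomul u' = a
  apply eq_of_C_tens F
  intro f z
  apply eq_of_tens z
  intro u v
  apply eq_of_tens a
  intro a b
  rw [mmul_tens, tensU_tens, mmul_tens, bil_mul₃_tens, ← umul₂, umul₂_tens]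
  simp [umul_one]

lemma rightSide_iota₂ (F F' : FSeries (Mero r ⊗[ℂ] (UEA 𝔤 ⊗[ℂ] UEA 𝔤))) :
    A.rightSide (iota₂ 𝔤 r F) (iota₂ 𝔤 r F') =
      iota₃ 𝔤 r (mmul r A.mul₃ (A.comulRight r F') (embed₂₃ 𝔤 r F)) := by
  apply eq_of_C_tens F'
  intro f' z'
  apply eq_of_tens z'
  intro u' v'
  rw [iota₂_tens, rightSide_tens, hAct_tens, dAct_one, leftUU_iota₂, comulRight_tens]
  generalize A.ucomul v' = a
  apply eq_of_C_tens F
  intro f z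
  apply eq_of_tens z
  intro u v
  apply eq_of_tens a
  intro a b
  rw [mmul_tens, embed₂₃_tens, app_assoc_symm_tens, mmul_tens, bil_mul₃_tens, ← umul₂, umul₂_tens,
    umul₂_tens, iota₂_tens, iota₃_tens, umul_one, _root_.one_mul,
    ← _root_.mul_one (DiffOp.ofMero f), tens_ofMero_mul, mul_comm f' f, map_mul DiffOp.ofMero]

section Shift
variable {η : LieSubalgebra ℂ 𝔤} (b : Module.Basis (Fin r) ℂ η)

/-- The term `∂ⁿF/∂λ_{i₁}⋯∂λ_{iₙ} ⊗ h_{i₁} ⋯ h_{iₙ}` of the shifted function. -/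
noncomputable def shiftTerm (l : List (Fin r)) (F : FSeries (Mero r ⊗[ℂ] (UEA 𝔤 ⊗[ℂ] UEA 𝔤))) :
    FSeries (Mero r ⊗[ℂ] ((UEA 𝔤 ⊗[ℂ] UEA 𝔤) ⊗[ℂ] UEA 𝔤)) :=
  tensU r (app ℂ (C ((Mero.iterPderiv l).rTensor (UEA 𝔤 ⊗[ℂ] UEA 𝔤))) F)
    (ofSeq (A.wordProd b l))

lemma ofSeq_shift (F : FSeries (Mero r ⊗[ℂ] (UEA 𝔤 ⊗[ℂ] UEA 𝔤))) :
    ofSeq (A.shift b F) = FSeries.sum fun k => (k.factorial : ℂ)⁻¹ •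
      ∑ i : Fin k → Fin r, A.shiftTerm b (List.ofFn i) F := by
  ext n
  simp only [FSeries.sum, FSeries.smul_apply, FSeries.sum_apply, ofSeq_apply, shift, shiftTerm,
    tensU, LinearMap.compr₂_apply, app_C_left_coeff, tens_coeff, map_sum]
  rfl

lemma wordProd_append (l : List (Fin r)) (i : Fin r) :
    ofSeq (A.wordProd b (l ++ [i])) =
      A.umul (ofSeq (A.wordProd b l)) (C (UEA.of 𝔤 (b i))) := by
  induction l with
  | nil =>
    change A.umul (C (UEA.of 𝔤 (b i))) (C 1) = A.umul (C 1) (C (UEA.of 𝔤 (b i)))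
    rw [umul_one, one_umul]
  | cons j l ih =>
    change A.umul (C (UEA.of 𝔤 (b j))) (ofSeq (A.wordProd b (l ++ [i]))) = A.umul
      (A.umul (C (UEA.of 𝔤 (b j))) (ofSeq (A.wordProd b l))) (C (UEA.of 𝔤 (b i)))
    rw [ih, umul_assoc]

lemma iterPderiv_append (l : List (Fin r)) (i : Fin r) (f : Mero r) :
    Mero.iterPderiv (l ++ [i]) f = Mero.iterPderiv l (Mero.pderiv i f) := by
  induction l with
  | nil => rfl
  | cons j l ih => exact congrArg (Mero.pderiv j) ih

lemma slot₃_iota₃ (D : FSeries (Mero r ⊗[ℂ] ((UEA 𝔤 ⊗[ℂ] UEA 𝔤) ⊗[ℂ] UEA 𝔤)))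
    (F : FSeries (Mero r ⊗[ℂ] (UEA 𝔤 ⊗[ℂ] UEA 𝔤))) (u : FSeries (UEA 𝔤)) (h : UEA 𝔤) :
    slot₃ (A.rightU r h) (iota₃ 𝔤 r (mmul r A.mul₃ D (tensU r F u))) =
      iota₃ 𝔤 r (mmul r A.mul₃ D (tensU r F (A.umul u (C h)))) := by
  apply eq_of_C_tens D
  intro f z
  apply eq_of_tens z
  intro a v
  apply eq_of_C_tens F
  intro f' a'
  rw [tensU_tens, tensU_tens, mmul_tens, mmul_tens, bil_mul₃_tens, bil_mul₃_tens, ← umul_assoc]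
  generalize A.umul₂ a a' = x
  apply eq_of_tens x
  intro x y
  simp

/-- The operator that differentiates `F` and multiplies by `h_i` in the third place, summed over `i`,
produces the sum over the words of length `k` in `F¹²(λ + ħh⁽³⁾)` as its `k`-th power. -/
lemma pow_sum_slot₃ (D : FSeries (Mero r ⊗[ℂ] ((UEA 𝔤 ⊗[ℂ] UEA 𝔤) ⊗[ℂ] UEA 𝔤)))
    (S : Module.End ℂ[X] (FSeries (Mero r ⊗[ℂ] (UEA 𝔤 ⊗[ℂ] UEA 𝔤)) → FSeries (HHHCoeff 𝔤 r)))
    (hS : ∀ Y F, S Y F = ∑ i, slot₃ (A.rightU r (UEA.of 𝔤 (b i))) (Y (mpd _ i F))) (k : ℕ)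
    (F : FSeries (Mero r ⊗[ℂ] (UEA 𝔤 ⊗[ℂ] UEA 𝔤))) :
    (S ^ k) (fun F => iota₃ 𝔤 r (mmul r A.mul₃ D (tensU r F (C 1)))) F =
      ∑ i : Fin k → Fin r, iota₃ 𝔤 r (mmul r A.mul₃ D (A.shiftTerm b (List.ofFn i) F)) := by
  induction k generalizing F with
  | zero =>
    have h : app ℂ (C ((Mero.iterPderiv []).rTensor (UEA 𝔤 ⊗[ℂ] UEA 𝔤))) F = F := by
      apply eq_of_C F
      intro F
      simp [Mero.iterPderiv]
    simp only [pow_zero, Module.End.one_apply, Finset.univ_unique, Finset.sum_singleton,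
      List.ofFn_zero, shiftTerm, h]
    rfl
  | succ k ih =>
    -- The factors `h_i` multiply from the right, so that words grow at their end.
    rw [pow_succ', Module.End.mul_apply, hS, ← (Fin.snocEquiv fun _ => Fin r).sum_comp,
      Fintype.sum_prod_type]
    refine Finset.sum_congr rfl fun i _ => ?_
    rw [ih, map_sum]
    refine Finset.sum_congr rfl fun l _ => ?_
    have hl : List.ofFn (Fin.snocEquiv (fun _ => Fin r) (i, l)) = List.ofFn l ++ [i] := by
      rw [List.ofFn_succ_last]
      simp [Fin.snocEquiv]
    have hd : app ℂ (C ((Mero.iterPderiv (List.ofFn l ++ [i])).rTensor (UEA 𝔤 ⊗[ℂ] UEA 𝔤))) F =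
        app ℂ (C ((Mero.iterPderiv (List.ofFn l)).rTensor (UEA 𝔤 ⊗[ℂ] UEA 𝔤))) (mpd _ i F) := by
      apply eq_of_C_tens F
      intro f w
      rw [mpd_tens, app_C_rTensor_tens, app_C_rTensor_tens, iterPderiv_append]
    rw [hl, shiftTerm, shiftTerm, wordProd_append, slot₃_iota₃, hd]

/-- The left-hand side of the cocycle equation for `F(λ)Θ`, without the factor `Θ¹²`: the shifted
product `(Δ₀ ⊗ id)F · F¹²(λ + ħh⁽³⁾)`, twisted by `Θ¹³Θ²³`. -/
theorem leftSide_twist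
    (hc : ∀ i j, A.umul (C (UEA.of 𝔤 (b i))) (C (UEA.of 𝔤 (b j))) =
      A.umul (C (UEA.of 𝔤 (b j))) (C (UEA.of 𝔤 (b i))))
    (F F' : FSeries (Mero r ⊗[ℂ] (UEA 𝔤 ⊗[ℂ] UEA 𝔤))) :
    A.leftSide (iota₂ 𝔤 r F) (fexp (A.theta₂ fun i => UEA.of 𝔤 (b i)) (iota₂ 𝔤 r F')) =
      fexp (A.theta₁₃ (fun i => UEA.of 𝔤 (b i)) + A.theta₂₃ (fun i => UEA.of 𝔤 (b i)))
        (iota₃ 𝔤 r (mmul r A.mul₃ (A.comulLeft r F') (ofSeq (A.shift b F)))) := by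
  let S : Module.End ℂ[X]
      (FSeries (Mero r ⊗[ℂ] (UEA 𝔤 ⊗[ℂ] UEA 𝔤)) → FSeries (HHHCoeff 𝔤 r)) :=
    { toFun := fun Y F => ∑ i, slot₃ (A.rightU r (UEA.of 𝔤 (b i))) (Y (mpd _ i F))
      map_add' := fun Y Y' => by funext F; simp [Finset.sum_add_distrib]
      map_smul' := fun c Y => by funext F; simp [Finset.smul_sum] }
  rw [map_fexp_of_twisted Finset.univ (fun F => A.leftSide (iota₂ 𝔤 r F)) _ _
    (fun i F => mpd _ i F) (fun i => slot₃ (A.rightU r (UEA.of 𝔤 (b i))))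
    (fun i _ => A.commute_slot₃_theta (h := fun i => UEA.of 𝔤 (b i)) hc i) S (fun _ _ => rfl)
    (A.leftSide_theta₂ fun i => UEA.of 𝔤 (b i)) F (iota₂ 𝔤 r F')]
  simp only [leftSide_iota₂]
  refine congrArg (fexp _) ?_
  rw [ofSeq_shift, map_series_sum, map_series_sum]
  simp only [LinearMap.map_smul_of_tower, map_sum,
    A.pow_sum_slot₃ b (A.comulLeft r F') S (fun _ _ => rfl)]

/-- The right-hand side of the cocycle equation for `F(λ)Θ`, without the factor `Θ²³`: the product
`(id ⊗ Δ₀)F · F²³`, twisted by `Θ¹²Θ¹³`. -/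
theorem rightSide_twist {h : Fin r → UEA 𝔤} {F : FSeries (Mero r ⊗[ℂ] (UEA 𝔤 ⊗[ℂ] UEA 𝔤))}
    (hF : ∀ i, A.leftUU r (A.ucomul (C (h i))) (iota₂ 𝔤 r F) =
      app (Mero r) (rT (HCoeff 𝔤 r) (A.rightU r (h i))) (iota₂ 𝔤 r F) +
        app (Mero r) (lT (HCoeff 𝔤 r) (A.rightU r (h i))) (iota₂ 𝔤 r F))
    (F' : FSeries (Mero r ⊗[ℂ] (UEA 𝔤 ⊗[ℂ] UEA 𝔤))) :
    A.rightSide (iota₂ 𝔤 r F) (fexp (A.theta₂ h) (iota₂ 𝔤 r F')) =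
      fexp (A.theta₁₂ h + A.theta₁₃ h)
        (iota₃ 𝔤 r (mmul r A.mul₃ (A.comulRight r F') (embed₂₃ 𝔤 r F))) := by
  rw [map_fexp _ (A.rightSide_theta₂ hF), rightSide_iota₂]

end Shift
end QUEAlgebra

/-! ### The counit equations -/

namespace QUEAlgebra
open TensorProduct FSeries
open scoped Polynomial

variable {𝔤 : Type*} [LieRing 𝔤] [LieAlgebra ℂ 𝔤] (A : QUEAlgebra 𝔤) {r : ℕ}

/-- The counit of `U_ħ𝔤`. -/
noncomputable def ucounit : FSeries (UEA 𝔤) →ₗ[ℂ[X]] FSeries ℂ := app ℂ (ofSeq A.counit)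

/-- The counit of a primitive element vanishes. -/
lemma ucounit_primitive {h : UEA 𝔤}
    (hh : A.ucomul (C h) = C h ⊗ₕ[ℂ] C 1 + C 1 ⊗ₕ[ℂ] C h) : A.ucounit (C h) = 0 := by
  have h1 : app ℂ (ofSeq fun n => TensorProduct.lid ℂ (UEA 𝔤) ∘ₗ (A.counit n).rTensor (UEA 𝔤))
    (A.ucomul (C h)) = C h := A.rTensor_counit_comul (C h)
  have h2 : A.ucounit (C 1) = C 1 := A.counit_one
  -- Compare the coefficients of `(ε₀ ⊗ id)Δ₀h = ε₀(h)1 + h` and `h`, and apply the classical counit.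
  ext n
  have h3 := congrFun h1 n
  have h4 := congrFun h2 n
  rw [ucounit, app_C_right_coeff, ofSeq_apply] at h4
  rw [hh, ← C_tmul, ← C_tmul, ← map_add, app_C_right_coeff, ofSeq_apply, map_add] at h3
  simp only [LinearMap.comp_apply, LinearMap.rTensor_tmul, LinearEquiv.coe_coe,
    TensorProduct.lid_tmul, h4] at h3
  have h5 : (C 1 : FSeries ℂ) n • h = (C h : FSeries (UEA 𝔤)) n := by
    cases n <;> simp
  rw [h5, add_eq_right] at h3
  have h6 := congrArg (UEA.counit 𝔤) h3
  rw [ucounit, app_C_right_coeff]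
  rw [map_zero, map_smul, map_one, smul_eq_mul, _root_.mul_one] at h6
  exact h6

lemma ucounit_umul (x y : FSeries (UEA 𝔤)) (hy : A.ucounit y = 0) :
    A.ucounit (A.umul x y) = 0 := by
  have h : A.ucounit (A.umul x y) = bil ℂ ℂ (C (LinearMap.mul ℂ ℂ)) (A.ucounit x) (A.ucounit y) :=
    A.counit_mul x y
  rw [h, hy, map_zero]

/-- The counit of `H`. -/
noncomputable def hcounit (r : ℕ) : FSeries (HCoeff 𝔤 r) →ₗ[ℂ[X]] FSeries (Mero r) :=
  app (Mero r) (ofSeq A.counitH)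

lemma counitH_tmul (n : ℕ) (d : DiffOp r) (u : UEA 𝔤) :
    A.counitH n (d ⊗ₜ u) = A.counit n u • DiffOp.evalOne d := by
  simp [counitH]

lemma hcounit_tens (d : DiffOp r) (u : FSeries (UEA 𝔤)) :
    A.hcounit r (C d ⊗ₕ[ℂ] u) =
      app ℂ (C (LinearMap.toSpanSingleton ℂ (Mero r) (DiffOp.evalOne d))) (A.ucounit u) := by
  apply eq_of_C u
  intro u
  ext n
  rw [← C_tmul, hcounit, app_C_right_coeff, ofSeq_apply, counitH_tmul, ucounit, app_C_left_coeff,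
    app_C_right_coeff]
  simp

/-- The operator `d ∂_i` kills the function `1`. -/
lemma hcounit_rightPd (i : Fin r) (x : FSeries (HCoeff 𝔤 r)) :
    A.hcounit r (app (Mero r) (rightPd 𝔤 i) x) = 0 := by
  apply eq_of_C_tens (g := fun _ => 0) x (hg := ⟨by simp, by simp⟩)
  · intro d u
    have hd : DiffOp.evalOne (d * DiffOp.pd i) = 0 := by
      simp [DiffOp.evalOne, DiffOp.toEnd_pd]
    rw [app_rightPd, hcounit_tens, hd]
    simp

lemma hcounit_rightU {h : UEA 𝔤} (hh : A.ucounit (C h) = 0) (x : FSeries (HCoeff 𝔤 r)) :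
    A.hcounit r (app (Mero r) (A.rightU r h) x) = 0 := by
  apply eq_of_C_tens (g := fun _ => 0) x (hg := ⟨by simp, by simp⟩)
  · intro d u
    rw [app_rightU, hcounit_tens, A.ucounit_umul u (C h) hh]
    simp

/-- The map `ε ⊗_R id`. -/
noncomputable def counitLeft (r : ℕ) : FSeries (HHCoeff 𝔤 r) →ₗ[ℂ[X]] FSeries (HCoeff 𝔤 r) :=
  app (Mero r) (ofSeq fun n => (TensorProduct.lid (Mero r) (HCoeff 𝔤 r)).toLinearMap ∘ₗ
      (A.counitH n).rTensor (HCoeff 𝔤 r))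

/-- The map `id ⊗_R ε`. -/
noncomputable def counitRight (r : ℕ) : FSeries (HHCoeff 𝔤 r) →ₗ[ℂ[X]] FSeries (HCoeff 𝔤 r) :=
  app (Mero r) (ofSeq fun n => (TensorProduct.rid (Mero r) (HCoeff 𝔤 r)).toLinearMap ∘ₗ
      (A.counitH n).lTensor (HCoeff 𝔤 r))

lemma counitLeft_tens (x y : FSeries (HCoeff 𝔤 r)) : A.counitLeft r (x ⊗ₕ[Mero r] y) =
    app (Mero r) (C (TensorProduct.lid (Mero r) (HCoeff 𝔤 r)).toLinearMap)
      (A.hcounit r x ⊗ₕ[Mero r] y) := by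
  rw [hcounit, ← app_rT_tens]
  generalize x ⊗ₕ[Mero r] y = z
  apply eq_of_C z
  intro z
  ext n
  rw [counitLeft, app_C_right_coeff, app_C_left_coeff, app_C_right_coeff]
  rfl

lemma counitRight_tens (x y : FSeries (HCoeff 𝔤 r)) : A.counitRight r (x ⊗ₕ[Mero r] y) =
    app (Mero r) (C (TensorProduct.rid (Mero r) (HCoeff 𝔤 r)).toLinearMap)
      (x ⊗ₕ[Mero r] A.hcounit r y) := by
  rw [hcounit, ← app_lT_tens]
  generalize x ⊗ₕ[Mero r] y = z
  apply eq_of_C z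
  intro z
  ext n
  rw [counitRight, app_C_right_coeff, app_C_left_coeff, app_C_right_coeff]
  rfl

lemma counitLeft_theta₂ (h : Fin r → UEA 𝔤) (w : FSeries (HHCoeff 𝔤 r)) :
    A.counitLeft r (A.theta₂ h w) = 0 := by
  apply eq_of_tens (g := fun _ => 0) w (hg := ⟨by simp, by simp⟩)
  · intro x y
    simp [counitLeft_tens, hcounit_rightPd]

lemma counitRight_theta₂ {h : Fin r → UEA 𝔤} (hh : ∀ i, A.ucounit (C (h i)) = 0)
    (w : FSeries (HHCoeff 𝔤 r)) : A.counitRight r (A.theta₂ h w) = 0 := by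
  apply eq_of_tens (g := fun _ => 0) w (hg := ⟨by simp, by simp⟩)
  · intro x y
    simp [counitRight_tens, A.hcounit_rightU (hh _)]

/-- The map from functions with values in `U_ħ𝔤` to `H`. -/
noncomputable def iota₁ (𝔤 : Type*) [LieRing 𝔤] [LieAlgebra ℂ 𝔤] (r : ℕ) :
    FSeries (Mero r ⊗[ℂ] UEA 𝔤) →ₗ[ℂ[X]] FSeries (HCoeff 𝔤 r) :=
  app ℂ (C (DiffOp.ofMero.toLinearMap.rTensor (UEA 𝔤)))

lemma iota₁_injective : Function.Injective (iota₁ 𝔤 r) := by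
  refine app_C_injective (Function.LeftInverse.injective (g := symbolZero 𝔤 r) fun x => ?_)
  induction x using TensorProduct.induction_on with
  | zero => simp
  | add a b ha hb => rw [map_add, map_add, ha, hb]
  | tmul f u => exact symbolZero_tmul f u

lemma counitLeft_iota₂ (F : FSeries (Mero r ⊗[ℂ] (UEA 𝔤 ⊗[ℂ] UEA 𝔤))) :
    A.counitLeft r (iota₂ 𝔤 r F) = iota₁ 𝔤 r
      (app ℂ (ofSeq fun n => ((TensorProduct.lid ℂ (UEA 𝔤)).toLinearMap ∘ₗ
      (A.counit n).rTensor (UEA 𝔤)).lTensor (Mero r)) F) := by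
  apply eq_of_C_tens F
  intro f z
  apply eq_of_tens z
  intro u v
  apply eq_of_C u
  intro u
  apply eq_of_C v
  intro v
  ext n
  rw [iota₂_tens]
  simp only [← C_tmul]
  rw [counitLeft, app_C_right_coeff, iota₁, app_C_left_coeff, app_C_right_coeff]
  simp [counitH_tmul, DiffOp.evalOne, DiffOp.toEnd_ofMero, TensorProduct.smul_tmul',
    DiffOp.smul_def]

lemma counitRight_iota₂ (F : FSeries (Mero r ⊗[ℂ] (UEA 𝔤 ⊗[ℂ] UEA 𝔤))) :
    A.counitRight r (iota₂ 𝔤 r F) = iota₁ 𝔤 r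
      (app ℂ (ofSeq fun n => ((TensorProduct.rid ℂ (UEA 𝔤)).toLinearMap ∘ₗ
      (A.counit n).lTensor (UEA 𝔤)).lTensor (Mero r)) F) := by
  apply eq_of_C_tens F
  intro f z
  apply eq_of_tens z
  intro u v
  apply eq_of_C u
  intro u
  apply eq_of_C v
  intro v
  ext n
  rw [iota₂_tens]
  simp only [← C_tmul]
  rw [counitRight, app_C_right_coeff, iota₁, app_C_left_coeff, app_C_right_coeff]
  simp only [LinearMap.comp_apply, ofSeq_apply, LinearMap.lTensor_tmul, counitH_tmul,
    LinearEquiv.coe_coe, LinearMap.rTensor_tmul]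
  refine (TensorProduct.rid_tmul _ _).trans ?_
  simp [DiffOp.evalOne, smul_assoc, one_smul]

lemma iota₁_one : iota₁ 𝔤 r (C (1 ⊗ₜ 1)) = C (1 ⊗ₜ 1) := by
  simp [iota₁]

end QUEAlgebra

open QUEAlgebra FSeries in
theorem mainTheorem4 {𝔤 : Type*} [LieRing 𝔤] [LieAlgebra ℂ 𝔤] (A : QUEAlgebra 𝔤)
    (η : LieSubalgebra ℂ 𝔤) [IsLieAbelian η] {r : ℕ} (b : Module.Basis (Fin r) ℂ η)
    (hcomm : ∀ h ∈ η, ∀ h' ∈ η, ∀ n,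
      A.mul n (UEA.of 𝔤 h) (UEA.of 𝔤 h') = A.mul n (UEA.of 𝔤 h') (UEA.of 𝔤 h))
    (hprim : ∀ h ∈ η, happ A.comul (hconst (UEA.of 𝔤 h)) =
      hconst (UEA.of 𝔤 h ⊗ₜ 1 + 1 ⊗ₜ UEA.of 𝔤 h))
    (F : ℕ → Mero r ⊗[ℂ] (UEA 𝔤 ⊗[ℂ] UEA 𝔤)) (hF : A.IsZeroWeight η F) :
    A.IsTwistor (A.twistElt b F) ↔ A.IsShiftedCocycle b F ∧ A.IsCounital F := by
  have hc : ∀ i j, A.umul (C (UEA.of 𝔤 (b i))) (C (UEA.of 𝔤 (b j))) =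
      A.umul (C (UEA.of 𝔤 (b j))) (C (UEA.of 𝔤 (b i))) := fun i j => by
    ext n
    rw [umul, bil_C_C_coeff, bil_C_C_coeff]
    exact hcomm _ (b i).2 _ (b j).2 n
  have hp : ∀ i, A.ucomul (C (UEA.of 𝔤 (b i))) =
      C (UEA.of 𝔤 (b i)) ⊗ₕ[ℂ] C 1 + C 1 ⊗ₕ[ℂ] C (UEA.of 𝔤 (b i)) := fun i => by
    rw [← C_tmul, ← C_tmul, ← map_add]
    exact hprim _ (b i).2
  have hw : ∀ i, A.leftUU r (A.ucomul (C (UEA.of 𝔤 (b i)))) (iota₂ 𝔤 r (ofSeq F)) =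
      app (Mero r) (rT (HCoeff 𝔤 r) (A.rightU r (UEA.of 𝔤 (b i)))) (iota₂ 𝔤 r (ofSeq F)) +
        app (Mero r) (lT (HCoeff 𝔤 r) (A.rightU r (UEA.of 𝔤 (b i)))) (iota₂ 𝔤 r (ofSeq F)) :=
      fun i => by
    refine A.leftUU_comul_iota₂ (hp i) ?_
    rw [← C_tmul, ← C_tmul, ← map_add, ← C_tmul, add_comm (UEA.of 𝔤 (b i) ⊗ₜ[ℂ] 1)]
    exact hF _ (b i).2
  have hT := A.ofSeq_twistElt b (ofSeq F)
  have hcocycle : A.leftSide (ofSeq (A.twistElt b F)) (ofSeq (A.twistElt b F)) =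
      A.rightSide (ofSeq (A.twistElt b F)) (ofSeq (A.twistElt b F)) ↔ A.IsShiftedCocycle b F := by
    have h12 := A.commute_theta₁₂_theta₁₃ (h := fun i => UEA.of 𝔤 (b i))
    have h23 := A.commute_theta₁₂_theta₂₃ (h := fun i => UEA.of 𝔤 (b i))
    have h33 := A.commute_theta₁₃_theta₂₃ (h := fun i => UEA.of 𝔤 (b i)) hc
    -- Both sides become `exp(ħ(θ₁₂ + θ₁₃ + θ₂₃))` applied to a side of the shifted cocycle equation.
    rw [show ofSeq (A.twistElt b F) = _ from hT, leftSide_fexp, rightSide_fexp,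
      A.leftSide_twist b hc, A.rightSide_twist hw, ← Module.End.mul_apply, ← Module.End.mul_apply,
      ← fexp_add (h12.add_right h23), ← fexp_add (h23.symm.add_right h33.symm),
      add_comm (A.theta₂₃ _), ← add_assoc, (fexp_injective _).eq_iff, iota₃_injective.eq_iff]
    rfl
  have hleft : A.counitLeft r (ofSeq (A.twistElt b F)) = C (1 ⊗ₜ 1) ↔
      app ℂ (ofSeq fun n => ((TensorProduct.lid ℂ (UEA 𝔤)).toLinearMap ∘ₗ
      (A.counit n).rTensor (UEA 𝔤)).lTensor (Mero r)) (ofSeq F) = C (1 ⊗ₜ 1) := by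
    rw [show ofSeq (A.twistElt b F) = _ from hT, map_fexp_of_map_eq_zero _ (A.counitLeft_theta₂ _),
      counitLeft_iota₂, ← iota₁_one, iota₁_injective.eq_iff]
  have hright : A.counitRight r (ofSeq (A.twistElt b F)) = C (1 ⊗ₜ 1) ↔
      app ℂ (ofSeq fun n => ((TensorProduct.rid ℂ (UEA 𝔤)).toLinearMap ∘ₗ
      (A.counit n).lTensor (UEA 𝔤)).lTensor (Mero r)) (ofSeq F) = C (1 ⊗ₜ 1) := by
    rw [show ofSeq (A.twistElt b F) = _ from hT, map_fexp_of_map_eq_zero _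
        (A.counitRight_theta₂ fun i => A.ucounit_primitive (hp i)),
      counitRight_iota₂, ← iota₁_one, iota₁_injective.eq_iff]
  exact ⟨fun h => ⟨hcocycle.1 h.cocycle, hleft.1 h.counit_left, hright.1 h.counit_right⟩,
    fun h => ⟨hcocycle.2 h.1, hleft.2 h.2.1, hright.2 h.2.2⟩⟩
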